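/- **Conventions.** On $\mathbb R^2$ with coordinates $x^1=x$, $x^2=y$ let $P=\varrho\,\partial_x\wedge\partial_y$ with $\varrho\in C^\infty(\mathbb R^2)$ arbitrary (every bi-vector on $\mathbb R^2$ is Poisson), i.e. $P^{12}=\varrho=-P^{21}$, and let $\omega_2=\mathrm dx\wedge\mathrm dy$; $\vec X=\omega_2^{-1}(\mathrm dH)$ means $\omega_2(\vec X,\cdot)=\mathrm dH$. The Schouten bracket is normalised by $[\![P,\vec X]\!]=-L_{\vec X}P$ and $[\![P,H]\!]^i=\sum_jP^{ij}\partial_jH$. A graph built of $n$ wedges has $n$ wedge tops, each issuing two arrows ordered Left $\prec$ Right, and possibly some vertices without outgoing arrows (sinks or terminal vertices); tadpoles are allowed. Its formula: put $P^{ij}$ into each top, where $i,j$ are the indices on its Left and Right arrows, put given functions into the other vertices, let each arrow with index $i$ act as $\partial/\partial x^i$ on the content of its head, multiply, and sum over all indices. Functions are encoded by graphs without sinks; vector fields by real linear combinations of *1-vector graphs* (one sink, of in-degree one), the component $X^i$ being the value on $x^i$; bi-vectors by graphs with two sinks $\bar 0,\bar 1$ of in-degree one, the component $Q^{ij}$ being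 the value on $(x^i,x^j)$. Let $\gamma_5$ be the pentagon-wheel graph cocycle with edges ordered by $$\gamma_5=12\wedge23\wedge34\wedge45\wedge51\wedge16\wedge26\wedge36\wedge46\wedge56+\tfrac52\cdot 12\wedge23\wedge34\wedge41\wedge45\wedge15\wedge56\wedge36\wedge26\wedge13 ,$$ and let $Q^{\gamma_5}_{d=2}(P)=\mathrm{Or}(\gamma_5)(P^{\otimes 6})$: for each of the two graphs, append to its ordered edges $E$ two arrows $S_0\wedge S_1$ to the sinks $\bar 0,\bar 1$, sum over all directings of the edges and all choices of the tails of $S_0,S_1$ such that exactly two arrows leave each of the six vertices, order Left $\prec$ Right at each vertex by the global order, and take the sign of the permutation from $E\wedge S_0\wedge S_1$ to $L_1\wedge R_1\wedge\dots\wedge L_6\wedge R_6$. **Statement.** Let $$\mathrm{Ham}^{\gamma_5}=6\cdot[3,4;4,5;1,2;1,3]-2\cdot[3,4;4,5;1,2;1,4]-2\cdot[1,5;1,4;1,2;1,3],$$ where $[L_2,R_2;L_3,R_3;L_4,R_4;L_5,R_5]$ is the graph built of four wedges with tops $2,3,4,5$, whose arrows head to the listed vertices, and one terminal vertex $1$,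 which contains $\varrho$. Let $\vec X^{\gamma_5}_{d=2}=\omega_2^{-1}(\mathrm d\,\mathrm{Ham}^{\gamma_5})$. Then: 1. $Q^{\gamma_5}_{d=2}(P)=[\![P,\vec X^{\gamma_5}_{d=2}]\!]$ for every $\varrho\in C^\infty(\mathbb R^2)$. 2. $\vec X^{\gamma_5}_{d=2}$ is encoded by $15=3\times5$ one-vector graphs built of five wedges over one sink: in each of the three graphs of $\mathrm{Ham}^{\gamma_5}$ (with its coefficient) issue a wedge from vertex $1$, sending its Left arrow to the sink and letting its Right arrow run over all the aerial vertices $1,\dots,5$. 3. Uniqueness: a real linear combination $X$ of 1-vector graphs on five wedges satisfies $Q^{\gamma_5}_{d=2}(P)=[\![P,\vec X(P)]\!]$ for all smooth $\varrho$ if and only if there is a real linear combination $H$ of graphs on four wedges (without sinks and terminal vertices) such that $\vec X(P)=\vec X^{\gamma_5}_{d=2}+[\![P,H(P)]\!]$ for all smooth $\varrho$. -/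

import Mathlib

open scoped ContDiff

noncomputable section

namespace GraphFlow

/-! ### Tensor fields on the affine plane -/

/-- The affine plane `ℝ²` with coordinates `x = x⁰`, `y = x¹`. -/
abbrev Plane := Fin 2 → ℝ

/-- Vector fields `X = ∑ i, Xⁱ ∂ᵢ`, given by their components. -/
abbrev VField := Plane → Fin 2 → ℝ

/-- Bi-vector fields, given by their components: `P(f, g) = ∑ i j, Pⁱʲ ∂ᵢf ∂ⱼg`. -/
abbrev BivField := Plane → Fin 2 → Fin 2 → ℝ

/-- The partial derivative `∂ᵢ f`. -/
def pderiv (i : Fin 2) (f : Plane → ℝ) : Plane → ℝ :=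
  fun x => fderiv ℝ f x (Pi.single i 1)

/-- The iterated partial derivative `∂₀^(α 0) ∂₁^(α 1) f`. -/
def mderiv (α : Fin 2 → ℕ) (f : Plane → ℝ) : Plane → ℝ :=
  (pderiv 0)^[α 0] ((pderiv 1)^[α 1] f)

/-- The bi-vector `P(ϱ) = ϱ ∂x ∧ ∂y`; every bi-vector on the plane has this form. -/
def bivector (ϱ : Plane → ℝ) : BivField :=
  fun x => ![![0, ϱ x], ![-ϱ x, 0]]

/-- The Schouten bracket `⟦P, X⟧ = -L_X P` of a bi-vector and a vector field. In terms of odd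
momenta `ξᵢ`, `P = ½ Pⁱʲ ξᵢ ξⱼ`, this is the case of a vector field `A = Xᵏ ξₖ` in
`⟦P, A⟧ = ∑ i, (P)∂⃖/∂ξᵢ · ∂ᵢA - (P)∂⃖ᵢ · ∂A/∂ξᵢ`. -/
def schoutenBV (P : BivField) (X : VField) : BivField := fun x i j =>
  -∑ k, (X x k * pderiv k (fun y => P y i j) x
    - P x k j * pderiv k (fun y => X y i) x
    - P x i k * pderiv k (fun y => X y j) x)

/-- The Schouten bracket `⟦P, H⟧` of a bi-vector and a function (the case of a function `A = H` in
the same formula): the Poisson vector field with Hamiltonian `H`. -/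
def schoutenBF (P : BivField) (H : Plane → ℝ) : VField := fun x i =>
  ∑ j, P x i j * pderiv j H x

/-- The standard symplectic form `ω₂ = dx ∧ dy`. -/
def omega (u v : Plane) : ℝ := u 0 * v 1 - u 1 * v 0

/-- The inverse of the isomorphism `u ↦ ω₂(u, ·)` from vectors to covectors. -/
def omegaInv (α : Plane →L[ℝ] ℝ) : Plane :=
  ![α (Pi.single 1 1), -α (Pi.single 0 1)]

theorem omega_omegaInv (α : Plane →L[ℝ] ℝ) (v : Plane) : omega (omegaInv α) v = α v := by
  have hv : v = v 0 • (Pi.single 0 1 : Plane) + v 1 • (Pi.single 1 1 : Plane) := by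
    ext i; fin_cases i <;> simp
  conv_rhs => rw [hv]
  simp [omega, omegaInv]
  ring

theorem omegaInv_unique (α : Plane →L[ℝ] ℝ) (u : Plane) (h : ∀ v, omega u v = α v) :
    u = omegaInv α := by
  ext i; fin_cases i <;> simp [omegaInv, ← h, omega]

/-! ### Directed graphs built of wedges, and their formulas -/

/-- Directed graphs on `k` vertices without outgoing arrows (sinks or terminal vertices) and `n`
wedge tops. Two arrows are issued from each top `v`, the Left one to `Γ v 0` and the Right one to
`Γ v 1`. Tadpoles are allowed. -/
abbrev WedgeGraph (k n : ℕ) := Fin n → Fin 2 → Fin k ⊕ Fin n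

/-- The number of arrows decorated with the index `i` that head to the vertex `v`, if the arrow
`s` from the top `w` is decorated with `I w s`. -/
def inCount {k n : ℕ} (Γ : WedgeGraph k n) (I : Fin n → Fin 2 → Fin 2) (v : Fin k ⊕ Fin n)
    (i : Fin 2) : ℕ :=
  (Finset.univ.filter fun e : Fin n × Fin 2 => Γ e.1 e.2 = v ∧ I e.1 e.2 = i).card

/-- The formula of a graph: a copy of `P` in every wedge top, the function `f s` in the vertex `s`
without outgoing arrows; each arrow decorated with `i` is `∂ᵢ` acting on the content of its head;
one sums over all the decorations. -/
def graphOp {k n : ℕ} (Γ : WedgeGraph k n) (P : BivField) (f : Fin k → Plane → ℝ) :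
    Plane → ℝ := fun x =>
  ∑ I : Fin n → Fin 2 → Fin 2,
    (∏ v, mderiv (inCount Γ I (Sum.inr v)) (fun y => P y (I v 0) (I v 1)) x) *
      ∏ s, mderiv (inCount Γ I (Sum.inl s)) (f s) x

/-- The formula of a real linear combination of graphs. -/
def comboOp {k n : ℕ} (c : WedgeGraph k n →₀ ℝ) (P : BivField) (f : Fin k → Plane → ℝ) :
    Plane → ℝ := fun x =>
  c.sum fun Γ a => a * graphOp Γ P f x

/-- A graph over one sink is a 1-vector graph if exactly one arrow heads to the sink. -/
def IsOneVector {n : ℕ} (Γ : WedgeGraph 1 n) : Prop :=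
  (Finset.univ.filter fun e : Fin n × Fin 2 => Γ e.1 e.2 = Sum.inl 0).card = 1

/-- The function encoded by graphs without sinks (all the vertices are wedge tops). -/
def functionOf {n : ℕ} (c : WedgeGraph 0 n →₀ ℝ) (P : BivField) : Plane → ℝ :=
  comboOp c P ![]

/-- The vector field encoded by 1-vector graphs: its component `Xⁱ` is its value `X(xⁱ)` on the
coordinate function. -/
def vectorOf {n : ℕ} (c : WedgeGraph 1 n →₀ ℝ) (P : BivField) : VField := fun x i =>
  comboOp c P ![fun y => y i] x

/-- The bi-vector encoded by graphs over two sinks (each of in-degree one): its component `Qⁱʲ` is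
its value `Q(xⁱ, xʲ)` on the coordinate functions. -/
def bivectorOf {n : ℕ} (c : WedgeGraph 2 n →₀ ℝ) (P : BivField) : BivField := fun x i j =>
  comboOp c P ![fun y => y i, fun y => y j] x

/-! ### Undirected graphs with ordered edges, and the orientation morphism -/

/-- Undirected graphs on `n` vertices with a global ordering `e₀ ∧ e₁ ∧ …` of their `m` edges. -/
abbrev EdgeGraph (n m : ℕ) := Fin m → Fin n × Fin n

/-- Tails of the arrows: the edges of `g` are directed by `o`, in the given order, and followed by
two new arrows, to the sinks `0` and `1`, issued from the vertices `s 0` and `s 1`. -/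
def tail {n m : ℕ} (g : EdgeGraph n m) (o : Fin m → Bool) (s : Fin 2 → Fin n) :
    Fin (m + 2) → Fin n :=
  Fin.append (fun a => if o a then (g a).1 else (g a).2) s

/-- Heads of the same arrows. -/
def head {n m : ℕ} (g : EdgeGraph n m) (o : Fin m → Bool) : Fin (m + 2) → Fin 2 ⊕ Fin n :=
  Fin.append (fun a => Sum.inr (if o a then (g a).2 else (g a).1)) Sum.inl

/-- The arrows issued from the vertex `v`, in the order inherited from the global ordering. -/
def outArrows {n m : ℕ} (t : Fin (m + 2) → Fin n) (v : Fin n) : List (Fin (m + 2)) :=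
  (List.finRange (m + 2)).filter fun a => t a = v

/-- The sign of the permutation that sorts the globally ordered arrows by their tails, that is,
takes them to `L₀ ∧ R₀ ∧ L₁ ∧ R₁ ∧ …` (`Lᵥ ≺ Rᵥ` are the arrows issued from the vertex `v`). -/
def arrowSign {n m : ℕ} (t : Fin (m + 2) → Fin n) : ℝ :=
  (-1) ^ (Finset.univ.filter fun p : Fin (m + 2) × Fin (m + 2) =>
    p.1 < p.2 ∧ t p.2 < t p.1).card

/-- The orientation morphism on one graph: the signed sum over all the ways to direct the edges and
to issue one new arrow to either of the two sinks such that the outcome is built of wedges. -/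
def orient {n m : ℕ} (g : EdgeGraph n m) : WedgeGraph 2 n →₀ ℝ :=
  ∑ o : Fin m → Bool, ∑ s : Fin 2 → Fin n,
    if h : ∀ v, (outArrows (tail g o s) v).length = 2 then
      Finsupp.single
        (fun v i => head g o ((outArrows (tail g o s) v).get (Fin.cast (h v).symm i)))
        (arrowSign (tail g o s))
    else 0

/-- The orientation morphism, extended by linearity. -/
def orientation {n m : ℕ} (γ : EdgeGraph n m →₀ ℝ) : WedgeGraph 2 n →₀ ℝ :=
  γ.sum fun g a => a • orient g

/-! ### The pentagon-wheel cocycle, its flow, and the Hamiltonian -/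

/-- The pentagon wheel: the rim `0, 1, 2, 3, 4` and the hub `5`. -/
def pentagonWheel : EdgeGraph 6 10 :=
  ![(0, 1), (1, 2), (2, 3), (3, 4), (4, 0), (0, 5), (1, 5), (2, 5), (3, 5), (4, 5)]

/-- The other graph of the pentagon-wheel cocycle: a triangular prism (with the triangles `0, 3, 4`
and `1, 2, 5`, joined by the edges `01`, `23`, `45`) with one diagonal `02`. -/
def prism : EdgeGraph 6 10 :=
  ![(0, 1), (1, 2), (2, 3), (3, 0), (3, 4), (0, 4), (4, 5), (2, 5), (1, 5), (0, 2)]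

/-- The pentagon-wheel graph cocycle `γ₅`; for these orderings of edges, the coefficient `5/2` is
the only one for which the vertex blow-up differential of the sum vanishes. -/
def gamma5 : EdgeGraph 6 10 →₀ ℝ :=
  Finsupp.single pentagonWheel 1 + Finsupp.single prism (5 / 2)

/-- The bi-vector `Q = Or(γ₅)(P, …, P)` of the flow `dP/dt = Q(P)`. -/
def flow5 (P : BivField) : BivField := bivectorOf (orientation gamma5) P

/-- Vertices labelled `1` (terminal) and `2, 3, 4, 5` (the wedge tops). -/
def vertex : ℕ → Fin 1 ⊕ Fin 4
  | 2 => Sum.inr 0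
  | 3 => Sum.inr 1
  | 4 => Sum.inr 2
  | 5 => Sum.inr 3
  | _ => Sum.inl 0

/-- The graph given by the list of the targets `[L₂, R₂; L₃, R₃; L₄, R₄; L₅, R₅]` of the arrows
issued from the tops `2, 3, 4, 5`. -/
def encoding (l : Fin 4 → Fin 2 → ℕ) : WedgeGraph 1 4 := fun v s => vertex (l v s)

/-- The Hamiltonian, as a linear combination of three graphs. -/
def hamGraphs5 : WedgeGraph 1 4 →₀ ℝ :=
  Finsupp.single (encoding ![![3, 4], ![4, 5], ![1, 2], ![1, 3]]) 6
    - Finsupp.single (encoding ![![3, 4], ![4, 5], ![1, 2], ![1, 4]]) 2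
    - Finsupp.single (encoding ![![1, 5], ![1, 4], ![1, 2], ![1, 3]]) 2

/-- The formula of the Hamiltonian: the terminal vertex contains `ϱ`. -/
def ham5 (ϱ : Plane → ℝ) : Plane → ℝ := comboOp hamGraphs5 (bivector ϱ) ![ϱ]

/-- The vector field `ω₂⁻¹(d Ham)`. -/
def field5 (ϱ : Plane → ℝ) : VField := fun x => omegaInv (fderiv ℝ (ham5 ϱ) x)

/-- Issue a wedge from the terminal vertex of `Γ`: it becomes the wedge top `0` (the old tops are
shifted by one), its Left arrow goes to the new sink and its Right arrow goes to the top `i`. -/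
def issueWedge {n : ℕ} (Γ : WedgeGraph 1 n) (i : Fin (n + 1)) : WedgeGraph 1 (n + 1) :=
  Fin.cons ![Sum.inl 0, Sum.inr i] fun v s =>
    Sum.elim (fun _ => Sum.inr 0) (fun w => Sum.inr w.succ) (Γ v s)

/-- The 1-vector graphs obtained from the graphs in the Hamiltonian by issuing a wedge from the
terminal vertex and letting its Right arrow run over all the five aerial vertices. -/
def fieldGraphs5 : WedgeGraph 1 5 →₀ ℝ :=
  hamGraphs5.sum fun Γ a => ∑ i : Fin 5, Finsupp.single (issueWedge Γ i) a

end GraphFlow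

end

noncomputable section

open MvPolynomial

namespace GraphFlow

/-! ### Partial derivatives of smooth functions -/

/-! The formula of a graph is a differential polynomial in ϱ, an element of `JetRing`. Every finite
jet occurs at the origin for a smooth ϱ (`exists_jet`), so an identity valid for all ϱ is an
identity in `JetRing`. Differential polynomials are in turn handled through symbols: each vertex v
containing ϱ carries a formal covector ζ_v, an arrow into v is a component of ζ_v, a wedge is the
bracket of the covectors at its two heads, and a graph is a product of brackets. `ofSymb` turns
powers of ζ_v into derivatives of ϱ, and the total derivative D_i becomes multiplication by the sum
of the components ζ_{v,i}.

Existence. In the plane the bracket of P = ϱ ∂x ∧ ∂y with Y is determined by the one component ϱ div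
Y - Y(ϱ). For the divergence-free field ω₂⁻¹(d Ham) it equals ϱ_y D₀Ham - ϱ_x D₁Ham. The component
(0, 1) of the orientation of γ₅ is compared with it by an exact integer computation in the kernel,
and antisymmetry (`orientJet_swap`) gives the other components. The graph encoding of the field is
the Leibniz rule: the Right arrow that runs over all the vertices multiplies the symbol of Ham by
the sum of the covectors (`sum_graphSymb_issueWedge`).

Uniqueness. Let Y be the difference of two solutions, so Y(ϱ) = ϱ div Y. Setting the variable ϱ to
zero gives Y = ϱ Z + g (ϱ_y, -ϱ_x) with g free of ϱ. Substituting back yields ϱ_y D₀g - ϱ_x D₁g = 0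
and div Z = 0. The first equation makes g constant, and homogeneity makes it zero
(`exists_hamiltonian`). In symmetric symbols, on which `ofSymb` is injective, div Z = 0 reads σ₀ w₀
+ σ₁ w₁ = 0 with σ_i the sum of the ζ_{v,i}. As σ₀ and σ₁ are coprime, w₀ = σ₁ h and w₁ = -σ₀ h.
Linear equivariance of graph formulas passes to h, and the first fundamental theorem for SL₂, proved
from Capelli's identity (`mem_span_brackets`), writes h as a combination of products of four
brackets. Such products are exactly the symbols of sinkless graphs on four wedges. -/

theorem contDiff_pderiv {f : Plane → ℝ} (hf : ContDiff ℝ ∞ f) (i : Fin 2) :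
    ContDiff ℝ ∞ (pderiv i f) :=
  (hf.fderiv_right (m := ∞) (by simp)).clm_apply contDiff_const

theorem contDiff_iterate_pderiv {f : Plane → ℝ} (hf : ContDiff ℝ ∞ f) (i : Fin 2) (n : ℕ) :
    ContDiff ℝ ∞ ((pderiv i)^[n] f) := by
  induction n with
  | zero => exact hf
  | succ n ih => rw [Function.iterate_succ_apply']; exact contDiff_pderiv ih i

theorem contDiff_mderiv {f : Plane → ℝ} (hf : ContDiff ℝ ∞ f) (α : Fin 2 → ℕ) :
    ContDiff ℝ ∞ (mderiv α f) :=
  contDiff_iterate_pderiv (contDiff_iterate_pderiv hf 1 _) 0 _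

theorem pderiv_comm {f : Plane → ℝ} (hf : ContDiff ℝ ∞ f) (i j : Fin 2) :
    pderiv i (pderiv j f) = pderiv j (pderiv i f) := by
  have key (i j : Fin 2) (x : Plane) :
      pderiv i (pderiv j f) x
        = fderiv ℝ (fderiv ℝ f) x (Pi.single i 1) (Pi.single j 1) := by
    have hd : DifferentiableAt ℝ (fderiv ℝ f) x :=
      ((hf.fderiv_right (m := ∞) (by simp)).differentiable (by simp)) x
    unfold pderiv
    rw [fderiv_clm_apply hd (differentiableAt_const _)]
    simp
  funext x
  rw [key, key]
  have hs : IsSymmSndFDerivAt ℝ f x :=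
    (hf.contDiffAt (x := x)).isSymmSndFDerivAt
      (by simpa using WithTop.coe_le_coe.2 (le_top : (2 : ℕ∞) ≤ ⊤))
  exact hs _ _

theorem pderiv_one_iterate_zero {f : Plane → ℝ} (hf : ContDiff ℝ ∞ f) (n : ℕ) :
    pderiv 1 ((pderiv 0)^[n] f) = (pderiv 0)^[n] (pderiv 1 f) := by
  induction n with
  | zero => rfl
  | succ n ih =>
    rw [Function.iterate_succ_apply', pderiv_comm (contDiff_iterate_pderiv hf 0 n), ih,
      Function.iterate_succ_apply']

theorem pderiv_const_mul {f : Plane → ℝ} (hf : ContDiff ℝ ∞ f) (c : ℝ) (i : Fin 2) :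
    pderiv i (fun x => c * f x) = fun x => c * pderiv i f x := by
  funext x
  unfold pderiv
  rw [fderiv_const_mul (hf.differentiable (by simp) x)]
  simp

theorem iterate_pderiv_const_mul {f : Plane → ℝ} (hf : ContDiff ℝ ∞ f) (c : ℝ) (i : Fin 2)
    (n : ℕ) : (pderiv i)^[n] (fun x => c * f x) = fun x => c * (pderiv i)^[n] f x := by
  induction n with
  | zero => rfl
  | succ n ih =>
    rw [Function.iterate_succ_apply', ih, pderiv_const_mul (contDiff_iterate_pderiv hf i n)]
    simp [Function.iterate_succ_apply']

theorem mderiv_const_mul {f : Plane → ℝ} (hf : ContDiff ℝ ∞ f) (c : ℝ) (α : Fin 2 → ℕ) :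
    mderiv α (fun x => c * f x) = fun x => c * mderiv α f x := by
  unfold mderiv
  rw [iterate_pderiv_const_mul hf,
    iterate_pderiv_const_mul (contDiff_iterate_pderiv hf 1 (α 1))]

theorem pderiv_coord (i j : Fin 2) :
    pderiv j (fun y : Plane => y i) = fun _ => if i = j then 1 else 0 := by
  funext x
  unfold pderiv
  have h : HasFDerivAt (fun y : Plane => y i)
      (ContinuousLinearMap.proj (R := ℝ) (φ := fun _ : Fin 2 => ℝ) i) x :=
    (ContinuousLinearMap.proj (R := ℝ) (φ := fun _ : Fin 2 => ℝ) i).hasFDerivAt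
  rw [h.fderiv]
  simp [Pi.single_apply]

/-- First derivatives of coordinate functions. -/
theorem mderiv_coord (i : Fin 2) (α : Fin 2 → ℕ) (hα : α 0 + α 1 = 1) (x : Plane) :
    mderiv α (fun y => y i) x = ∏ j, (if i = j then 1 else 0 : ℝ) ^ α j := by
  have h : (α 0 = 0 ∧ α 1 = 1) ∨ (α 0 = 1 ∧ α 1 = 0) := by omega
  rcases h with ⟨h0, h1⟩ | ⟨h0, h1⟩ <;> simp [mderiv, h0, h1, pderiv_coord]

/-! ### Differential polynomials -/

/-- The ring of differential polynomials: the variable `(a, b)` stands for `∂₀ᵃ ∂₁ᵇ ϱ`. -/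
abbrev JetRing := MvPolynomial (ℕ × ℕ) ℝ

/-- Raise the order of differentiation with respect to the coordinate `i`. -/
def shift (i : Fin 2) (p : ℕ × ℕ) : ℕ × ℕ := ![(p.1 + 1, p.2), (p.1, p.2 + 1)] i

/-- The total derivative with respect to the coordinate `i`. -/
def totalD (i : Fin 2) : Derivation ℝ JetRing JetRing := mkDerivation ℝ fun p => X (shift i p)

@[simp] theorem totalD_X (i : Fin 2) (p : ℕ × ℕ) :
    totalD i (X p) = (X (shift i p) : JetRing) := by
  simp [totalD]

/-- The derivatives of `ϱ` at the point `x`. -/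
def jet (ϱ : Plane → ℝ) (x : Plane) (p : ℕ × ℕ) : ℝ := mderiv ![p.1, p.2] ϱ x

/-- The value of a differential polynomial on a function. -/
def jetEval (ϱ : Plane → ℝ) (p : JetRing) : Plane → ℝ := fun x => eval (jet ϱ x) p

theorem pderiv_jet {ϱ : Plane → ℝ} (hϱ : ContDiff ℝ ∞ ϱ) (i : Fin 2) (p : ℕ × ℕ) :
    pderiv i (fun x => jet ϱ x p) = fun x => jet ϱ x (shift i p) := by
  have h : pderiv i (mderiv ![p.1, p.2] ϱ) = mderiv ![(shift i p).1, (shift i p).2] ϱ := by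
    fin_cases i
    · simp [mderiv, shift, Function.iterate_succ_apply']
    · simp only [mderiv, shift]
      rw [show (⟨1, by decide⟩ : Fin 2) = 1 from rfl,
        pderiv_one_iterate_zero (contDiff_iterate_pderiv hϱ 1 _)]
      simp [Function.iterate_succ_apply']
  exact h

theorem contDiff_jetEval {ϱ : Plane → ℝ} (hϱ : ContDiff ℝ ∞ ϱ) (p : JetRing) :
    ContDiff ℝ ∞ (jetEval ϱ p) := by
  unfold jetEval
  induction p using MvPolynomial.induction_on with
  | C a => simpa using contDiff_const
  | add p q hp hq => simpa using hp.add hq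
  | mul_X p n hp => simpa using hp.mul (show ContDiff ℝ ∞ fun x => jet ϱ x n from contDiff_mderiv hϱ _)

theorem pderiv_jetEval {ϱ : Plane → ℝ} (hϱ : ContDiff ℝ ∞ ϱ) (i : Fin 2) (p : JetRing) :
    pderiv i (jetEval ϱ p) = jetEval ϱ (totalD i p) := by
  have hd (p : JetRing) (x : Plane) : DifferentiableAt ℝ (jetEval ϱ p) x :=
    (contDiff_jetEval hϱ p).differentiable (by simp) x
  induction p using MvPolynomial.induction_on with
  | C a =>
    have : jetEval ϱ (C a) = fun _ => a := by ext; simp [jetEval]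
    funext x
    simp [this, pderiv]
    simp [jetEval]
  | add p q hp hq =>
    funext x
    have : jetEval ϱ (p + q) = jetEval ϱ p + jetEval ϱ q := by ext; simp [jetEval]
    rw [this]
    unfold pderiv at hp hq ⊢
    rw [fderiv_add (hd p x) (hd q x)]
    simpa [jetEval] using congrArg₂ (· + ·) (congrFun hp x) (congrFun hq x)
  | mul_X p n hp =>
    funext x
    have : jetEval ϱ (p * X n) = jetEval ϱ p * jetEval ϱ (X n) := by ext; simp [jetEval]
    rw [this]
    have hX : pderiv i (jetEval ϱ (X n)) x = jet ϱ x (shift i n) := by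
      have := congrFun (pderiv_jet hϱ i n) x
      rwa [show (fun x => jet ϱ x n) = jetEval ϱ (X n) by ext; simp [jetEval]] at this
    have hp' := congrFun hp x
    unfold pderiv at hp' hX ⊢
    rw [fderiv_mul (hd p x) (hd (X n) x)]
    simp only [add_apply, smul_apply, hp', hX]
    simp [jetEval]

/-! ### A differential polynomial that vanishes on all functions is zero -/

/-- The function of a polynomial in two variables. -/
def polyFun (q : MvPolynomial (Fin 2) ℝ) : Plane → ℝ := fun x => eval x q

theorem contDiff_polyFun (q : MvPolynomial (Fin 2) ℝ) : ContDiff ℝ ∞ (polyFun q) := by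
  unfold polyFun
  induction q using MvPolynomial.induction_on with
  | C a => simpa using contDiff_const
  | add p q hp hq => simpa using hp.add hq
  | mul_X p n hp => simpa using hp.mul (contDiff_apply ℝ ℝ n)

theorem pderiv_polyFun (i : Fin 2) (q : MvPolynomial (Fin 2) ℝ) :
    pderiv i (polyFun q) = polyFun (MvPolynomial.pderiv i q) := by
  have hd (p : MvPolynomial (Fin 2) ℝ) (x : Plane) : DifferentiableAt ℝ (polyFun p) x :=
    (contDiff_polyFun p).differentiable (by simp) x
  induction q using MvPolynomial.induction_on with
  | C a =>
    have : polyFun (C a) = fun _ => a := by ext; simp [polyFun]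
    funext x
    simp [this, pderiv]
    simp [polyFun]
  | add p q hp hq =>
    funext x
    have : polyFun (p + q) = polyFun p + polyFun q := by ext; simp [polyFun]
    rw [this]
    unfold pderiv at hp hq ⊢
    rw [fderiv_add (hd p x) (hd q x)]
    simpa [polyFun] using congrArg₂ (· + ·) (congrFun hp x) (congrFun hq x)
  | mul_X p n hp =>
    funext x
    have : polyFun (p * X n) = polyFun p * polyFun (X n) := by ext; simp [polyFun]
    rw [this]
    have hX : pderiv i (polyFun (X n)) x = if n = i then 1 else 0 := by
      have := congrFun (pderiv_coord n i) x
      rwa [show (fun y : Plane => y n) = polyFun (X n) by ext; simp [polyFun]] at this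
    have hp' := congrFun hp x
    unfold pderiv at hp' hX ⊢
    rw [fderiv_mul (hd p x) (hd (X n) x)]
    simp only [add_apply, smul_apply, hp', hX]
    simp [polyFun, pderiv_X, Pi.single_apply, apply_ite]

theorem iterate_pderiv_polyFun (i : Fin 2) (n : ℕ) (q : MvPolynomial (Fin 2) ℝ) :
    (pderiv i)^[n] (polyFun q) = polyFun ((MvPolynomial.pderiv i)^[n] q) := by
  induction n with
  | zero => rfl
  | succ n ih => simp only [Function.iterate_succ_apply', ih, pderiv_polyFun]

/-- The rising factorial (m i + 1)⋯(m i + n) collects the exponents brought down by the successive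
derivatives. For m i = 0 it is n!, the denominator in Taylor coefficients. -/
theorem coeff_iterate_pderiv (i : Fin 2) (n : ℕ) (q : MvPolynomial (Fin 2) ℝ)
    (m : Fin 2 →₀ ℕ) :
    coeff m ((MvPolynomial.pderiv i)^[n] q)
      = coeff (m + Finsupp.single i n) q * (m i + 1).ascFactorial n := by
  induction n generalizing m with
  | zero => simp
  | succ n ih =>
    rw [Function.iterate_succ_apply', coeff_pderiv, ih, add_assoc, ← Finsupp.single_add,
      add_comm 1 n]
    have h := Nat.succ_ascFactorial (m i + 1) n
    rw [← Nat.ascFactorial_succ] at h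
    rw [← h]
    simp
    ring

/-- Every finite jet is the jet of a smooth function. -/
theorem exists_jet (s : Finset (ℕ × ℕ)) (z : ℕ × ℕ → ℝ) :
    ∃ ϱ : Plane → ℝ, ContDiff ℝ ∞ ϱ ∧ ∀ p ∈ s, jet ϱ 0 p = z p := by
  classical
  let e : ℕ × ℕ → (Fin 2 →₀ ℕ) := fun p => Finsupp.single 0 p.1 + Finsupp.single 1 p.2
  have he : ∀ p q, e p = e q → p = q := by
    intro p q h
    have h0 := DFunLike.congr_fun h 0
    have h1 := DFunLike.congr_fun h 1
    simp [e] at h0 h1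
    exact Prod.ext h0 h1
  -- The Taylor polynomial at the origin with the prescribed derivatives.
  let q : MvPolynomial (Fin 2) ℝ :=
    ∑ p ∈ s, monomial (e p) (z p / (p.1.factorial * p.2.factorial : ℝ))
  refine ⟨polyFun q, contDiff_polyFun q, fun p hp => ?_⟩
  have hq : coeff (e p) q = z p / (p.1.factorial * p.2.factorial : ℝ) := by
    simp only [q, coeff_sum, coeff_monomial]
    rw [Finset.sum_eq_single p]
    · simp
    · intro b _ hb
      rw [if_neg fun h => hb (he _ _ h)]
    · exact fun h => absurd hp h
  have h0 : (p.1.factorial : ℝ) ≠ 0 := by positivity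
  have h1 : (p.2.factorial : ℝ) ≠ 0 := by positivity
  simp only [jet, mderiv, iterate_pderiv_polyFun]
  unfold polyFun
  rw [show eval (0 : Plane) = constantCoeff from eval_zero, constantCoeff_eq,
    coeff_iterate_pderiv, coeff_iterate_pderiv]
  have : (0 : Fin 2 →₀ ℕ) + Finsupp.single 0 p.1 + Finsupp.single 1 p.2 = e p := by simp [e]
  simp only [Matrix.cons_val_zero, Matrix.cons_val_one, this, hq]
  simp [Nat.one_ascFactorial]
  field_simp

/-- Only finitely many variables occur in p, and their values at the origin can be prescribed
freely; a polynomial over an infinite field that vanishes at all points is zero. -/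
theorem eq_zero_of_jetEval (p : JetRing)
    (h : ∀ ϱ : Plane → ℝ, ContDiff ℝ ∞ ϱ → jetEval ϱ p 0 = 0) : p = 0 := by
  apply MvPolynomial.funext
  intro z
  obtain ⟨ϱ, hϱ, hz⟩ := exists_jet p.vars z
  have := h ϱ hϱ
  rw [map_zero, ← this]
  exact eval₂Hom_congr' rfl (fun i hi _ => (hz i hi).symm) rfl

/-! ### Symbols of differential polynomials -/

/-- Symbols: polynomials in the components of a covector `ζ_v` at every vertex `v`. -/
abbrev Symb (V : Type*) := MvPolynomial (V × Fin 2) ℝ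

/-- A derivation acts on a product by the Leibniz rule. -/
theorem derivation_prod {A M ι : Type*} [CommRing A] [AddCommGroup M] [Algebra ℝ A] [Module ℝ M]
    [Module A M] [DecidableEq ι] (D : Derivation ℝ A M) (s : Finset ι) (f : ι → A) :
    D (∏ v ∈ s, f v) = ∑ v ∈ s, (∏ w ∈ s.erase v, f w) • D (f v) := by
  induction s using Finset.induction_on with
  | empty => simp
  | insert a s ha ih =>
    rw [Finset.prod_insert ha, D.leibniz, ih, Finset.sum_insert ha, Finset.erase_insert ha,
      add_comm, Finset.smul_sum]
    congr 1
    refine Finset.sum_congr rfl fun v hv => ?_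
    have hav : a ≠ v := fun h => ha (h ▸ hv)
    rw [Finset.erase_insert_of_ne hav, Finset.prod_insert (by simp [ha]), mul_smul]

/-- A derivation for which all the factors are eigenvectors. -/
theorem derivation_prod_of_eigen {A ι : Type*} [CommRing A] [Algebra ℝ A]
    (D : Derivation ℝ A A) (s : Finset ι) (f : ι → A) (l : ι → ℝ)
    (h : ∀ v ∈ s, D (f v) = l v • f v) : D (∏ v ∈ s, f v) = (∑ v ∈ s, l v) • ∏ v ∈ s, f v := by
  classical
  rw [derivation_prod, Finset.sum_smul]
  refine Finset.sum_congr rfl fun v hv => ?_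
  rw [h v hv, ← Finset.mul_prod_erase s f hv]
  simp only [smul_eq_mul, mul_smul_comm]
  rw [mul_comm]

section

variable {V : Type*} [Fintype V]

/-- The differential monomial with the symbol `∏ ζ_v^(m v)`. -/
def jetMonomial (m : V × Fin 2 →₀ ℕ) : JetRing := ∏ v, X (m (v, 0), m (v, 1))

/-- The differential polynomial with the given symbol: the content of all the vertices is `ϱ`. -/
def ofSymb : Symb V →ₗ[ℝ] JetRing := (basisMonomials _ ℝ).constr ℝ jetMonomial

theorem ofSymb_monomial (m : V × Fin 2 →₀ ℕ) (c : ℝ) :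
    ofSymb (monomial m c) = c • jetMonomial m := by
  have h : monomial m c = c • basisMonomials (V × Fin 2) ℝ m := by
    simp [smul_monomial]
  rw [h, map_smul, ofSymb, Module.Basis.constr_basis]

/-- The sum of the covectors of all the vertices. -/
def totalSymb (V : Type*) [Fintype V] (i : Fin 2) : Symb V := ∑ v, X (v, i)

theorem jetMonomial_shift [DecidableEq V] (m : V × Fin 2 →₀ ℕ) (v : V) (i : Fin 2) :
    jetMonomial (m + Finsupp.single (v, i) 1)
      = (∏ w ∈ Finset.univ.erase v, X (m (w, 0), m (w, 1))) *
          (X (shift i (m (v, 0), m (v, 1))) : JetRing) := by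
  unfold jetMonomial
  rw [← Finset.mul_prod_erase Finset.univ _ (Finset.mem_univ v), mul_comm]
  congr 1
  · refine Finset.prod_congr rfl fun w hw => ?_
    have : v ≠ w := fun h => (Finset.mem_erase.1 hw).1 h.symm
    simp [this]
  · fin_cases i <;> simp [shift]

/-- The Leibniz rule: differentiating a product of derivatives of ϱ raises the order at one vertex v
at a time, which is multiplication of the symbol by ζ_{v,i}. -/
theorem ofSymb_totalSymb_mul (i : Fin 2) (p : Symb V) :
    ofSymb (totalSymb V i * p) = totalD i (ofSymb p) := by
  classical
  induction p using MvPolynomial.induction_on' with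
  | add p q hp hq => simp only [mul_add, map_add, hp, hq]
  | monomial m c =>
    rw [ofSymb_monomial, (totalD i).map_smul, totalSymb, Finset.sum_mul, map_sum, jetMonomial,
      derivation_prod, Finset.smul_sum]
    refine Finset.sum_congr rfl fun v _ => ?_
    rw [X, monomial_mul, add_comm, ofSymb_monomial, jetMonomial_shift]
    simp

/-! ### Infinitesimal linear transformations -/

/-- The infinitesimal linear transformation `ζᵢ ∂/∂ζⱼ` of symbols. -/
def glSymb (V : Type*) [Fintype V] (i j : Fin 2) : Derivation ℝ (Symb V) (Symb V) :=
  ∑ v, (X (v, i) : Symb V) • MvPolynomial.pderiv (v, j)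

theorem glSymb_apply (i j : Fin 2) (p : Symb V) :
    glSymb V i j p = ∑ v, X (v, i) * MvPolynomial.pderiv (v, j) p := by
  have h := congrFun (map_sum (Derivation.coeFnAddMonoidHom (R := ℝ) (A := Symb V) (M := Symb V))
    (fun v => (X (v, i) : Symb V) • MvPolynomial.pderiv (v, j)) Finset.univ) p
  rw [Finset.sum_apply] at h
  exact h

theorem glSymb_X (i j k : Fin 2) (v : V) :
    glSymb V i j (X (v, k)) = if k = j then X (v, i) else 0 := by
  classical
  rw [glSymb_apply, Finset.sum_eq_single v]
  · by_cases h : k = j <;> simp [pderiv_X, h]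
  · intro w _ hw
    simp [pderiv_X, hw.symm]
  · simp

/-- The order of differentiation, lowered in the direction `j` and raised in the direction `i`. -/
def exchange (i j : Fin 2) (p : ℕ × ℕ) : ℕ × ℕ :=
  shift i (![(p.1 - 1, p.2), (p.1, p.2 - 1)] j)

/-- The infinitesimal linear transformation of differential polynomials. -/
def glJet (i j : Fin 2) : Derivation ℝ JetRing JetRing :=
  -- When the order in the direction j is zero, the truncated subtraction in `exchange` gives a
  -- meaningless index, but the coefficient vanishes.
  mkDerivation ℝ fun p => ((![p.1, p.2] j : ℕ) : ℝ) • X (exchange i j p)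

theorem glJet_X (i j : Fin 2) (p : ℕ × ℕ) :
    glJet i j (X p) = ((![p.1, p.2] j : ℕ) : ℝ) • (X (exchange i j p) : JetRing) := by
  simp [glJet]

theorem ofSymb_glSymb (i j : Fin 2) (p : Symb V) :
    ofSymb (glSymb V i j p) = glJet i j (ofSymb p) := by
  classical
  induction p using MvPolynomial.induction_on' with
  | add p q hp hq => simp only [map_add, hp, hq]
  | monomial m c =>
    rw [ofSymb_monomial, (glJet i j).map_smul, glSymb_apply, map_sum, jetMonomial,
      derivation_prod, Finset.smul_sum]
    refine Finset.sum_congr rfl fun v _ => ?_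
    rw [X, pderiv_monomial, monomial_mul, add_comm, ofSymb_monomial, jetMonomial_shift, glJet_X]
    have h1 : (![m (v, 0), m (v, 1)] j : ℕ) = m (v, j) := by fin_cases j <;> rfl
    have h2 : ∀ w ∈ Finset.univ.erase v, ∀ k,
        (m - Finsupp.single (v, j) 1 : V × Fin 2 →₀ ℕ) (w, k) = m (w, k) := by
      intro w hw k
      have : v ≠ w := fun h => (Finset.mem_erase.1 hw).1 h.symm
      simp [this]
    have h3 : shift i ((m - Finsupp.single (v, j) 1 : V × Fin 2 →₀ ℕ) (v, 0),
          (m - Finsupp.single (v, j) 1 : V × Fin 2 →₀ ℕ) (v, 1)) = exchange i j (m (v, 0), m (v, 1)) := by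
      unfold exchange
      congr 1
      fin_cases j <;> simp
    rw [h1, h3, Finset.prod_congr rfl fun w hw => by rw [h2 w hw, h2 w hw]]
    simp only [one_mul, smul_eq_mul, mul_smul_comm, smul_smul]

/-- The differential polynomial of a symbol on `V` is homogeneous of degree `card V`. -/
theorem isHomogeneous_ofSymb (p : Symb V) :
    (ofSymb p).IsHomogeneous (Fintype.card V) := by
  induction p using MvPolynomial.induction_on' with
  | monomial m c =>
    rw [ofSymb_monomial, jetMonomial]
    refine (homogeneousSubmodule _ ℝ _).smul_mem c ?_
    have := IsHomogeneous.prod Finset.univ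
      (fun v : V => (X (m (v, 0), m (v, 1)) : JetRing)) (fun _ => 1) fun v _ => isHomogeneous_X _ _
    simpa using this
  | add p q hp hq => rw [map_add]; exact hp.add hq

/-! ### Permutations of the vertices. -/

/-- Renaming of vertices. -/
def renameVertices {V W : Type*} (e : V → W) : Symb V →ₐ[ℝ] Symb W := rename (Prod.map e id)

@[simp] theorem renameVertices_X {V W : Type*} (e : V → W) (v : V) (i : Fin 2) :
    renameVertices e (X (v, i)) = X (e v, i) := by simp [renameVertices]

/-- All vertices contain the same ϱ and the factors commute, so `ofSymb` forgets labels. Hence it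
can be injective only on symmetric symbols. -/
theorem ofSymb_renameVertices {W : Type*} [Fintype W] (e : V ≃ W) (p : Symb V) :
    ofSymb (renameVertices e p) = ofSymb p := by
  induction p using MvPolynomial.induction_on' with
  | add p q hp hq => simp only [map_add, hp, hq]
  | monomial m c =>
    rw [renameVertices, rename_monomial, ofSymb_monomial, ofSymb_monomial, jetMonomial,
      jetMonomial]
    congr 1
    refine (Fintype.prod_equiv e _ _ fun v => ?_).symm
    have h (k : Fin 2) : Finsupp.mapDomain (Prod.map e id) m (e v, k) = m (v, k) :=
      Finsupp.mapDomain_apply (e.injective.prodMap Function.injective_id) m (v, k)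
    rw [h, h]

theorem glSymb_renameVertices (e : Equiv.Perm V) (i j : Fin 2) (p : Symb V) :
    glSymb V i j (renameVertices e p) = renameVertices e (glSymb V i j p) := by
  simp only [glSymb_apply, map_sum, map_mul, renameVertices_X]
  symm
  refine Fintype.sum_equiv e _ _ fun v => ?_
  congr 1
  exact (pderiv_rename (e.injective.prodMap Function.injective_id) (v, j) p).symm

theorem renameVertices_totalSymb (e : Equiv.Perm V) (i : Fin 2) :
    renameVertices e (totalSymb V i) = totalSymb V i := by
  simp only [totalSymb, map_sum, renameVertices_X]
  exact Fintype.sum_equiv e _ _ fun v => rfl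

end

/-! ### Symbols of graphs -/

/-- The bracket `[a, b] = a₀ b₁ - a₁ b₀`. -/
def bracket {A : Type*} [CommRing A] (a b : Fin 2 → A) : A := a 0 * b 1 - a 1 * b 0

/-- The components of the bi-vector `∂x ∧ ∂y`. -/
def eps (i j : Fin 2) : ℝ := ![![0, 1], ![-1, 0]] i j

theorem bivector_apply (ϱ : Plane → ℝ) (y : Plane) (i j : Fin 2) :
    bivector ϱ y i j = eps i j * ϱ y := by
  fin_cases i <;> fin_cases j <;> simp [bivector, eps]

/-- The product of the brackets over the wedges of a graph whose vertices carry covectors. -/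
def graphSymb {k n : ℕ} {A : Type*} [CommRing A] (vec : Fin k ⊕ Fin n → Fin 2 → A)
    (Γ : WedgeGraph k n) : A := ∏ v, bracket (vec (Γ v 0)) (vec (Γ v 1))

theorem bracket_eq_sum {A : Type*} [CommRing A] [Algebra ℝ A] (a b : Fin 2 → A) :
    bracket a b = ∑ J : Fin 2 → Fin 2, eps (J 0) (J 1) • (a (J 0) * b (J 1)) := by
  rw [Fintype.sum_equiv (finTwoArrowEquiv (Fin 2))
    (fun J => eps (J 0) (J 1) • (a (J 0) * b (J 1)))
    (fun p => eps p.1 p.2 • (a p.1 * b p.2)) fun J => rfl]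
  simp [Fintype.sum_prod_type, Fin.sum_univ_two, eps, bracket, sub_eq_add_neg]

/-- Expanding the product of brackets chooses an index on every arrow. Grouping the arrows by head
and index turns the product of components into powers with exponents `inCount`, the orders of
differentiation in `graphOp`. -/
theorem graphSymb_eq_sum {k n : ℕ} {A : Type*} [CommRing A] [Algebra ℝ A]
    (vec : Fin k ⊕ Fin n → Fin 2 → A) (Γ : WedgeGraph k n) :
    graphSymb vec Γ = ∑ I : Fin n → Fin 2 → Fin 2,
      (∏ v, eps (I v 0) (I v 1)) • ∏ u, ∏ i, vec u i ^ inCount Γ I u i := by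
  classical
  unfold graphSymb
  simp only [bracket_eq_sum]
  rw [Finset.prod_univ_sum, Fintype.piFinset_univ]
  refine Finset.sum_congr rfl fun I _ => ?_
  rw [Finset.prod_smul]
  congr 1
  have h1 : ∏ v, vec (Γ v 0) (I v 0) * vec (Γ v 1) (I v 1)
      = ∏ e : Fin n × Fin 2, vec (Γ e.1 e.2) (I e.1 e.2) := by
    rw [Fintype.prod_prod_type]
    simp [Fin.prod_univ_two]
  rw [h1, ← Finset.prod_fiberwise Finset.univ (fun e : Fin n × Fin 2 => (Γ e.1 e.2, I e.1 e.2)),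
    Fintype.prod_prod_type]
  refine Finset.prod_congr rfl fun u _ => Finset.prod_congr rfl fun i _ => ?_
  rw [Finset.prod_congr rfl (g := fun _ => vec u i), Finset.prod_const]
  · simp [inCount]
  · intro e he
    have := (Finset.mem_filter.1 he).2
    rw [Prod.mk.injEq] at this
    rw [this.1, this.2]

theorem ofSymb_prod {V : Type*} [Fintype V] (c : V → Fin 2 → ℕ) :
    ofSymb (∏ v, ∏ i, (X (v, i) : Symb V) ^ c v i) = ∏ v, X (c v 0, c v 1) := by
  classical
  let m : V × Fin 2 →₀ ℕ := Finsupp.equivFunOnFinite.symm fun p => c p.1 p.2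
  have h : ∏ v, ∏ i, (X (v, i) : Symb V) ^ c v i = monomial m 1 := by
    rw [monomial_eq, Finsupp.prod_fintype _ _ (by simp), Fintype.prod_prod_type]
    simp [m]
  rw [h, ofSymb_monomial, one_smul]
  rfl

theorem inCount_zero_add_one {k n : ℕ} (Γ : WedgeGraph k n) (I : Fin n → Fin 2 → Fin 2)
    (u : Fin k ⊕ Fin n) :
    inCount Γ I u 0 + inCount Γ I u 1
      = (Finset.univ.filter fun e : Fin n × Fin 2 => Γ e.1 e.2 = u).card := by
  classical
  rw [← Finset.card_filter_add_card_filter_not (s := Finset.univ.filter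
    fun e : Fin n × Fin 2 => Γ e.1 e.2 = u) (fun e => I e.1 e.2 = 0)]
  simp only [Finset.filter_filter, inCount]
  congr 2
  ext e
  simp only [Finset.mem_filter, Finset.mem_univ, true_and, and_congr_right_iff]
  intro _
  generalize I e.1 e.2 = i
  fin_cases i <;> simp

theorem mderiv_bivector {ϱ : Plane → ℝ} (hϱ : ContDiff ℝ ∞ ϱ) (α : Fin 2 → ℕ) (i j : Fin 2)
    (x : Plane) : mderiv α (fun y => bivector ϱ y i j) x = eps i j * jet ϱ x (α 0, α 1) := by
  simp only [bivector_apply]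
  rw [mderiv_const_mul hϱ]
  rfl

theorem jetEval_sum {ι : Type*} (ϱ : Plane → ℝ) (x : Plane) (s : Finset ι) (f : ι → JetRing) :
    jetEval ϱ (∑ i ∈ s, f i) x = ∑ i ∈ s, jetEval ϱ (f i) x := by simp [jetEval]

theorem jetEval_smul (ϱ : Plane → ℝ) (x : Plane) (c : ℝ) (p : JetRing) :
    jetEval ϱ (c • p) x = c * jetEval ϱ p x := by simp [jetEval, smul_eval]

/-- The covectors at the vertices, if the sink `s` contains the coordinate with the number `σ s`. -/
def sinkVec {k n : ℕ} (σ : Fin k → Fin 2) : Fin k ⊕ Fin n → Fin 2 → Symb (Fin n) :=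
  Sum.elim (fun s i => C (if σ s = i then 1 else 0)) fun v i => X (v, i)

/-- The formula of a graph over sinks of in-degree one that contain coordinates. -/
theorem graphOp_sinks {k n : ℕ} {ϱ : Plane → ℝ} (hϱ : ContDiff ℝ ∞ ϱ) (Γ : WedgeGraph k n)
    (σ : Fin k → Fin 2)
    (hΓ : ∀ s, (Finset.univ.filter fun e : Fin n × Fin 2 => Γ e.1 e.2 = Sum.inl s).card = 1)
    (f : Fin k → Plane → ℝ) (hf : ∀ s, f s = fun y => y (σ s)) (x : Plane) :
    graphOp Γ (bivector ϱ) f x = jetEval ϱ (ofSymb (graphSymb (sinkVec σ) Γ)) x := by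
  rw [graphSymb_eq_sum, map_sum, jetEval_sum]
  unfold graphOp
  refine Finset.sum_congr rfl fun I _ => ?_
  rw [map_smul, jetEval_smul, Fintype.prod_sum_type]
  simp only [mderiv_bivector hϱ, Finset.prod_mul_distrib, mul_assoc]
  congr 1
  have h1 (s : Fin k) : mderiv (inCount Γ I (Sum.inl s)) (f s) x
      = ∏ i, (if σ s = i then 1 else 0 : ℝ) ^ inCount Γ I (Sum.inl s) i := by
    -- In-degree one makes this a first derivative of a coordinate function, hence a Kronecker delta
    -- and a constant in the symbol.
    rw [hf, mderiv_coord _ _ ((inCount_zero_add_one Γ I _).trans (hΓ s))]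
  simp only [h1, sinkVec, Sum.elim_inl, Sum.elim_inr]
  have h2 : ∏ s : Fin k, ∏ i : Fin 2, (C (if σ s = i then 1 else 0 : ℝ) : Symb (Fin n)) ^
      inCount Γ I (Sum.inl s) i
      = C (∏ s : Fin k, ∏ i : Fin 2, (if σ s = i then 1 else 0 : ℝ) ^ inCount Γ I (Sum.inl s) i) := by
    simp only [map_prod, map_pow]
  rw [h2, ← smul_eq_C_mul, map_smul, jetEval_smul, ofSymb_prod, mul_comm]
  simp [jetEval]

/-- The formula of a graph all of whose vertices contain `ϱ`. -/
theorem graphOp_all {k n : ℕ} {V : Type*} [Fintype V] {ϱ : Plane → ℝ} (hϱ : ContDiff ℝ ∞ ϱ)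
    (Γ : WedgeGraph k n) (e : Fin k ⊕ Fin n ≃ V) (f : Fin k → Plane → ℝ) (hf : ∀ s, f s = ϱ)
    (x : Plane) : graphOp Γ (bivector ϱ) f x
      = jetEval ϱ (ofSymb (graphSymb (fun u i => (X (e u, i) : Symb V)) Γ)) x := by
  rw [graphSymb_eq_sum, map_sum, jetEval_sum]
  unfold graphOp
  refine Finset.sum_congr rfl fun I _ => ?_
  rw [map_smul, jetEval_smul, ← Fintype.prod_equiv e.symm
    (fun v => ∏ i, (X (v, i) : Symb V) ^ inCount Γ I (e.symm v) i) _ fun v => by simp, ofSymb_prod]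
  simp only [mderiv_bivector hϱ, Finset.prod_mul_distrib, mul_assoc, hf]
  congr 1
  rw [← Fintype.prod_equiv e (fun u => (X (inCount Γ I u 0, inCount Γ I u 1) : JetRing)) _
    fun u => by simp, Fintype.prod_sum_type]
  simp only [jetEval, map_mul, map_prod, eval_X]
  rw [mul_comm]
  rfl

/-! ### The first fundamental theorem for planar covectors -/

/-- The commutator of two derivations is a derivation, so it is enough that it kills the variables.
-/
theorem mvpderiv_comm {σ : Type*} (i j : σ) (p : MvPolynomial σ ℝ) :
    MvPolynomial.pderiv i (MvPolynomial.pderiv j p)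
      = MvPolynomial.pderiv j (MvPolynomial.pderiv i p) := by
  classical
  have h : ⁅MvPolynomial.pderiv (R := ℝ) i, MvPolynomial.pderiv (R := ℝ) j⁆
      = 0 := by
    refine derivation_ext fun k => ?_
    rw [Derivation.commutator_apply]
    simp only [pderiv_X, Pi.single_apply]
    split_ifs <;> simp
  have := DFunLike.congr_fun h p
  rwa [Derivation.commutator_apply, Derivation.zero_apply, sub_eq_zero] at this

section

variable {V : Type*} [Fintype V]

/-- The correction term comes from the coefficient ζ_{w,i} of `glSymb`. It accounts for the drop in
weight under the Ω-process and for the lower-order term in Capelli's identity. -/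
theorem pderiv_glSymb (w : V) (k i j : Fin 2) (p : Symb V) :
    MvPolynomial.pderiv (w, k) (glSymb V i j p)
      = glSymb V i j (MvPolynomial.pderiv (w, k) p)
        + if k = i then MvPolynomial.pderiv (w, j) p else 0 := by
  classical
  simp only [glSymb_apply, map_sum, Derivation.leibniz, smul_eq_mul, Finset.sum_add_distrib,
    mvpderiv_comm (w, k)]
  congr 1
  rw [Finset.sum_eq_single w]
  · by_cases h : k = i <;> simp [pderiv_X, h, eq_comm]
  · intro v _ hv
    simp [pderiv_X, hv]
  · simp

/-- The covector at a vertex. -/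
def zeta (v : V) (i : Fin 2) : Symb V := X (v, i)

/-- The polarized `Ω`-process. -/
def omegaProcess (a b : V) (h : Symb V) : Symb V :=
  MvPolynomial.pderiv (a, 0) (MvPolynomial.pderiv (b, 1) h)
    - MvPolynomial.pderiv (a, 1) (MvPolynomial.pderiv (b, 0) h)

/-- Normal ordering: all multiplications are moved to the left of all the derivatives. -/
theorem glSymb_comp (i j k l : Fin 2) (p : Symb V) :
    glSymb V i j (glSymb V k l p)
      = (∑ a, ∑ b, X (a, i) * X (b, k) *
          MvPolynomial.pderiv (a, j) (MvPolynomial.pderiv (b, l) p))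
        + if j = k then glSymb V i l p else 0 := by
  classical
  rw [glSymb_apply]
  simp only [pderiv_glSymb, mul_add, Finset.sum_add_distrib]
  congr 1
  · refine Finset.sum_congr rfl fun a _ => ?_
    rw [glSymb_apply, Finset.mul_sum]
    refine Finset.sum_congr rfl fun b _ => ?_
    rw [mvpderiv_comm (b, l)]
    ring
  · split_ifs
    · rw [glSymb_apply]
    · simp

/-- Capelli's identity. -/
theorem capelli (h : Symb V) :
    ∑ a, ∑ b, bracket (zeta a) (zeta b) * omegaProcess a b h
      = 2 * (glSymb V 0 0 (glSymb V 1 1 h) - glSymb V 0 1 (glSymb V 1 0 h) + glSymb V 0 0 h) := by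
  rw [glSymb_comp, glSymb_comp, if_neg (by decide), if_pos rfl]
  -- Exchanging the names of a and b identifies the four sums in pairs, whence the factor 2.
  have e (i j k l : Fin 2) : ∑ a : V, ∑ b : V, X (a, i) * X (b, k) *
          MvPolynomial.pderiv (a, j) (MvPolynomial.pderiv (b, l) h)
      = ∑ a, ∑ b, X (b, i) * X (a, k) *
          MvPolynomial.pderiv (a, l) (MvPolynomial.pderiv (b, j) h) := by
    rw [Finset.sum_comm]
    refine Finset.sum_congr rfl fun a _ => Finset.sum_congr rfl fun b _ => ?_
    rw [mvpderiv_comm]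
  have h1 := e 0 0 1 1
  have h2 := e 0 1 1 0
  calc _ = (∑ a, ∑ b, X (a, 0) * X (b, 1) *
          MvPolynomial.pderiv (a, 0) (MvPolynomial.pderiv (b, 1) h))
        - (∑ a, ∑ b, X (b, 0) * X (a, 1) *
          MvPolynomial.pderiv (a, 0) (MvPolynomial.pderiv (b, 1) h))
        - (∑ a, ∑ b, X (a, 0) * X (b, 1) *
          MvPolynomial.pderiv (a, 1) (MvPolynomial.pderiv (b, 0) h))
        + (∑ a, ∑ b, X (b, 0) * X (a, 1) *
          MvPolynomial.pderiv (a, 1) (MvPolynomial.pderiv (b, 0) h)) := by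
        simp only [← Finset.sum_sub_distrib, ← Finset.sum_add_distrib]
        refine Finset.sum_congr rfl fun a _ => Finset.sum_congr rfl fun b _ => ?_
        simp only [bracket, zeta, omegaProcess]
        ring
    _ = _ := by
        rw [← h1, ← h2]
        ring

/-- A polynomial of degree zero with respect to both components is constant. -/
theorem eq_C_of_glSymb_eq_zero (h : Symb V) (h0 : glSymb V 0 0 h = 0) (h1 : glSymb V 1 1 h = 0) :
    h = C (constantCoeff h) := by
  classical
  -- Euler's identity: each monomial is an eigenvector, with its degree in the components i as the
  -- eigenvalue.
  have key (i : Fin 2) (m : V × Fin 2 →₀ ℕ) :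
      coeff m (glSymb V i i h) = (∑ v, m (v, i) : ℕ) * coeff m h := by
    rw [glSymb_apply, coeff_sum, Nat.cast_sum, Finset.sum_mul]
    refine Finset.sum_congr rfl fun v _ => ?_
    rw [coeff_X_mul']
    split_ifs with hm
    · rw [coeff_pderiv]
      have hle : Finsupp.single (v, i) 1 ≤ m := by
        rw [Finsupp.single_le_iff]
        exact Nat.one_le_iff_ne_zero.2 (Finsupp.mem_support_iff.1 hm)
      rw [tsub_add_cancel_of_le hle]
      have : (m - Finsupp.single (v, i) 1 : V × Fin 2 →₀ ℕ) (v, i) + 1 = m (v, i) := by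
        have := Finsupp.single_le_iff.1 hle
        simp; omega
      rw [← this]
      push_cast
      ring
    · rw [Finsupp.notMem_support_iff.1 hm]
      simp
  ext m
  rw [coeff_C]
  split_ifs with hm
  · rw [← hm]; rfl
  · by_contra hne
    apply hm
    have z (i : Fin 2) (v : V) : m (v, i) = 0 := by
      have hi : glSymb V i i h = 0 := by fin_cases i <;> assumption
      have := key i m
      rw [hi, coeff_zero, eq_comm, mul_eq_zero, or_iff_left hne] at this
      exact Finset.sum_eq_zero_iff.1 (Nat.cast_eq_zero.1 this) v (Finset.mem_univ v)
    ext ⟨v, i⟩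
    simp [z]

/-- Invariants of several planar covectors are polynomials in the brackets. -/
theorem mem_span_brackets (n : ℕ) (h : Symb V) (h10 : glSymb V 1 0 h = 0)
    (h00 : glSymb V 0 0 h = (n : ℝ) • h) (h11 : glSymb V 1 1 h = (n : ℝ) • h) :
    h ∈ Submodule.span ℝ (Set.range fun ab : Fin n → V × V =>
      ∏ k, bracket (zeta (ab k).1) (zeta (ab k).2)) := by
  induction n generalizing h with
  | zero =>
    rw [eq_C_of_glSymb_eq_zero h (by simpa using h00) (by simpa using h11)]
    have : (C (constantCoeff h) : Symb V) = constantCoeff h • 1 := by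
      rw [smul_eq_C_mul, mul_one]
    rw [this]
    exact Submodule.smul_mem _ _ (Submodule.subset_span ⟨Fin.elim0, by simp⟩)
  | succ n ih =>
    -- Since h is killed by `glSymb V 1 0`, the mixed term of Capelli's identity disappears, and no
    -- condition on `glSymb V 0 1` is needed.
    have hcap := capelli h
    rw [h10, h11, map_zero, (glSymb V 0 0).map_smul, h00] at hcap
    -- For the weight n + 1 the right-hand side of Capelli's identity is 2((n + 1)² + (n + 1)) h =
    -- 2(n + 1)(n + 2) h.
    have hh : h = (1 / (2 * ((n + 1) * (n + 2))) : ℝ) •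
        ∑ a, ∑ b, bracket (zeta a) (zeta b) * omegaProcess a b h := by
      rw [hcap, smul_smul, sub_zero, ← add_smul,
        show (2 : Symb V) = C 2 from rfl, ← smul_eq_C_mul, smul_smul, smul_smul]
      have : (1 / (2 * ((n + 1) * (n + 2))) *
          2 * (((n + 1 : ℕ) : ℝ) * ((n + 1 : ℕ) : ℝ) + ((n + 1 : ℕ) : ℝ)) : ℝ) = 1 := by
        push_cast
        field_simp
        ring
      rw [this, one_smul]
    have hstep (a b : V) : bracket (zeta a) (zeta b) * omegaProcess a b h ∈
        Submodule.span ℝ (Set.range fun ab : Fin (n + 1) → V × V =>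
          ∏ k, bracket (zeta (ab k).1) (zeta (ab k).2)) := by
      have e (w : V) (k i j : Fin 2) (p : Symb V) : glSymb V i j (MvPolynomial.pderiv (w, k) p)
          = MvPolynomial.pderiv (w, k) (glSymb V i j p)
            - if k = i then MvPolynomial.pderiv (w, j) p else 0 := by
        rw [pderiv_glSymb, add_sub_cancel_right]
      -- The Ω-process commutes with `glSymb V 1 0` and lowers both weights by one, so the induction
      -- hypothesis applies.
      have hΩ := ih (omegaProcess a b h)
        (by
          simp only [omegaProcess, map_sub, e, h10]
          simp)
        (by
          simp only [omegaProcess, map_sub, e, h00]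
          simp [add_smul, smul_sub])
        (by
          simp only [omegaProcess, map_sub, e, h11]
          simp [add_smul, smul_sub])
      refine Submodule.span_induction
        (p := fun q _ => bracket (zeta a) (zeta b) * q ∈ Submodule.span ℝ (Set.range
          fun ab : Fin (n + 1) → V × V => ∏ k, bracket (zeta (ab k).1) (zeta (ab k).2)))
        ?_ ?_ ?_ ?_ hΩ
      · rintro _ ⟨ab, rfl⟩
        refine Submodule.subset_span ⟨Fin.cons (a, b) ab, ?_⟩
        simp [Fin.prod_univ_succ]
      · simp
      · intro p q _ _ hp hq
        rw [mul_add]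
        exact Submodule.add_mem _ hp hq
      · intro c p _ hp
        rw [mul_smul_comm]
        exact Submodule.smul_mem _ _ hp
    rw [hh]
    exact Submodule.smul_mem _ _ (Submodule.sum_mem _ fun a _ => Submodule.sum_mem _ fun b _ =>
      hstep a b)

end

/-! ### Symmetric symbols -/

section

variable {V : Type*} [Fintype V]

/-- A symbol is symmetric if it does not change under permutations of vertices. -/
def IsSymmSymb (w : Symb V) : Prop := ∀ π : Equiv.Perm V, renameVertices π w = w

/-- The exponent of the differential monomial with the symbol `∏ ζ_v^(m v)`. -/
def jetExponent (m : V × Fin 2 →₀ ℕ) : ℕ × ℕ →₀ ℕ := ∑ v, Finsupp.single (m (v, 0), m (v, 1)) 1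

theorem jetMonomial_eq_monomial (m : V × Fin 2 →₀ ℕ) :
    jetMonomial m = monomial (jetExponent m) 1 := by
  rw [jetMonomial, jetExponent, monomial_sum_one]
  rfl

/-- `jetExponent` records how many vertices carry each order of differentiation. Equal counts give
fibres of equal size, and bijections between the fibres assemble into a permutation. -/
theorem exists_perm_of_jetExponent_eq {m m' : V × Fin 2 →₀ ℕ}
    (h : jetExponent m = jetExponent m') :
    ∃ π : Equiv.Perm V, m = Finsupp.mapDomain (Prod.map π id) m' := by
  classical
  let α (m : V × Fin 2 →₀ ℕ) (v : V) : ℕ × ℕ := (m (v, 0), m (v, 1))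
  have hcard (c : ℕ × ℕ) : Fintype.card {v // α m' v = c} = Fintype.card {v // α m v = c} := by
    have h' := DFunLike.congr_fun h c
    simp only [jetExponent, Finsupp.finsetSum_apply, Finsupp.single_apply, Finset.sum_boole,
      Nat.cast_id] at h'
    rw [Fintype.card_subtype, Fintype.card_subtype]
    exact h'.symm
  let π : Equiv.Perm V := (Equiv.sigmaFiberEquiv (α m')).symm.trans
    ((Equiv.sigmaCongrRight fun c => Fintype.equivOfCardEq (hcard c)).trans
      (Equiv.sigmaFiberEquiv (α m)))
  have hπ (v : V) : α m (π v) = α m' v :=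
    (Fintype.equivOfCardEq (hcard (α m' v)) ⟨v, rfl⟩).2
  refine ⟨π, ?_⟩
  ext ⟨u, k⟩
  obtain ⟨v, rfl⟩ := π.surjective u
  have hk : Finsupp.mapDomain (Prod.map π id) m' (π v, k) = m' (v, k) :=
    Finsupp.mapDomain_apply (π.injective.prodMap Function.injective_id) m' (v, k)
  rw [hk]
  have := hπ v
  fin_cases k
  · exact congrArg Prod.fst this
  · exact congrArg Prod.snd this

/-- Monomials with the same image under `ofSymb` form one orbit of the permutations, and a symmetric
symbol has equal coefficients on it. The coefficient of the image is thus a positive integer times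
the coefficient of w, so nothing cancels in characteristic zero. -/
theorem eq_zero_of_ofSymb_eq_zero {w : Symb V} (hw : IsSymmSymb w) (h : ofSymb w = 0) :
    w = 0 := by
  classical
  ext m
  rw [coeff_zero]
  by_contra hm
  have h1 : ofSymb w = ∑ m' ∈ w.support, monomial (jetExponent m') (coeff m' w) := by
    conv_lhs => rw [w.as_sum]
    rw [map_sum]
    refine Finset.sum_congr rfl fun m' _ => ?_
    rw [ofSymb_monomial, jetMonomial_eq_monomial, smul_monomial, smul_eq_mul, mul_one]
  have h2 := congrArg (coeff (jetExponent m)) h1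
  rw [h, coeff_zero, coeff_sum] at h2
  simp only [coeff_monomial] at h2
  rw [← Finset.sum_filter] at h2
  have h3 : ∀ m' ∈ w.support.filter (fun m' => jetExponent m' = jetExponent m),
      coeff m' w = coeff m w := by
    intro m' hm'
    obtain ⟨π, hπ⟩ := exists_perm_of_jetExponent_eq (Finset.mem_filter.1 hm').2
    rw [hπ]
    conv_lhs => rw [← hw π]
    exact coeff_rename_mapDomain _ (π.injective.prodMap Function.injective_id) w m
  rw [Finset.sum_congr rfl h3, Finset.sum_const, nsmul_eq_mul, eq_comm, mul_eq_zero,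
    or_iff_left hm, Nat.cast_eq_zero, Finset.card_eq_zero] at h2
  exact Finset.notMem_empty m (h2 ▸ Finset.mem_filter.2 ⟨mem_support_iff.2 hm, rfl⟩)

theorem IsSymmSymb.glSymb {w : Symb V} (hw : IsSymmSymb w) (i j : Fin 2) :
    IsSymmSymb (glSymb V i j w) := fun π => by rw [← glSymb_renameVertices, hw π]

theorem IsSymmSymb.mul {V : Type*} {w w' : Symb V} (hw : IsSymmSymb w) (hw' : IsSymmSymb w') :
    IsSymmSymb (w * w') := fun π => by rw [map_mul, hw π, hw' π]

theorem IsSymmSymb.add {V : Type*} {w w' : Symb V} (hw : IsSymmSymb w) (hw' : IsSymmSymb w') :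
    IsSymmSymb (w + w') := fun π => by rw [map_add, hw π, hw' π]

theorem IsSymmSymb.smul {V : Type*} {w : Symb V} (hw : IsSymmSymb w) (c : ℝ) :
    IsSymmSymb (c • w) := fun π => by rw [map_smul, hw π]

theorem isSymmSymb_totalSymb (i : Fin 2) : IsSymmSymb (totalSymb V i) :=
  fun π => renameVertices_totalSymb π i

end

theorem exists_sum_single {n : ℕ} {α : Type*} (m : α →₀ ℕ) (hm : m.degree = n) :
    ∃ f : Fin n → α, ∑ v, Finsupp.single (f v) 1 = m := by
  induction n generalizing m with
  | zero => exact ⟨Fin.elim0, by simpa using ((Finsupp.degree_eq_zero_iff m).1 hm).symm⟩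
  | succ n ih =>
    obtain ⟨a, ha⟩ : ∃ a, m a ≠ 0 := by
      by_contra! h
      have : m = 0 := by ext a; exact h a
      simp [this] at hm
    have hle : Finsupp.single a 1 ≤ m := Finsupp.single_le_iff.2 (Nat.one_le_iff_ne_zero.2 ha)
    obtain ⟨m', rfl⟩ := exists_add_of_le hle
    rw [map_add, Finsupp.degree_single, add_comm] at hm
    obtain ⟨f, hf⟩ := ih m' (by omega)
    exact ⟨Fin.cons a f, by simp [Fin.sum_univ_succ, hf]⟩

/-- Homogeneous differential polynomials of degree `n` have symmetric symbols on `n` vertices. -/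
theorem exists_symmSymb {n : ℕ} {p : JetRing} (hp : p.IsHomogeneous n) :
    ∃ w : Symb (Fin n), IsSymmSymb w ∧ ofSymb w = p := by
  classical
  have h1 (m : ℕ × ℕ →₀ ℕ) (hm : coeff m p ≠ 0) :
      ∃ w : Symb (Fin n), ofSymb w = monomial m (coeff m p) := by
    have hdeg : m.degree = n := by rw [← hp hm, Finsupp.degree_eq_weight_one]; rfl
    obtain ⟨f, hf⟩ := exists_sum_single m hdeg
    -- The n factors of the differential monomial are distributed over the n vertices in some order.
    refine ⟨monomial (Finsupp.equivFunOnFinite.symm fun q => ![(f q.1).1, (f q.1).2] q.2)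
      (coeff m p), ?_⟩
    rw [ofSymb_monomial, jetMonomial_eq_monomial, smul_monomial, smul_eq_mul, mul_one]
    refine congrArg (fun d => monomial d (coeff m p)) (Eq.trans ?_ hf)
    simp [jetExponent]
  have h2 : ∃ w : Symb (Fin n), ofSymb w = p := by
    choose! f hf using h1
    refine ⟨∑ m ∈ p.support, f m, ?_⟩
    rw [map_sum]
    conv_rhs => rw [p.as_sum]
    exact Finset.sum_congr rfl fun m hm => hf m (mem_support_iff.1 hm)
  obtain ⟨w, hw⟩ := h2
  -- Averaging over permutations makes the symbol symmetric without changing its image under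
  -- `ofSymb`.
  refine ⟨((n.factorial : ℝ)⁻¹) • ∑ π : Equiv.Perm (Fin n), renameVertices π w, ?_, ?_⟩
  · refine IsSymmSymb.smul (fun τ => ?_) _
    rw [map_sum]
    refine Fintype.sum_equiv (Equiv.mulLeft τ) _ _ fun π => ?_
    simp only [renameVertices, rename_rename, Equiv.coe_mulLeft, Equiv.Perm.coe_mul]
    congr 1
  · rw [map_smul, map_sum]
    simp only [ofSymb_renameVertices, hw, Finset.sum_const, Finset.card_univ,
      Fintype.card_perm, Fintype.card_fin]
    rw [← Nat.cast_smul_eq_nsmul ℝ, smul_smul, inv_mul_cancel₀ (by positivity), one_smul]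

/-! ### Divisibility by linear forms -/

/-- Substitutions that are trivial modulo `a`. -/
theorem dvd_sub_of_subst {σ : Type*} (τ : MvPolynomial σ ℝ →ₐ[ℝ] MvPolynomial σ ℝ)
    (a : MvPolynomial σ ℝ) (h : ∀ i, a ∣ X i - τ (X i)) (p : MvPolynomial σ ℝ) :
    a ∣ p - τ p := by
  induction p using MvPolynomial.induction_on with
  | C c => simp [← algebraMap_eq]
  | add p q hp hq =>
    have := dvd_add hp hq
    rw [map_add]
    convert this using 1
    ring
  | mul_X p i hp =>
    have := dvd_add (hp.mul_right (X i)) ((h i).mul_left (τ p))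
    rw [map_mul]
    convert this using 1
    ring

/-- The two components of the sum of covectors are coprime. -/
theorem totalSymb_one_dvd {n : ℕ} [NeZero n] {p : Symb (Fin n)}
    (h : totalSymb (Fin n) 1 ∣ totalSymb (Fin n) 0 * p) : totalSymb (Fin n) 1 ∣ p := by
  classical
  -- Restriction to the hyperplane where the second component of the total covector is zero: ζ_{0,1}
  -- is eliminated. The first component survives as a nonzero polynomial, hence p must restrict to
  -- zero.
  let τ : Symb (Fin n) →ₐ[ℝ] Symb (Fin n) :=
    aeval fun i => if i = (0, 1) then X (0, 1) - totalSymb (Fin n) 1 else X i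
  have hτX (i : Fin n × Fin 2) : τ (X i)
      = if i = (0, 1) then X (0, 1) - totalSymb (Fin n) 1 else X i := by simp [τ]
  have h1 : τ (totalSymb (Fin n) 1) = 0 := by
    have : τ (totalSymb (Fin n) 1)
        = ∑ v : Fin n, (X (v, 1) - if v = 0 then totalSymb (Fin n) 1 else 0) := by
      rw [totalSymb, map_sum]
      refine Finset.sum_congr rfl fun v _ => ?_
      rw [hτX]
      by_cases hv : v = 0 <;> simp [hv, totalSymb]
    rw [this, Finset.sum_sub_distrib]
    simp [totalSymb]
  have h0 : τ (totalSymb (Fin n) 0) = totalSymb (Fin n) 0 := by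
    rw [totalSymb, map_sum]
    refine Finset.sum_congr rfl fun v _ => ?_
    rw [hτX, if_neg (by simp)]
  have hne : totalSymb (Fin n) 0 ≠ 0 := by
    intro hz
    have := congrArg (coeff (Finsupp.single (0, 0) 1)) hz
    simp [totalSymb, coeff_sum, coeff_X, Finsupp.single_left_inj, Prod.ext_iff] at this
  have hz : τ p = 0 := by
    obtain ⟨q, hq⟩ := h
    have := congrArg τ hq
    rw [map_mul, map_mul, h1, zero_mul, h0] at this
    exact (mul_eq_zero.1 this).resolve_left hne
  have := dvd_sub_of_subst τ (totalSymb (Fin n) 1) (fun i => by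
    rw [hτX]
    split_ifs with hi
    · rw [hi]; simp
    · simp) p
  rwa [hz, sub_zero] at this

theorem totalSymb_ne_zero (n : ℕ) [NeZero n] (i : Fin 2) : totalSymb (Fin n) i ≠ 0 := by
  classical
  intro hz
  have := congrArg (coeff (Finsupp.single (0, i) 1)) hz
  simp [totalSymb, coeff_sum, coeff_X, Finsupp.single_left_inj, Prod.ext_iff] at this

theorem glSymb_totalSymb {V : Type*} [Fintype V] (i j k : Fin 2) :
    glSymb V i j (totalSymb V k) = if k = j then totalSymb V i else 0 := by
  simp only [totalSymb, map_sum, glSymb_X]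
  split_ifs <;> simp

/-- A divergence-free vector field of differential polynomials that is equivariant under linear
transformations is Hamiltonian, and its Hamiltonian is a polynomial in the brackets. -/
theorem exists_hamiltonian_of_div_eq_zero {n : ℕ} [NeZero n] {Z0 Z1 : JetRing}
    (h0 : Z0.IsHomogeneous n) (h1 : Z1.IsHomogeneous n)
    (hdiv : totalD 0 Z0 + totalD 1 Z1 = 0)
    (hgl10 : glJet 1 0 Z0 = 0) (hgl00 : glJet 0 0 Z0 = (n : ℝ) • Z0)
    (hgl11 : glJet 1 1 Z0 = ((n + 1 : ℕ) : ℝ) • Z0) :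
    ∃ h ∈ Submodule.span ℝ (Set.range fun ab : Fin n → Fin n × Fin n =>
        ∏ k, bracket (zeta (ab k).1) (zeta (ab k).2)),
      Z0 = totalD 1 (ofSymb h) ∧ Z1 = -totalD 0 (ofSymb h) := by
  obtain ⟨w0, hs0, rfl⟩ := exists_symmSymb h0
  obtain ⟨w1, hs1, rfl⟩ := exists_symmSymb h1
  -- Both sides are symmetric, so the vanishing divergence lifts from differential polynomials to
  -- symbols.
  have hw : totalSymb (Fin n) 0 * w0 + totalSymb (Fin n) 1 * w1 = 0 := by
    refine eq_zero_of_ofSymb_eq_zero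
      (((isSymmSymb_totalSymb 0).mul hs0).add ((isSymmSymb_totalSymb 1).mul hs1)) ?_
    rw [map_add, ofSymb_totalSymb_mul, ofSymb_totalSymb_mul, hdiv]
  obtain ⟨h, rfl⟩ : totalSymb (Fin n) 1 ∣ w0 :=
    totalSymb_one_dvd ⟨-w1, by linear_combination hw⟩
  have hw1 : w1 = -(totalSymb (Fin n) 0 * h) := by
    apply mul_left_cancel₀ (totalSymb_ne_zero n 1)
    linear_combination hw
  have key (i j : Fin 2) (c : ℝ)
      (hc : glJet i j (ofSymb (totalSymb (Fin n) 1 * h))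
        = c • ofSymb (totalSymb (Fin n) 1 * h)) :
      glSymb (Fin n) i j (totalSymb (Fin n) 1 * h) = c • (totalSymb (Fin n) 1 * h) := by
    rw [← sub_eq_zero, sub_eq_add_neg, ← neg_smul]
    refine eq_zero_of_ofSymb_eq_zero ((hs0.glSymb i j).add (hs0.smul _)) ?_
    rw [map_add, map_smul, ofSymb_glSymb, hc, neg_smul, add_neg_cancel]
  have k10 := key 1 0 0 (by rw [hgl10, zero_smul])
  have k00 := key 0 0 n hgl00
  have k11 := key 1 1 _ hgl11
  -- The factor `totalSymb (Fin n) 1` is killed by (1, 0) and has weights 0 and 1. Cancelling it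
  -- leaves h killed by (1, 0) with both weights n.
  rw [Derivation.leibniz, glSymb_totalSymb] at k10 k00 k11
  refine ⟨h, mem_span_brackets n h ?_ ?_ ?_, ofSymb_totalSymb_mul 1 h, ?_⟩
  · simpa [totalSymb_ne_zero n 1] using k10
  · apply mul_left_cancel₀ (totalSymb_ne_zero n 1)
    simpa using k00
  · apply mul_left_cancel₀ (totalSymb_ne_zero n 1)
    have : ((n + 1 : ℕ) : ℝ) • (totalSymb (Fin n) 1 * h)
        = totalSymb (Fin n) 1 * (n : ℝ) • h + h * totalSymb (Fin n) 1 := by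
      push_cast
      rw [add_smul, one_smul, mul_smul_comm, mul_comm h]
    rw [this] at k11
    simpa using k11
  · rw [hw1, map_neg, ofSymb_totalSymb_mul]

/-! ### Infinitesimal symmetries of bi-vectors -/

/-- As D_i is the sum of X (shift i r) ∂/∂X_r, the commutator with ∂/∂X_q retains only the r with
shift i r = q; it suffices to check this on variables. -/
theorem pderiv_totalD (q : ℕ × ℕ) (i : Fin 2) (p : JetRing) :
    MvPolynomial.pderiv q (totalD i p) = totalD i (MvPolynomial.pderiv q p)
      + mkDerivation ℝ (fun r => if shift i r = q then (1 : JetRing) else 0) p := by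
  classical
  have h : ⁅MvPolynomial.pderiv (R := ℝ) q, totalD i⁆
      = mkDerivation ℝ (fun r => if shift i r = q then (1 : JetRing) else 0) := by
    refine derivation_ext fun k => ?_
    rw [Derivation.commutator_apply, mkDerivation_X]
    by_cases hk : k = q <;> by_cases hs : shift i k = q <;>
      simp [pderiv_X, Pi.single_apply, hk, hs]
  have := DFunLike.congr_fun h p
  rw [Derivation.commutator_apply] at this
  linear_combination this

theorem pderiv_totalD_of_shift {q r : ℕ × ℕ} {i : Fin 2} (h : shift i r = q) (p : JetRing) :
    MvPolynomial.pderiv q (totalD i p)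
      = totalD i (MvPolynomial.pderiv q p) + MvPolynomial.pderiv r p := by
  classical
  rw [pderiv_totalD, pderiv_def r]
  congr 3
  funext s
  have hinj : shift i s = q ↔ s = r := by
    rw [← h]
    fin_cases i <;> simp [shift, Prod.ext_iff]
  rw [Pi.single_apply]
  simp only [hinj]

theorem pderiv_totalD_of_ne {q : ℕ × ℕ} {i : Fin 2} (h : ∀ r, shift i r ≠ q) (p : JetRing) :
    MvPolynomial.pderiv q (totalD i p) = totalD i (MvPolynomial.pderiv q p) := by
  classical
  rw [pderiv_totalD]
  simp only [h, if_false]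
  have : mkDerivation ℝ (fun _ : ℕ × ℕ => (0 : JetRing)) = 0 :=
    derivation_ext fun k => by simp
  rw [this]
  simp

theorem notMem_vars_of_pderiv_eq_zero {σ : Type*} {p : MvPolynomial σ ℝ} {i : σ}
    (h : MvPolynomial.pderiv i p = 0) : i ∉ p.vars := by
  classical
  intro hi
  obtain ⟨m, hm, him⟩ := (mem_vars_iff_mem_support i).1 hi
  have hle : Finsupp.single i 1 ≤ m :=
    Finsupp.single_le_iff.2 (Nat.one_le_iff_ne_zero.2 (Finsupp.mem_support_iff.1 him))
  have := congrArg (coeff (m - Finsupp.single i 1)) h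
  rw [coeff_pderiv, tsub_add_cancel_of_le hle, coeff_zero, mul_eq_zero] at this
  rcases this with h | h
  · exact mem_support_iff.1 hm h
  · exact absurd h (by positivity)

/-- Only constants are preserved along the level sets of `ϱ`. -/
theorem eq_C_of_hamiltonian_derivative_eq_zero {g : JetRing}
    (h00 : MvPolynomial.pderiv (0, 0) g = 0)
    (h : X (0, 1) * totalD 0 g - X (1, 0) * totalD 1 g = 0) : ∃ c, g = C c := by
  classical
  suffices hv : g.vars = ∅ from ⟨_, vars_eq_empty_iff_eq_C.1 hv⟩
  by_contra hne
  -- Take a variable of g with the largest number a of derivatives along x. The equation is then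
  -- differentiated with respect to (a + 1, b), which occurs in D₀g but not in D₁g.
  obtain ⟨⟨a, b⟩, hab, hmax⟩ := Finset.exists_max_image g.vars Prod.fst
    (Finset.nonempty_iff_ne_empty.2 hne)
  have hab0 : (a, b) ≠ (0, 0) := fun h' => notMem_vars_of_pderiv_eq_zero h00 (h' ▸ hab)
  have hz (b' : ℕ) : MvPolynomial.pderiv (a + 1, b') g = 0 :=
    pderiv_eq_zero_of_notMem_vars fun h' => absurd (hmax _ h') (by simp)
  have h1 : MvPolynomial.pderiv (a + 1, b) (totalD 1 g) = 0 := by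
    rcases b with _ | b
    · rw [pderiv_totalD_of_ne (by simp [shift]), hz, map_zero]
    · rw [pderiv_totalD_of_shift (r := (a + 1, b)) (by simp [shift]), hz, hz, map_zero, add_zero]
  have h0 : MvPolynomial.pderiv (a + 1, b) (totalD 0 g) = MvPolynomial.pderiv (a, b) g := by
    rw [pderiv_totalD_of_shift (r := (a, b)) (by simp [shift]), hz, map_zero, zero_add]
  -- Only X (0, 1) * ∂g/∂X_(a,b) remains. The factor X (1, 0) would contribute only for (a, b) = (0,
  -- 0), which is excluded because g is free of ϱ.
  have hd := congrArg (MvPolynomial.pderiv (a + 1, b)) h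
  rw [map_sub, Derivation.leibniz, Derivation.leibniz, h0, h1, pderiv_X_of_ne (by simp),
    pderiv_X_of_ne (by
      intro h'
      simp only [Prod.mk.injEq] at h'
      exact hab0 (Prod.ext (by simp; omega) (by simp; omega)))] at hd
  simp only [smul_eq_mul, mul_zero, add_zero, sub_zero, map_zero, mul_eq_zero, X_ne_zero,
    false_or] at hd
  exact notMem_vars_of_pderiv_eq_zero hd hab

/-- Substitution of zero for one variable. -/
def killVar (q : ℕ × ℕ) : JetRing →ₐ[ℝ] JetRing := aeval fun r => if r = q then 0 else X r

theorem killVar_X (q r : ℕ × ℕ) : killVar q (X r) = if r = q then 0 else X r := by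
  simp [killVar]

theorem X_dvd_sub_killVar (q : ℕ × ℕ) (p : JetRing) : X q ∣ p - killVar q p := by
  refine dvd_sub_of_subst (killVar q) (X q) (fun i => ?_) p
  rw [killVar_X]
  split_ifs with h
  · simp [h]
  · simp

theorem killVar_of_pderiv_eq_zero {q : ℕ × ℕ} {p : JetRing}
    (h : MvPolynomial.pderiv q p = 0) : killVar q p = p := by
  have hv := notMem_vars_of_pderiv_eq_zero h
  have h1 : killVar q p = aeval X p :=
    eval₂Hom_congr' rfl (fun i hi _ => if_neg (by rintro rfl; exact hv hi)) rfl
  rw [h1, aeval_X_left_apply]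

theorem pderiv_killVar (q : ℕ × ℕ) (p : JetRing) :
    MvPolynomial.pderiv q (killVar q p) = 0 := by
  classical
  induction p using MvPolynomial.induction_on with
  | C a => simp [killVar]
  | add p p' hp hp' => rw [map_add, map_add, hp, hp', add_zero]
  | mul_X p r hp =>
    rw [map_mul, Derivation.leibniz, hp, killVar_X]
    split_ifs with h
    · simp
    · simp [pderiv_X_of_ne h]

theorem glJet_X_zero (i j : Fin 2) : glJet i j (X (0, 0)) = 0 := by
  rw [glJet_X]
  fin_cases j <;> simp

theorem isHomogeneous_of_X_mul {q : ℕ × ℕ} {p : JetRing} {n : ℕ}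
    (h : (X q * p).IsHomogeneous (n + 1)) : p.IsHomogeneous n := by
  intro m hm
  have := h (d := Finsupp.single q 1 + m) (by rwa [coeff_X_mul])
  rw [map_add, Finsupp.weight_single] at this
  simp at this
  omega

/-- Vector fields that are encoded by differential polynomials, are equivariant under linear
transformations, and preserve the bi-vector `ϱ ∂x ∧ ∂y` for every `ϱ`, are Hamiltonian. -/
theorem exists_hamiltonian {n : ℕ} [NeZero n] {Y0 Y1 : JetRing}
    (h0 : Y0.IsHomogeneous (n + 1)) (h1 : Y1.IsHomogeneous (n + 1))
    (hY : X (1, 0) * Y0 + X (0, 1) * Y1 = X (0, 0) * (totalD 0 Y0 + totalD 1 Y1))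
    (hgl10 : glJet 1 0 Y0 = 0) (hgl00 : glJet 0 0 Y0 = (n : ℝ) • Y0)
    (hgl11 : glJet 1 1 Y0 = ((n + 1 : ℕ) : ℝ) • Y0) :
    ∃ h ∈ Submodule.span ℝ (Set.range fun ab : Fin n → Fin n × Fin n =>
        ∏ k, bracket (zeta (ab k).1) (zeta (ab k).2)),
      Y0 = X (0, 0) * totalD 1 (ofSymb h) ∧ Y1 = -(X (0, 0) * totalD 0 (ofSymb h)) := by
  classical
  set K := killVar (0, 0) with hK
  have hK10 : K (X (1, 0)) = X (1, 0) := by rw [hK, killVar_X, if_neg (by decide)]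
  have hK01 : K (X (0, 1)) = X (0, 1) := by rw [hK, killVar_X, if_neg (by decide)]
  have hK00 : K (X (0, 0)) = 0 := by rw [hK, killVar_X, if_pos rfl]
  -- The equation modulo ϱ, regarded as a variable independent of its derivatives.
  have e1 : X (1, 0) * K Y0 + X (0, 1) * K Y1 = 0 := by
    have := congrArg K hY
    rwa [map_mul, map_add, map_mul, map_mul, hK00, zero_mul, hK10, hK01] at this
  -- both components vanish on the zero locus of `ϱ` up to a multiple of the Hamiltonian field
  obtain ⟨g', hg'⟩ : X (0, 1) ∣ K Y0 := by
    have := congrArg (killVar (0, 1)) e1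
    rw [map_add, map_mul, map_mul, killVar_X, if_neg (by decide), killVar_X, if_pos rfl, map_zero,
      zero_mul, add_zero, mul_eq_zero, or_iff_right (X_ne_zero _)] at this
    have h := X_dvd_sub_killVar (0, 1) (K Y0)
    rwa [this, sub_zero] at h
  -- Applying `K` to the quotient makes it free of ϱ, since `K` fixes both K Y0 and X (0, 1).
  obtain ⟨g, hg00, hg⟩ : ∃ g, MvPolynomial.pderiv (0, 0) g = 0 ∧ K Y0 = X (0, 1) * g := by
    refine ⟨K g', pderiv_killVar _ _, ?_⟩
    have := congrArg K hg'
    rwa [map_mul, hK01, show K (K Y0) = K Y0 from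
      killVar_of_pderiv_eq_zero (pderiv_killVar _ _)] at this
  have hg1 : K Y1 = -(X (1, 0) * g) := by
    apply mul_left_cancel₀ (X_ne_zero (R := ℝ) ((0, 1) : ℕ × ℕ))
    rw [hg] at e1
    linear_combination e1
  obtain ⟨Z0, hZ0⟩ := X_dvd_sub_killVar (0, 0) Y0
  obtain ⟨Z1, hZ1⟩ := X_dvd_sub_killVar (0, 0) Y1
  rw [← hK, hg, sub_eq_iff_eq_add] at hZ0
  rw [← hK, hg1, sub_eq_iff_eq_add] at hZ1
  have hX (i : Fin 2) (q : ℕ × ℕ) : totalD i (X q) = (X (shift i q) : JetRing) := totalD_X i q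
  -- Substitute Y = ϱ Z + g (ϱ_y, -ϱ_x): the terms with ϱ_xy cancel in the divergence, the terms ϱ
  -- Z(ϱ) cancel between the two sides, and one factor ϱ is left to divide by.
  have e2 : X (0, 1) * totalD 0 g - X (1, 0) * totalD 1 g
      = X (0, 0) * -(totalD 0 Z0 + totalD 1 Z1) := by
    apply mul_left_cancel₀ (X_ne_zero (R := ℝ) ((0, 0) : ℕ × ℕ))
    rw [hZ0, hZ1] at hY
    simp only [map_add, map_neg, Derivation.leibniz, hX, smul_eq_mul, shift] at hY
    simp only [Matrix.cons_val_zero, Matrix.cons_val_one, zero_add] at hY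
    linear_combination -hY
  -- The left-hand side of `e2` is free of ϱ and the right-hand side is a multiple of ϱ, hence both
  -- vanish.
  have e3 : X (0, 1) * totalD 0 g - X (1, 0) * totalD 1 g = 0 := by
    have hne (i : Fin 2) (r : ℕ × ℕ) : shift i r ≠ (0, 0) := by
      fin_cases i <;> simp [shift]
    have hp : MvPolynomial.pderiv (0, 0) (X (0, 1) * totalD 0 g - X (1, 0) * totalD 1 g) = 0 := by
      rw [map_sub, Derivation.leibniz, Derivation.leibniz, pderiv_totalD_of_ne (hne 0),
        pderiv_totalD_of_ne (hne 1), hg00, pderiv_X_of_ne (by decide), pderiv_X_of_ne (by decide)]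
      simp
    rw [← killVar_of_pderiv_eq_zero hp, e2, map_mul, killVar_X, if_pos rfl, zero_mul]
  obtain ⟨c, rfl⟩ := eq_C_of_hamiltonian_derivative_eq_zero hg00 e3
  -- A nonzero c would give Y0 the linear term c ϱ_y, but Y0 is homogeneous of degree n + 1 ≥ 2.
  have hc : c = 0 := by
    by_contra hc
    have hco : coeff (Finsupp.single (0, 1) 1) Y0 = c := by
      rw [hZ0, coeff_add, mul_comm (X (0, 1)), coeff_C_mul, coeff_X_mul']
      simp
    have := h0 (d := Finsupp.single (0, 1) 1) (by rwa [hco])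
    rw [Finsupp.weight_single] at this
    simp at this
    exact NeZero.ne n this
  subst hc
  simp only [map_zero, mul_zero, add_zero, neg_zero] at hZ0 hZ1 e2
  subst hZ0 hZ1
  have hdiv : totalD 0 Z0 + totalD 1 Z1 = 0 := by
    have := e2.symm
    simp only [sub_zero, mul_eq_zero, X_ne_zero, false_or, neg_eq_zero] at this
    exact this
  have hglZ (i j : Fin 2) : glJet i j (X (0, 0) * Z0) = X (0, 0) * glJet i j Z0 := by
    rw [Derivation.leibniz, glJet_X_zero, smul_zero, add_zero, smul_eq_mul]
  have hcancel (i j : Fin 2) (c : ℝ) (h : glJet i j (X (0, 0) * Z0) = c • (X (0, 0) * Z0)) :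
      glJet i j Z0 = c • Z0 := by
    apply mul_left_cancel₀ (X_ne_zero (R := ℝ) ((0, 0) : ℕ × ℕ))
    rw [← hglZ, h, mul_smul_comm]
  obtain ⟨h, hmem, rfl, rfl⟩ := exists_hamiltonian_of_div_eq_zero (isHomogeneous_of_X_mul h0)
    (isHomogeneous_of_X_mul h1) hdiv (by simpa using hcancel 1 0 0 (by rw [hgl10, zero_smul]))
    (hcancel 0 0 _ hgl00) (hcancel 1 1 _ hgl11)
  exact ⟨h, hmem, rfl, by rw [mul_neg]⟩

/-! ### Vector fields and functions of graphs -/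

/-- The symbol of the component `Xⁱ` of the vector field of a linear combination of graphs. -/
def vectorSymb {n : ℕ} (i : Fin 2) : (WedgeGraph 1 n →₀ ℝ) →ₗ[ℝ] Symb (Fin n) :=
  Finsupp.linearCombination ℝ (graphSymb (sinkVec fun _ => i))

/-- The symbol of the function of a linear combination of graphs without sinks. -/
def functionSymb {n : ℕ} : (WedgeGraph 0 n →₀ ℝ) →ₗ[ℝ] Symb (Fin n) :=
  Finsupp.linearCombination ℝ (graphSymb (sinkVec Fin.elim0))

theorem comboOp_eq_jetEval {k n : ℕ} {V : Type*} [Fintype V] (c : WedgeGraph k n →₀ ℝ)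
    (P : BivField) (ϱ : Plane → ℝ) (f : Fin k → Plane → ℝ) (x : Plane)
    (g : WedgeGraph k n → Symb V)
    (h : ∀ Γ ∈ c.support, graphOp Γ P f x = jetEval ϱ (ofSymb (g Γ)) x) :
    comboOp c P f x = jetEval ϱ (ofSymb (Finsupp.linearCombination ℝ g c)) x := by
  rw [Finsupp.linearCombination_apply, Finsupp.sum, map_sum, jetEval_sum]
  unfold comboOp Finsupp.sum
  refine Finset.sum_congr rfl fun Γ hΓ => ?_
  change c Γ * graphOp Γ P f x = _
  rw [h Γ hΓ, map_smul, jetEval_smul]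

theorem vectorOf_eq_jetEval {n : ℕ} {c : WedgeGraph 1 n →₀ ℝ} (hc : ∀ Γ ∈ c.support, IsOneVector Γ)
    {ϱ : Plane → ℝ} (hϱ : ContDiff ℝ ∞ ϱ) (x : Plane) (i : Fin 2) :
    vectorOf c (bivector ϱ) x i = jetEval ϱ (ofSymb (vectorSymb i c)) x := by
  refine comboOp_eq_jetEval c _ ϱ _ x _ fun Γ hΓ => ?_
  refine graphOp_sinks hϱ Γ (fun _ => i) (fun s => ?_) _ (fun s => ?_) x
  · rw [Subsingleton.elim s 0]
    exact hc Γ hΓ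
  · rw [Subsingleton.elim s 0]
    rfl

theorem functionOf_eq_jetEval {n : ℕ} (c : WedgeGraph 0 n →₀ ℝ)
    {ϱ : Plane → ℝ} (hϱ : ContDiff ℝ ∞ ϱ) :
    functionOf c (bivector ϱ) = jetEval ϱ (ofSymb (functionSymb c)) := by
  funext x
  refine comboOp_eq_jetEval c _ ϱ _ x _ fun Γ _ => ?_
  exact graphOp_sinks hϱ Γ Fin.elim0 (fun s => s.elim0) _ (fun s => s.elim0) x

/-- Polynomials in the brackets are symbols of graphs. -/
theorem exists_functionSymb {n : ℕ} {h : Symb (Fin n)}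
    (hh : h ∈ Submodule.span ℝ (Set.range fun ab : Fin n → Fin n × Fin n =>
      ∏ k, bracket (zeta (ab k).1) (zeta (ab k).2))) :
    ∃ c : WedgeGraph 0 n →₀ ℝ, functionSymb c = h := by
  have hle : Submodule.span ℝ (Set.range fun ab : Fin n → Fin n × Fin n =>
      ∏ k, bracket (zeta (ab k).1) (zeta (ab k).2)) ≤ LinearMap.range functionSymb := by
    rw [Submodule.span_le]
    rintro _ ⟨ab, rfl⟩
    refine ⟨Finsupp.single (fun v => ![Sum.inr (ab v).1, Sum.inr (ab v).2]) 1, ?_⟩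
    rw [functionSymb, Finsupp.linearCombination_single, one_smul]
    rfl
  exact hle hh

theorem glSymb_bracket {V : Type*} [Fintype V] (i j : Fin 2) (a b : V) :
    glSymb V i j (bracket (zeta a) (zeta b)) = if i = j then bracket (zeta a) (zeta b) else 0 := by
  simp only [bracket, zeta, map_sub, Derivation.leibniz, glSymb_X, smul_eq_mul]
  fin_cases i <;> fin_cases j <;> simp <;> ring

theorem IsOneVector.exists_sink {n : ℕ} {Γ : WedgeGraph 1 n} (hΓ : IsOneVector Γ) :
    ∃ w s, ∀ v t, Γ v t = Sum.inl 0 ↔ v = w ∧ t = s := by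
  obtain ⟨⟨w, s⟩, h⟩ := Finset.card_eq_one.1 hΓ
  refine ⟨w, s, fun v t => ?_⟩
  have := Finset.ext_iff.1 h (v, t)
  simpa using this

/-- The linear transformations of the first component of a one-vector graph. -/
theorem glSymb_graphSymb {n : ℕ} {Γ : WedgeGraph 1 (n + 1)} (hΓ : IsOneVector Γ) :
    let y := graphSymb (sinkVec fun _ => 0) Γ
    glSymb _ 1 0 y = 0 ∧ glSymb _ 0 0 y = (n : ℝ) • y ∧
      glSymb _ 1 1 y = ((n + 1 : ℕ) : ℝ) • y := by
  obtain ⟨w, s, hs⟩ := hΓ.exists_sink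
  have haer (v : Fin (n + 1)) (t : Fin 2) (h : ¬(v = w ∧ t = s)) : ∃ a, Γ v t = Sum.inr a := by
    rcases hv : Γ v t with u | a
    · rw [Subsingleton.elim u 0] at hv
      exact absurd ((hs v t).1 hv) h
    · exact ⟨a, rfl⟩
  have hsink : Γ w s = Sum.inl 0 := (hs w s).2 ⟨rfl, rfl⟩
  -- The sink carries the constant covector (1, 0), so the wedge over it contributes ±ζ_{b,1}. The
  -- other n wedges are genuine invariant brackets.
  have hw : ∃ (b : Fin (n + 1)) (r : ℝ), bracket (sinkVec (fun _ => 0) (Γ w 0))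
      (sinkVec (fun _ => 0) (Γ w 1)) = r • (X (b, 1) : Symb (Fin (n + 1))) := by
    have h2 : s = 0 ∨ s = 1 := by fin_cases s <;> simp
    rcases h2 with rfl | rfl
    · obtain ⟨b, hb⟩ := haer w 1 (by simp)
      exact ⟨b, 1, by simp [hsink, hb, bracket, sinkVec]⟩
    · obtain ⟨b, hb⟩ := haer w 0 (by simp)
      exact ⟨b, -1, by simp [hsink, hb, bracket, sinkVec]⟩
  obtain ⟨b, r, hbr⟩ := hw
  have hv (v : Fin (n + 1)) (h : v ≠ w) : ∃ a b, bracket (sinkVec (fun _ => 0) (Γ v 0))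
      (sinkVec (fun _ => 0) (Γ v 1)) = bracket (zeta a) (zeta b : Fin 2 → Symb (Fin (n + 1))) := by
    obtain ⟨a, ha⟩ := haer v 0 fun h' => h h'.1
    obtain ⟨b, hb⟩ := haer v 1 fun h' => h h'.1
    exact ⟨a, b, by simp [ha, hb, sinkVec, zeta, bracket]⟩
  intro y
  -- The eigenvalues add up over the wedges: the one over the sink gives l, each other bracket gives
  -- the trace of the infinitesimal transformation.
  have key (i j : Fin 2) (l : ℝ) (hX : glSymb (Fin (n + 1)) i j (X (b, 1)) = l • X (b, 1)) :
      glSymb _ i j y = (∑ v, if v = w then l else if i = j then 1 else 0) • y := by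
    refine derivation_prod_of_eigen _ _ _ _ fun v _ => ?_
    by_cases h : v = w
    · rw [if_pos h, h, hbr, Derivation.map_smul, hX, smul_comm]
    · obtain ⟨a, b, hab⟩ := hv v h
      rw [if_neg h, hab, glSymb_bracket]
      split_ifs <;> simp
  refine ⟨?_, ?_, ?_⟩
  · rw [key 1 0 0 (by simp [glSymb_X])]
    simp
  · rw [key 0 0 0 (by simp [glSymb_X])]
    congr 1
    simp [Finset.sum_ite, Finset.filter_ne', Finset.card_erase_of_mem]
  · rw [key 1 1 1 (by simp [glSymb_X])]
    simp

theorem glSymb_vectorSymb {n : ℕ} {c : WedgeGraph 1 (n + 1) →₀ ℝ}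
    (hc : ∀ Γ ∈ c.support, IsOneVector Γ) :
    glSymb _ 1 0 (vectorSymb 0 c) = 0 ∧ glSymb _ 0 0 (vectorSymb 0 c) = (n : ℝ) • vectorSymb 0 c ∧
      glSymb _ 1 1 (vectorSymb 0 c) = ((n + 1 : ℕ) : ℝ) • vectorSymb 0 c := by
  simp only [vectorSymb, Finsupp.linearCombination_apply, Finsupp.sum, map_sum, Finset.smul_sum,
    Derivation.map_smul]
  refine ⟨Finset.sum_eq_zero fun Γ h => ?_, Finset.sum_congr rfl fun Γ h => ?_,
    Finset.sum_congr rfl fun Γ h => ?_⟩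
  · rw [(glSymb_graphSymb (hc Γ h)).1, smul_zero]
  · rw [(glSymb_graphSymb (hc Γ h)).2.1, smul_comm]
  · rw [(glSymb_graphSymb (hc Γ h)).2.2, smul_comm]

/-! ### Schouten brackets -/

/-- The component of the bracket `⟦P, Y⟧` as a differential polynomial. -/
def schoutenJet (Y : Fin 2 → JetRing) : JetRing :=
  X (0, 0) * (totalD 0 (Y 0) + totalD 1 (Y 1)) - (X (1, 0) * Y 0 + X (0, 1) * Y 1)

theorem jetEval_X (ϱ : Plane → ℝ) (x : Plane) (a b : ℕ) :
    jetEval ϱ (X (a, b)) x = mderiv ![a, b] ϱ x := by simp [jetEval, jet]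

theorem jetEval_X_zero (ϱ : Plane → ℝ) : jetEval ϱ (X (0, 0)) = ϱ := by
  funext x
  rw [jetEval_X]
  rfl

theorem jetEval_mul (ϱ : Plane → ℝ) (x : Plane) (p q : JetRing) :
    jetEval ϱ (p * q) x = jetEval ϱ p x * jetEval ϱ q x := by simp [jetEval]

theorem jetEval_add (ϱ : Plane → ℝ) (x : Plane) (p q : JetRing) :
    jetEval ϱ (p + q) x = jetEval ϱ p x + jetEval ϱ q x := by simp [jetEval]

theorem jetEval_sub (ϱ : Plane → ℝ) (x : Plane) (p q : JetRing) :
    jetEval ϱ (p - q) x = jetEval ϱ p x - jetEval ϱ q x := by simp [jetEval]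

theorem jetEval_neg (ϱ : Plane → ℝ) (x : Plane) (p : JetRing) :
    jetEval ϱ (-p) x = -jetEval ϱ p x := by simp [jetEval]

/-- An antisymmetric tensor on the plane has one independent component, here ϱ div W - W(ϱ). -/
theorem schoutenBV_eq_jetEval {ϱ : Plane → ℝ} (hϱ : ContDiff ℝ ∞ ϱ) (Y : Fin 2 → JetRing)
    {W : VField} (hW : ∀ x i, W x i = jetEval ϱ (Y i) x) (x : Plane) (i j : Fin 2) :
    schoutenBV (bivector ϱ) W x i j = eps i j * jetEval ϱ (schoutenJet Y) x := by
  have h1 (i k : Fin 2) : pderiv k (fun y => W y i) x = jetEval ϱ (totalD k (Y i)) x := by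
    have : (fun y => W y i) = jetEval ϱ (Y i) := funext fun y => hW y i
    rw [this, pderiv_jetEval hϱ]
  have h2 (i j k : Fin 2) : pderiv k (fun y => bivector ϱ y i j) x
      = eps i j * jetEval ϱ (X (shift k (0, 0))) x := by
    simp only [bivector_apply]
    rw [pderiv_const_mul hϱ]
    conv_lhs => rw [← jetEval_X_zero ϱ]
    rw [pderiv_jetEval hϱ, totalD_X]
  unfold schoutenBV schoutenJet
  simp only [h1, h2]
  simp only [hW, bivector_apply, jetEval_mul, jetEval_add, jetEval_sub, Fin.sum_univ_two,
    jetEval_X_zero]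
  fin_cases i <;> fin_cases j <;> simp [eps, shift] <;> ring

theorem schoutenBF_eq_jetEval {ϱ : Plane → ℝ} (hϱ : ContDiff ℝ ∞ ϱ) (h : JetRing) (x : Plane)
    (i : Fin 2) : schoutenBF (bivector ϱ) (jetEval ϱ h) x i
      = jetEval ϱ (![X (0, 0) * totalD 1 h, -(X (0, 0) * totalD 0 h)] i) x := by
  unfold schoutenBF
  simp only [pderiv_jetEval hϱ, bivector_apply, Fin.sum_univ_two]
  fin_cases i <;> simp [eps, jetEval_mul, jetEval_neg, jetEval_X_zero]

theorem totalD_comm (p : JetRing) : totalD 0 (totalD 1 p) = totalD 1 (totalD 0 p) := by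
  have h : ⁅totalD 0, totalD 1⁆ = 0 := by
    refine derivation_ext fun k => ?_
    rw [Derivation.commutator_apply]
    simp [shift]
  have := DFunLike.congr_fun h p
  rwa [Derivation.commutator_apply, Derivation.zero_apply, sub_eq_zero] at this

theorem schoutenJet_add (Y Y' : Fin 2 → JetRing) :
    schoutenJet (fun i => Y i + Y' i) = schoutenJet Y + schoutenJet Y' := by
  simp only [schoutenJet, map_add]
  ring

theorem schoutenJet_hamiltonian (h : JetRing) :
    schoutenJet ![X (0, 0) * totalD 1 h, -(X (0, 0) * totalD 0 h)] = 0 := by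
  simp only [schoutenJet, Matrix.cons_val_zero, Matrix.cons_val_one, map_neg, Derivation.leibniz,
    totalD_X, totalD_comm, smul_eq_mul, shift, zero_add]
  ring

/-! ### The vector field with the Hamiltonian `Ham` -/

/-- The vertices of the graphs in the Hamiltonian. -/
def vertexEquiv : Fin 1 ⊕ Fin 4 ≃ Fin 5 := finSumFinEquiv

/-- The symbol of the Hamiltonian. -/
def hamSymb : Symb (Fin 5) :=
  Finsupp.linearCombination ℝ (graphSymb fun u i => X (vertexEquiv u, i)) hamGraphs5

theorem ham5_eq_jetEval {ϱ : Plane → ℝ} (hϱ : ContDiff ℝ ∞ ϱ) :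
    ham5 ϱ = jetEval ϱ (ofSymb hamSymb) := by
  funext x
  refine comboOp_eq_jetEval _ _ ϱ _ x _ fun Γ _ => ?_
  refine graphOp_all hϱ Γ vertexEquiv _ (fun s => ?_) x
  rw [Subsingleton.elim s 0]
  rfl

/-- The components of the vector field with the Hamiltonian `Ham`. -/
def fieldJet : Fin 2 → JetRing :=
  ![totalD 1 (ofSymb hamSymb), -totalD 0 (ofSymb hamSymb)]

theorem field5_eq_jetEval {ϱ : Plane → ℝ} (hϱ : ContDiff ℝ ∞ ϱ) (x : Plane) (i : Fin 2) :
    field5 ϱ x i = jetEval ϱ (fieldJet i) x := by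
  have h (k : Fin 2) : fderiv ℝ (ham5 ϱ) x (Pi.single k 1)
      = jetEval ϱ (totalD k (ofSymb hamSymb)) x := by
    rw [← pderiv_jetEval hϱ, ← ham5_eq_jetEval hϱ]
    rfl
  unfold field5 omegaInv
  rw [h, h]
  fin_cases i <;> simp [fieldJet, jetEval_neg]

theorem isOneVector_issueWedge {n : ℕ} (Γ : WedgeGraph 1 n) (i : Fin (n + 1)) :
    IsOneVector (issueWedge Γ i) := by
  classical
  unfold IsOneVector
  rw [Finset.card_eq_one]
  refine ⟨(0, 0), ?_⟩
  ext ⟨v, s⟩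
  simp only [Finset.mem_filter, Finset.mem_univ, true_and, Finset.mem_singleton, Prod.mk.injEq]
  refine Fin.cases ?_ (fun v => ?_) v
  · fin_cases s <;> simp [issueWedge]
  · rcases h : Γ v s with u | w <;> simp [issueWedge, h, Fin.succ_ne_zero]

theorem isOneVector_of_mem_support {Γ : WedgeGraph 1 5} (h : Γ ∈ fieldGraphs5.support) :
    IsOneVector Γ := by
  classical
  unfold fieldGraphs5 at h
  obtain ⟨Γ', -, h'⟩ := Finset.mem_biUnion.1 (Finsupp.support_sum h)
  obtain ⟨i, -, hi⟩ := Finset.mem_biUnion.1 (Finsupp.support_finsetSum h')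
  rw [Finset.mem_singleton.1 (Finsupp.support_single_subset hi)]
  exact isOneVector_issueWedge _ _

/-- The new wedge over the sink contributes ζ_{i,1} or -ζ_{i,0}, depending on the component; summing
over i gives the symbol of ω₂⁻¹ d. The remaining factors agree because the terminal vertex and the
new top both have number 0. -/
theorem sum_graphSymb_issueWedge (Γ : WedgeGraph 1 4) (k : Fin 2) :
    ∑ i, graphSymb (sinkVec fun _ => k) (issueWedge Γ i)
      = ![totalSymb (Fin 5) 1, -totalSymb (Fin 5) 0] k
        * graphSymb (fun u i => (X (vertexEquiv u, i) : Symb (Fin 5))) Γ := by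
  have h (i : Fin 5) : graphSymb (sinkVec fun _ => k) (issueWedge Γ i)
      = (![X (i, 1), -X (i, 0)] k : Symb (Fin 5))
        * graphSymb (fun u i => (X (vertexEquiv u, i) : Symb (Fin 5))) Γ := by
    unfold graphSymb
    rw [Fin.prod_univ_succ]
    refine congrArg₂ (· * ·) ?_ ?_
    · fin_cases k <;> simp [issueWedge, bracket, sinkVec]
    · refine Finset.prod_congr rfl fun v _ => ?_
      have hv (s : Fin 2) : (sinkVec (fun _ => k) (issueWedge Γ i v.succ s) : Fin 2 → Symb (Fin 5))
          = fun j => X (vertexEquiv (Γ v s), j) := by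
        rcases hΓ : Γ v s with u | w
        · rw [Subsingleton.elim u 0] at hΓ
          have : vertexEquiv (Sum.inl u) = 0 := by rw [Subsingleton.elim u 0]; rfl
          simp [issueWedge, hΓ, sinkVec, this]
        · have : vertexEquiv (Sum.inr w) = w.succ := by fin_cases w <;> rfl
          simp [issueWedge, hΓ, sinkVec, this]
      rw [hv, hv]
  simp only [h, ← Finset.sum_mul]
  refine congrArg (· * _) ?_
  fin_cases k <;> simp [totalSymb]

theorem ofSymb_vectorSymb_fieldGraphs5 (k : Fin 2) :
    ofSymb (vectorSymb k fieldGraphs5) = fieldJet k := by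
  have h : vectorSymb k fieldGraphs5 = ![totalSymb (Fin 5) 1, -totalSymb (Fin 5) 0] k * hamSymb := by
    unfold fieldGraphs5 hamSymb vectorSymb
    rw [Finsupp.sum, map_sum, Finsupp.linearCombination_apply, Finsupp.sum, Finset.mul_sum]
    refine Finset.sum_congr rfl fun Γ _ => ?_
    rw [map_sum, mul_smul_comm, ← sum_graphSymb_issueWedge, Finset.smul_sum]
    refine Finset.sum_congr rfl fun i _ => ?_
    rw [Finsupp.linearCombination_single]
  rw [h]
  fin_cases k
  · exact ofSymb_totalSymb_mul 1 hamSymb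
  · change ofSymb (-totalSymb (Fin 5) 0 * hamSymb) = -totalD 0 (ofSymb hamSymb)
    rw [neg_mul, map_neg, ofSymb_totalSymb_mul]

theorem field5_eq_vectorOf {ϱ : Plane → ℝ} (hϱ : ContDiff ℝ ∞ ϱ) :
    field5 ϱ = vectorOf fieldGraphs5 (bivector ϱ) := by
  funext x i
  rw [field5_eq_jetEval hϱ, vectorOf_eq_jetEval (fun _ => isOneVector_of_mem_support) hϱ,
    ofSymb_vectorSymb_fieldGraphs5]

/-- Uniqueness of the trivializing vector field up to Hamiltonian vector fields of graphs. -/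
theorem schouten_eq_iff {c : WedgeGraph 1 5 →₀ ℝ} (hc : ∀ Γ ∈ c.support, IsOneVector Γ) :
    (∀ ϱ : Plane → ℝ, ContDiff ℝ ∞ ϱ → schoutenBV (bivector ϱ) (field5 ϱ)
        = schoutenBV (bivector ϱ) (vectorOf c (bivector ϱ))) ↔
      ∃ h : WedgeGraph 0 4 →₀ ℝ, ∀ ϱ : Plane → ℝ, ContDiff ℝ ∞ ϱ →
        vectorOf c (bivector ϱ)
          = field5 ϱ + schoutenBF (bivector ϱ) (functionOf h (bivector ϱ)) := by
  classical
  constructor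
  · intro H
    have hc' : ∀ Γ ∈ (c - fieldGraphs5).support, IsOneVector Γ := by
      intro Γ hΓ
      rcases Finset.mem_union.1 (Finsupp.support_sub hΓ) with h | h
      · exact hc Γ h
      · exact isOneVector_of_mem_support h
    set Y : Fin 2 → JetRing := fun i => ofSymb (vectorSymb i (c - fieldGraphs5)) with hY
    have hYc (i : Fin 2) : ofSymb (vectorSymb i c) = fieldJet i + Y i := by
      rw [hY]
      simp only [map_sub, ofSymb_vectorSymb_fieldGraphs5]
      ring
    have hzero : schoutenJet Y = 0 := by
      refine eq_zero_of_jetEval _ fun ϱ hϱ => ?_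
      -- The component (0, 1) at the origin suffices, since all finite jets are realised there.
      have h1 := congrFun (congrFun (congrFun (H ϱ hϱ) 0) 0) 1
      rw [schoutenBV_eq_jetEval hϱ fieldJet (field5_eq_jetEval hϱ),
        schoutenBV_eq_jetEval hϱ (fun i => fieldJet i + Y i)
          (fun x i => by rw [vectorOf_eq_jetEval hc hϱ, hYc]), schoutenJet_add, jetEval_add] at h1
      simpa [eps] using h1
    obtain ⟨g10, g00, g11⟩ := glSymb_vectorSymb hc'
    -- Five wedges over one sink give homogeneity of degree 5 = n + 1. One factor ϱ is absorbed by
    -- P, which leaves four wedges for the Hamiltonian.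
    obtain ⟨h, hmem, h0, h1⟩ := exists_hamiltonian (n := 4) (Y0 := Y 0) (Y1 := Y 1)
      (isHomogeneous_ofSymb _) (isHomogeneous_ofSymb _) (sub_eq_zero.1 hzero).symm
      (by rw [hY, ← ofSymb_glSymb, g10, map_zero])
      (by rw [hY, ← ofSymb_glSymb, g00, map_smul])
      (by rw [hY, ← ofSymb_glSymb, g11, map_smul])
    obtain ⟨c', rfl⟩ := exists_functionSymb hmem
    refine ⟨c', fun ϱ hϱ => ?_⟩
    funext x i
    rw [vectorOf_eq_jetEval hc hϱ, hYc, jetEval_add, Pi.add_apply, Pi.add_apply,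
      field5_eq_jetEval hϱ, functionOf_eq_jetEval c' hϱ, schoutenBF_eq_jetEval hϱ]
    fin_cases i
    · exact congrArg (fun p => _ + jetEval ϱ p x) h0
    · exact congrArg (fun p => _ + jetEval ϱ p x) h1
  · rintro ⟨h, H⟩ ϱ hϱ
    funext x i j
    rw [schoutenBV_eq_jetEval hϱ fieldJet (field5_eq_jetEval hϱ),
      schoutenBV_eq_jetEval hϱ (fun i => fieldJet i + ![X (0, 0) * totalD 1 (ofSymb (functionSymb h)),
        -(X (0, 0) * totalD 0 (ofSymb (functionSymb h)))] i) (fun x i => by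
          rw [H ϱ hϱ, Pi.add_apply, Pi.add_apply, field5_eq_jetEval hϱ,
            functionOf_eq_jetEval h hϱ, schoutenBF_eq_jetEval hϱ, jetEval_add]),
      schoutenJet_add, schoutenJet_hamiltonian, add_zero]

/-! ### Computations with encoded monomials

A list of exponents `(a₀, b₀), (a₁, b₁), …` below `32` is encoded by a natural number with the
digits `32 aᵥ + bᵥ` to the base `1024`. -/

/-- The code of the component `k` of the covector with the number `c`: the vertices have the
numbers `0, …, n - 1`, and the numbers `n`, `n + 1` stand for the basic covectors with the numbers
`a`, `b`, the components of which are zero or one. -/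
def componentCode (n a b c k : ℕ) : Option ℕ :=
  bif Nat.blt c n then some ((bif Nat.beq k 0 then 32 else 1) * 1024 ^ c)
  else bif Nat.beq (bif Nat.beq c n then a else b) k then some 0 else none

/-- Evaluate a natural number before it is used. -/
def force {α : Type} (k : ℕ) (f : ℕ → α) : α :=
  match k with
  | 0 => f 0
  | k + 1 => f (k + 1)

/-- Evaluate the entries of a list of pairs before it is used. -/
def forcePairs {α : Type} : List (ℕ × ℕ) → (List (ℕ × ℕ) → α) → α
  | [], f => f []
  | e :: l, f => force e.1 fun a => force e.2 fun b => forcePairs l fun l => f ((a, b) :: l)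

/-- The terms of the product of brackets with a given term. -/
def bracketTerms (n a b : ℕ) : List (ℕ × ℕ) → ℤ → ℕ → List (ℤ × ℕ)
  | [], c, K => [(c, K)]
  | e :: es, c, K => force e.1 fun u => force e.2 fun v =>
    (match componentCode n a b u 0, componentCode n a b v 1 with
      | some x, some y => force (K + x + y) (bracketTerms n a b es c)
      | _, _ => []) ++
    (match componentCode n a b u 1, componentCode n a b v 0 with
      | some x, some y => force (K + x + y) (bracketTerms n a b es (-c))
      | _, _ => [])

/-- The lists of `m` Boolean values. -/
def boolLists : ℕ → List (List Bool)
  | 0 => [[]]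
  | m + 1 => (boolLists m).flatMap fun l => [true :: l, false :: l]

/-- The tails and heads of directed edges. -/
def directEdges (E : List (ℕ × ℕ)) (l : List Bool) : List (ℕ × ℕ) :=
  List.zipWith (fun e b => bif b then e else (e.2, e.1)) E l

/-- The arrows with the tail `v`. -/
def arrowsFrom (A : List (ℕ × ℕ)) (v : ℕ) : List (ℕ × ℕ) := A.filter fun e => Nat.beq e.1 v

/-- The number of inversions. -/
def inversions : List ℕ → ℕ
  | [] => 0
  | a :: l => (l.filter fun b => Nat.blt b a).length + inversions l

/-- The heads of the two arrows. -/
def headPair : List (ℕ × ℕ) → ℕ × ℕ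
  | e :: e' :: _ => (e.2, e'.2)
  | _ => (0, 0)

/-- The terms of one directed graph, given by the tails and heads of the arrows. -/
def arrowTerms (a b : ℕ) (A : List (ℕ × ℕ)) : List (ℤ × ℕ) :=
  bif (List.range 6).all fun v => Nat.beq (arrowsFrom A v).length 2 then
    bracketTerms 6 a b ((List.range 6).map fun v => headPair (arrowsFrom A v))
      (bif Nat.beq (inversions (A.map Prod.fst) % 2) 0 then 1 else -1) 0
  else []

/-- The number with the octal digits equal to the numbers of arrows issued from the vertices. -/
def tailCode (A : List (ℕ × ℕ)) : ℕ := (A.map fun e => 8 ^ e.1).sum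

/-- The terms of the orientation of a graph on six vertices with ten edges. -/
def orientTerms (E : List (ℕ × ℕ)) (a b : ℕ) : List (ℤ × ℕ) :=
  (boolLists 10).flatMap fun l => forcePairs (directEdges E l) fun A => force (tailCode A) fun T =>
    -- A fast filter: T has the out-degrees as its octal digits, and adding one to a digit at most 2
    -- does not set its bit of value 4. Directings with an out-degree above two are thus skipped.
    bif Nat.beq (Nat.land (T + 0o111111) 0o444444) 0 then
      (List.range 6).flatMap fun s => (List.range 6).flatMap fun s' =>
        bif Nat.beq (T + 8 ^ s + 8 ^ s') 0o222222 then
          forcePairs (A ++ [(s, 6), (s', 7)]) (arrowTerms a b)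
        else []
    else []

/-- The terms of the Hamiltonian. -/
def hamTerms : List (ℤ × ℕ) :=
  bracketTerms 5 0 0 [(2, 3), (3, 4), (0, 1), (0, 2)] 6 0
    ++ (bracketTerms 5 0 0 [(2, 3), (3, 4), (0, 1), (0, 3)] (-2) 0
    ++ bracketTerms 5 0 0 [(0, 4), (0, 3), (0, 1), (0, 2)] (-2) 0)

/-- The terms of the product of a derivative of the Hamiltonian with a derivative of `ϱ`. -/
def derivHamTerms (w r : ℕ) (m : ℤ) : List (ℤ × ℕ) :=
  -- Adding w · 1024 ^ v, with w = 32 or 1, differentiates the content of vertex v along x or y. The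
  -- new lowest digit r encodes the extra factor, a first derivative of ϱ.
  hamTerms.flatMap fun t => (List.range 5).map fun v => (m * t.1, (t.2 + w * 1024 ^ v) * 1024 + r)

/-- Multiply all the coefficients by an integer. -/
def scale (m : ℤ) (p : List (ℤ × ℕ)) : List (ℤ × ℕ) := p.map fun t => (m * t.1, t.2)

/-- The digits of a code. -/
def digits : ℕ → ℕ → List ℕ
  | 0, _ => []
  | n + 1, K => K % 1024 :: digits n (K / 1024)

/-- The code with given digits. -/
def ofDigits (l : List ℕ) : ℕ :=
  List.rec (motive := fun _ => ℕ) 0 (fun d _ r => Nat.add d (Nat.mul 1024 r)) l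

/-- Insertion into a sorted list. -/
def insertDigit (d : ℕ) (l : List ℕ) : List ℕ :=
  List.rec (motive := fun _ => List ℕ) [d]
    (fun e l r => bif Nat.ble d e then d :: e :: l else e :: r) l

/-- The sorted list of the digits of a code. -/
def sortedDigits (n : ℕ) : ℕ → List ℕ :=
  Nat.rec (motive := fun _ => ℕ → List ℕ) (fun _ => [])
    (fun _ f K => force (Nat.mod K 1024) fun d => insertDigit d (f (Nat.div K 1024))) n

/-- Search trees of coefficients. -/
inductive CoeffTree
  | leaf : CoeffTree
  | node : CoeffTree → ℕ → ℤ → CoeffTree → CoeffTree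

/-- Evaluate an integer before it is used. -/
def forceInt {α : Type} (c : ℤ) (f : ℤ → α) : α :=
  match c with
  | .ofNat k => force k fun k => f (.ofNat k)
  | .negSucc k => force k fun k => f (.negSucc k)

/-- Add a coefficient and pass the tree to a continuation. -/
def CoeffTree.insert {α : Type} (k : ℕ) (c : ℤ) : CoeffTree → (CoeffTree → α) → α
  | leaf, f => f (node leaf k c leaf)
  | node l k' c' r, f => bif Nat.beq k k' then forceInt (c + c') fun c => f (node l k' c r)
    else bif Nat.blt k k' then l.insert k c fun l => f (node l k' c' r)
    else r.insert k c fun r => f (node l k' c' r)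

/-- All the coefficients vanish. -/
def CoeffTree.allZero : CoeffTree → Bool
  | leaf => true
  | node l _ c r => decide (c = 0) && (l.allZero && r.allZero)

/-- Collect similar terms, up to permutations of digits, and test if they cancel out. -/
def zeroTest : List (ℤ × ℕ) → CoeffTree → Bool
  | [], T => T.allZero
  | t :: p, T => force (ofDigits (sortedDigits 6 t.2)) fun k =>
      forceInt t.1 fun c => T.insert k c (zeroTest p)

/-- The edges of the pentagon wheel. -/
def wheelEdges : List (ℕ × ℕ) :=
  [(0, 1), (1, 2), (2, 3), (3, 4), (4, 0), (0, 5), (1, 5), (2, 5), (3, 5), (4, 5)]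

/-- The edges of the prism with a diagonal. -/
def prismEdges : List (ℕ × ℕ) :=
  [(0, 1), (1, 2), (2, 3), (3, 0), (3, 4), (0, 4), (4, 5), (2, 5), (1, 5), (0, 2)]

/-- The terms with given coefficients and orders of the derivatives of `ϱ`. -/
def explicitTerms (L : List (ℤ × List (ℕ × ℕ))) : List (ℤ × ℕ) :=
  L.map fun t => (t.1, ofDigits (t.2.map fun e => 32 * e.1 + e.2))

/-- The component `Q⁰¹` of the bi-vector of the orientation of the pentagon wheel. -/
def wheelTerms : List (ℤ × ℕ) :=
  explicitTerms [
    (2, [(0, 5), (1, 0), (1, 0), (1, 0), (1, 0), (1, 0)]),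
    (-20, [(0, 3), (1, 0), (1, 0), (1, 0), (1, 1), (1, 1)]),
    (40, [(0, 2), (1, 0), (1, 0), (1, 0), (1, 1), (1, 2)]),
    (-20, [(0, 1), (1, 0), (1, 0), (1, 1), (1, 1), (1, 2)]),
    (-10, [(0, 1), (1, 0), (1, 0), (1, 0), (1, 0), (1, 4)]),
    (40, [(0, 1), (0, 3), (1, 0), (1, 0), (1, 1), (2, 0)]),
    (-40, [(0, 1), (0, 2), (1, 0), (1, 0), (1, 2), (2, 0)]),
    (-20, [(0, 1), (0, 1), (0, 3), (1, 0), (2, 0), (2, 0)]),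
    (20, [(0, 1), (0, 1), (0, 1), (1, 2), (2, 0), (2, 0)]),
    (-20, [(0, 2), (0, 2), (1, 0), (1, 0), (1, 0), (2, 1)]),
    (20, [(0, 1), (0, 1), (1, 0), (1, 1), (1, 1), (2, 1)]),
    (40, [(0, 1), (0, 1), (0, 2), (1, 0), (2, 0), (2, 1)]),
    (-40, [(0, 1), (0, 1), (0, 1), (1, 1), (2, 0), (2, 1)]),
    (20, [(0, 1), (0, 1), (1, 0), (1, 0), (1, 0), (2, 3)]),
    (20, [(0, 1), (0, 2), (0, 2), (1, 0), (1, 0), (3, 0)]),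
    (-40, [(0, 1), (0, 1), (0, 2), (1, 0), (1, 1), (3, 0)]),
    (20, [(0, 1), (0, 1), (0, 1), (1, 1), (1, 1), (3, 0)]),
    (-20, [(0, 1), (0, 1), (0, 1), (1, 0), (1, 0), (3, 2)]),
    (10, [(0, 1), (0, 1), (0, 1), (0, 1), (1, 0), (4, 1)]),
    (-2, [(0, 1), (0, 1), (0, 1), (0, 1), (0, 1), (5, 0)])]

/-- The component `Q⁰¹` of the bi-vector of the orientation of the prism with a diagonal. -/
def prismTerms : List (ℤ × ℕ) :=
  explicitTerms [
    (4, [(0, 4), (1, 0), (1, 0), (1, 0), (1, 0), (1, 1)]),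
    (8, [(0, 3), (1, 0), (1, 0), (1, 0), (1, 1), (1, 1)]),
    (-24, [(0, 2), (1, 0), (1, 0), (1, 0), (1, 1), (1, 2)]),
    (24, [(0, 1), (1, 0), (1, 0), (1, 1), (1, 1), (1, 2)]),
    (-4, [(0, 2), (1, 0), (1, 0), (1, 0), (1, 0), (1, 3)]),
    (-8, [(0, 1), (1, 0), (1, 0), (1, 0), (1, 1), (1, 3)]),
    (4, [(0, 2), (0, 3), (1, 0), (1, 0), (1, 0), (2, 0)]),
    (-4, [(0, 1), (0, 4), (1, 0), (1, 0), (1, 0), (2, 0)]),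
    (-24, [(0, 1), (0, 3), (1, 0), (1, 0), (1, 1), (2, 0)]),
    (12, [(0, 1), (0, 2), (1, 0), (1, 0), (1, 2), (2, 0)]),
    (12, [(0, 1), (0, 1), (1, 0), (1, 0), (1, 3), (2, 0)]),
    (12, [(0, 1), (0, 1), (0, 3), (1, 0), (2, 0), (2, 0)]),
    (-12, [(0, 1), (0, 1), (0, 1), (1, 2), (2, 0), (2, 0)]),
    (12, [(0, 2), (0, 2), (1, 0), (1, 0), (1, 0), (2, 1)]),
    (-24, [(0, 1), (0, 1), (1, 0), (1, 1), (1, 1), (2, 1)]),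
    (-12, [(0, 1), (0, 1), (0, 2), (1, 0), (2, 0), (2, 1)]),
    (24, [(0, 1), (0, 1), (0, 1), (1, 1), (2, 0), (2, 1)]),
    (12, [(0, 1), (0, 2), (1, 0), (1, 0), (1, 0), (2, 2)]),
    (-12, [(0, 1), (0, 1), (0, 1), (1, 0), (2, 0), (2, 2)]),
    (-12, [(0, 1), (0, 2), (0, 2), (1, 0), (1, 0), (3, 0)]),
    (24, [(0, 1), (0, 1), (0, 2), (1, 0), (1, 1), (3, 0)]),
    (-8, [(0, 1), (0, 1), (0, 1), (1, 1), (1, 1), (3, 0)]),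
    (-4, [(0, 1), (0, 1), (0, 1), (0, 2), (2, 0), (3, 0)]),
    (-12, [(0, 1), (0, 1), (0, 2), (1, 0), (1, 0), (3, 1)]),
    (8, [(0, 1), (0, 1), (0, 1), (1, 0), (1, 1), (3, 1)]),
    (4, [(0, 1), (0, 1), (0, 1), (0, 1), (2, 0), (3, 1)]),
    (4, [(0, 1), (0, 1), (0, 1), (0, 2), (1, 0), (4, 0)]),
    (-4, [(0, 1), (0, 1), (0, 1), (0, 1), (1, 1), (4, 0)])]

/-! ### Differential polynomials given by lists of terms -/

/-- The differential monomial with given digits. -/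
def digitMonomial (l : List ℕ) : JetRing := (l.map fun d => X (d / 32, d % 32)).prod

/-- The differential polynomial with given terms. -/
def termsValue (n : ℕ) (p : List (ℤ × ℕ)) : JetRing :=
  (p.map fun t => (t.1 : ℝ) • digitMonomial (digits n t.2)).sum

theorem termsValue_append (n : ℕ) (p q : List (ℤ × ℕ)) :
    termsValue n (p ++ q) = termsValue n p + termsValue n q := by
  simp [termsValue]

theorem termsValue_nil (n : ℕ) : termsValue n [] = 0 := rfl

theorem termsValue_flatMap {α : Type*} (n : ℕ) (l : List α) (f : α → List (ℤ × ℕ)) :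
    termsValue n (l.flatMap f) = (l.map fun a => termsValue n (f a)).sum := by
  induction l with
  | nil => rfl
  | cons a l ih => rw [List.flatMap_cons, termsValue_append, ih, List.map_cons, List.sum_cons]

theorem termsValue_scale (n : ℕ) (m : ℤ) (p : List (ℤ × ℕ)) :
    termsValue n (scale m p) = (m : ℝ) • termsValue n p := by
  induction p with
  | nil => simp [scale, termsValue]
  | cons t p ih =>
    have h1 (t : ℤ × ℕ) (p : List (ℤ × ℕ)) : termsValue n (t :: p)
        = (t.1 : ℝ) • digitMonomial (digits n t.2) + termsValue n p := rfl
    have h2 : scale m (t :: p) = (m * t.1, t.2) :: scale m p := rfl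
    rw [h2, h1, h1, ih, smul_add, smul_smul]
    push_cast
    rfl

/-! ### Collection of similar terms -/

theorem force_eq {α : Type} (k : ℕ) (f : ℕ → α) : force k f = f k := by cases k <;> rfl

theorem forceInt_eq {α : Type} (c : ℤ) (f : ℤ → α) : forceInt c f = f c := by
  cases c <;> simp [forceInt, force_eq]

theorem forcePairs_eq {α : Type} (l : List (ℕ × ℕ)) (f : List (ℕ × ℕ) → α) :
    forcePairs l f = f l := by
  induction l generalizing f with
  | nil => rfl
  | cons e l ih => rw [forcePairs, force_eq, force_eq, ih]

theorem insertDigit_perm (d : ℕ) (l : List ℕ) : (insertDigit d l).Perm (d :: l) := by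
  induction l with
  | nil => exact List.Perm.refl _
  | cons e l ih =>
    change (bif Nat.ble d e then d :: e :: l else e :: insertDigit d l).Perm _
    cases Nat.ble d e
    · exact (ih.cons e).trans (List.Perm.swap d e l)
    · exact List.Perm.refl _

theorem sortedDigits_perm (n K : ℕ) : (sortedDigits n K).Perm (digits n K) := by
  induction n generalizing K with
  | zero => exact List.Perm.refl _
  | succ n ih =>
    change (force (K % 1024) fun d => insertDigit d (sortedDigits n (K / 1024))).Perm _
    rw [force_eq]
    exact (insertDigit_perm _ _).trans ((ih _).cons _)

theorem ofDigits_cons (d : ℕ) (l : List ℕ) : ofDigits (d :: l) = d + 1024 * ofDigits l := rfl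

theorem length_digits (n K : ℕ) : (digits n K).length = n := by
  induction n generalizing K with
  | zero => rfl
  | succ n ih => simp [digits, ih]

theorem lt_of_mem_digits {n K d : ℕ} (h : d ∈ digits n K) : d < 1024 := by
  induction n generalizing K with
  | zero => simp [digits] at h
  | succ n ih =>
    rcases List.mem_cons.1 h with rfl | h
    · exact Nat.mod_lt _ (by norm_num)
    · exact ih h

theorem digits_ofDigits (l : List ℕ) (h : ∀ d ∈ l, d < 1024) :
    digits l.length (ofDigits l) = l := by
  induction l with
  | nil => rfl
  | cons d l ih =>
    have hd := h d (by simp)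
    rw [List.length_cons, digits, ofDigits_cons, Nat.add_mul_mod_self_left, Nat.mod_eq_of_lt hd,
      Nat.add_mul_div_left _ _ (by norm_num), Nat.div_eq_of_lt hd, zero_add,
      ih fun d hd => h d (List.mem_cons_of_mem _ hd)]

/-- A permutation of the digits only permutes commuting factors. That the result is sorted plays no
role in correctness; it brings similar terms to the same key. -/
theorem digitMonomial_sorted (n K : ℕ) :
    digitMonomial (digits n (ofDigits (sortedDigits n K))) = digitMonomial (digits n K) := by
  have hp := sortedDigits_perm n K
  have hl : (sortedDigits n K).length = n := by rw [hp.length_eq, length_digits]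
  conv_lhs => rw [← hl]
  conv_lhs =>
    arg 1
    arg 2
    rw [hl]
  rw [digits_ofDigits _ fun d hd => lt_of_mem_digits (hp.mem_iff.1 hd)]
  exact (hp.map _).prod_eq

namespace CoeffTree

/-- The differential polynomial with the coefficients in a search tree. -/
def value : CoeffTree → JetRing
  | leaf => 0
  | node l k c r => l.value + (c : ℝ) • digitMonomial (digits 6 k) + r.value

/-- Search tree with an additional coefficient. -/
theorem exists_insert (k : ℕ) (c : ℤ) (T : CoeffTree) :
    ∃ T' : CoeffTree, T'.value = T.value + (c : ℝ) • digitMonomial (digits 6 k) ∧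
      ∀ (α : Type) (f : CoeffTree → α), T.insert k c f = f T' := by
  induction T with
  | leaf => exact ⟨node leaf k c leaf, by simp [value], fun α f => rfl⟩
  | node l k' c' r ihl ihr =>
    obtain ⟨l', hl, hl'⟩ := ihl
    obtain ⟨r', hr, hr'⟩ := ihr
    rcases hb : Nat.beq k k' with _ | _
    · rcases hlt : Nat.blt k k' with _ | _
      · exact ⟨node l k' c' r', by simp only [value, hr]; ring, fun α f => by
          simp [insert, hb, hlt, hr']⟩
      · exact ⟨node l' k' c' r, by simp only [value, hl]; ring, fun α f => by
          simp [insert, hb, hlt, hl']⟩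
    · obtain rfl := Nat.eq_of_beq_eq_true hb
      refine ⟨node l k (c + c') r, ?_, fun α f => by simp [insert, forceInt_eq]⟩
      simp only [value]
      push_cast
      rw [add_smul]
      ring

theorem value_eq_zero {T : CoeffTree} (h : T.allZero = true) : T.value = 0 := by
  induction T with
  | leaf => rfl
  | node l k c r ihl ihr =>
    simp only [allZero, Bool.and_eq_true, decide_eq_true_eq] at h
    simp [value, h.1, ihl h.2.1, ihr h.2.2]

end CoeffTree

/-- The value of the tree plus that of the terms still to be inserted is invariant. No search-order
property is needed: misplaced keys could only make the test fail. -/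
theorem termsValue_add_value_eq_zero {p : List (ℤ × ℕ)} {T : CoeffTree}
    (h : zeroTest p T = true) : termsValue 6 p + T.value = 0 := by
  induction p generalizing T with
  | nil => rw [termsValue_nil, zero_add, CoeffTree.value_eq_zero h]
  | cons t p ih =>
    obtain ⟨T', hT', hf⟩ := CoeffTree.exists_insert
      (ofDigits (sortedDigits 6 t.2)) t.1 T
    rw [zeroTest, force_eq, forceInt_eq, hf] at h
    have := ih h
    rw [hT', digitMonomial_sorted] at this
    rw [← this]
    simp only [termsValue, List.map_cons, List.sum_cons]
    ring

/-! ### Codes of monomials -/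

/-- The code of a monomial. -/
def monomialCode {n : ℕ} (m : Fin n × Fin 2 →₀ ℕ) : ℕ :=
  ∑ v : Fin n, (32 * m (v, 0) + m (v, 1)) * 1024 ^ (v : ℕ)

theorem monomialCode_add {n : ℕ} (m m' : Fin n × Fin 2 →₀ ℕ) :
    monomialCode (m + m') = monomialCode m + monomialCode m' := by
  simp only [monomialCode, ← Finset.sum_add_distrib]
  refine Finset.sum_congr rfl fun v _ => ?_
  simp only [Finsupp.add_apply]
  ring

theorem monomialCode_single {n : ℕ} (v : Fin n) (k : Fin 2) :
    monomialCode (Finsupp.single (v, k) 1) = ![32, 1] k * 1024 ^ (v : ℕ) := by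
  classical
  rw [monomialCode, Finset.sum_eq_single v]
  · fin_cases k <;> simp
  · intro w _ hw
    simp [hw.symm]
  · simp

theorem digits_sum {n : ℕ} (d : Fin n → ℕ) (hd : ∀ v, d v < 1024) :
    digits n (∑ v, d v * 1024 ^ (v : ℕ)) = List.ofFn d := by
  induction n with
  | zero => rfl
  | succ n ih =>
    have h : ∑ v, d v * 1024 ^ (v : ℕ)
        = d 0 + 1024 * ∑ v : Fin n, d v.succ * 1024 ^ (v : ℕ) := by
      rw [Fin.sum_univ_succ, Finset.mul_sum]
      simp only [Fin.val_zero, pow_zero, mul_one, Fin.val_succ, pow_succ]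
      congr 1
      exact Finset.sum_congr rfl fun v _ => by ring
    rw [digits, h, Nat.add_mul_mod_self_left, Nat.mod_eq_of_lt (hd 0),
      Nat.add_mul_div_left _ _ (by norm_num), Nat.div_eq_of_lt (hd 0), zero_add,
      ih _ fun v => hd v.succ, List.ofFn_succ]

/-- The bound on the degree keeps every exponent below 32, so the code has no carries and the digits
can be read back. -/
theorem digitMonomial_monomialCode {n : ℕ} {m : Fin n × Fin 2 →₀ ℕ} (hm : m.degree < 32) :
    digitMonomial (digits n (monomialCode m)) = jetMonomial m := by
  have hlt (q : Fin n × Fin 2) : m q < 32 := (Finsupp.le_degree q m).trans_lt hm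
  rw [monomialCode, digits_sum _ fun v => by
    have := hlt (v, 0)
    have := hlt (v, 1)
    omega]
  rw [digitMonomial, List.map_ofFn, List.prod_ofFn, jetMonomial]
  refine Finset.prod_congr rfl fun v _ => ?_
  have := hlt (v, 1)
  simp only [Function.comp]
  congr 2 <;> omega

/-- The list of terms of a symbol of degree at most `d`. -/
def IsTermsOf {n : ℕ} (d : ℕ) (N : List (ℤ × ℕ)) (p : Symb (Fin n)) : Prop :=
  ∃ L : List (ℤ × (Fin n × Fin 2 →₀ ℕ)), N = L.map (fun t => (t.1, monomialCode t.2)) ∧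
    p = (L.map fun t => monomial t.2 (t.1 : ℝ)).sum ∧ ∀ t ∈ L, t.2.degree ≤ d

theorem IsTermsOf.nil {n : ℕ} (d : ℕ) : IsTermsOf d [] (0 : Symb (Fin n)) :=
  ⟨[], rfl, rfl, by simp⟩

theorem IsTermsOf.append {n d : ℕ} {N N' : List (ℤ × ℕ)} {p p' : Symb (Fin n)}
    (h : IsTermsOf d N p) (h' : IsTermsOf d N' p') : IsTermsOf d (N ++ N') (p + p') := by
  obtain ⟨L, rfl, rfl, hL⟩ := h
  obtain ⟨L', rfl, rfl, hL'⟩ := h'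
  refine ⟨L ++ L', by simp, by simp, fun t ht => ?_⟩
  rcases List.mem_append.1 ht with ht | ht
  · exact hL t ht
  · exact hL' t ht

theorem IsTermsOf.termsValue {n d : ℕ} {N : List (ℤ × ℕ)} {p : Symb (Fin n)}
    (h : IsTermsOf d N p) (hd : d < 32) : termsValue n N = ofSymb p := by
  obtain ⟨L, rfl, rfl, hL⟩ := h
  rw [GraphFlow.termsValue, List.map_map, map_list_sum, List.map_map]
  congr 1
  refine List.map_congr_left fun t ht => ?_
  simp only [Function.comp]
  rw [digitMonomial_monomialCode ((hL t ht).trans_lt hd), ofSymb_monomial]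

/-- The covector with a given number. -/
def covector (n : ℕ) (i j : Fin 2) (c : ℕ) (k : Fin 2) : Symb (Fin n) :=
  if h : c < n then X (⟨c, h⟩, k) else C (if (if c = n then i else j) = k then 1 else 0)

theorem covector_eq (n : ℕ) (i j : Fin 2) (c : ℕ) (k : Fin 2) :
    match componentCode n i j c k with
    | some x => ∃ u : Fin n × Fin 2 →₀ ℕ, covector n i j c k = monomial u 1 ∧
        x = monomialCode u ∧ u.degree ≤ 1
    | none => covector n i j c k = 0 := by
  unfold componentCode covector
  by_cases h : c < n
  · have hb : Nat.blt c n = true := by simpa [Nat.blt_eq] using h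
    simp only [hb, cond_true, h, dif_pos]
    refine ⟨Finsupp.single (⟨c, h⟩, k) 1, rfl, ?_, by simp⟩
    rw [monomialCode_single]
    fin_cases k
    · simp
    · simp
      rfl
  · have hb : Nat.blt c n = false := by
      rw [Bool.eq_false_iff, ne_eq, Nat.blt_eq]
      exact h
    simp only [hb, cond_false, h, dif_neg, not_false_eq_true]
    have hi : (bif Nat.beq c n then (i : ℕ) else (j : ℕ)) = ((if c = n then i else j : Fin 2) : ℕ) := by
      by_cases hc : c = n
      · simp [hc]
      · have : Nat.beq c n = false := by
          rw [Bool.eq_false_iff]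
          exact fun h' => hc (Nat.eq_of_beq_eq_true h')
        simp [hc, this]
    rw [hi]
    generalize (if c = n then i else j : Fin 2) = a
    by_cases ha : a = k
    · subst ha
      simp only [Nat.beq_refl, cond_true, if_true]
      exact ⟨0, rfl, by simp [monomialCode], by simp⟩
    · have : Nat.beq a k = false := by
        rw [Bool.eq_false_iff]
        exact fun h' => ha (Fin.ext (Nat.eq_of_beq_eq_true h'))
      simp [this, ha]

/-- `monomial m c` accumulates the factors already chosen. Each remaining bracket raises the degree
by at most two, which is the budget in `hd`. -/
theorem isTermsOf_bracketTerms (n : ℕ) (i j : Fin 2) (es : List (ℕ × ℕ)) (c : ℤ)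
    (m : Fin n × Fin 2 →₀ ℕ) (d : ℕ) (hd : m.degree + 2 * es.length ≤ d) :
    IsTermsOf d (bracketTerms n i j es c (monomialCode m))
      ((es.map fun e => bracket (covector n i j e.1) (covector n i j e.2)).prod
        * monomial m (c : ℝ)) := by
  induction es generalizing c m with
  | nil => exact ⟨[(c, m)], rfl, by simp, by simpa using hd⟩
  | cons e es ih =>
    have key (x y : Fin 2) (c' : ℤ) : IsTermsOf d
        (match componentCode n i j e.1 x, componentCode n i j e.2 y with
          | some x, some y => bracketTerms n i j es c' (monomialCode m + x + y)
          | _, _ => [])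
        ((es.map fun e => bracket (covector n i j e.1) (covector n i j e.2)).prod
          * (covector n i j e.1 x * covector n i j e.2 y * monomial m (c' : ℝ))) := by
      have hx := covector_eq n i j e.1 x
      have hy := covector_eq n i j e.2 y
      rcases h1 : componentCode n i j e.1 x with _ | x'
      · rw [h1] at hx
        simp only at hx ⊢
        rw [hx, zero_mul, zero_mul, mul_zero]
        exact IsTermsOf.nil d
      rcases h2 : componentCode n i j e.2 y with _ | y'
      · rw [h2] at hy
        simp only at hy ⊢
        rw [hy, mul_zero, zero_mul, mul_zero]
        exact IsTermsOf.nil d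
      rw [h1] at hx
      rw [h2] at hy
      obtain ⟨u, hu, rfl, hu1⟩ := hx
      obtain ⟨w, hw, rfl, hw1⟩ := hy
      simp only
      rw [hu, hw, ← monomialCode_add, ← monomialCode_add, monomial_mul, monomial_mul, one_mul,
        one_mul, add_comm (u + w), ← add_assoc]
      refine ih c' (m + u + w) ?_
      rw [map_add, map_add]
      rw [List.length_cons] at hd
      omega
    have h := (key 0 1 c).append (key 1 0 (-c))
    convert h using 1
    · rw [bracketTerms]
      simp only [force_eq]
      rfl
    · rw [List.map_cons, List.prod_cons, bracket]
      push_cast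
      rw [map_neg]
      ring

theorem termsValue_bracketTerms (n : ℕ) (i j : Fin 2) (es : List (ℕ × ℕ)) (c : ℤ)
    (hes : 2 * es.length < 32) : termsValue n (bracketTerms n i j es c 0)
      = (c : ℝ) • ofSymb
        (es.map fun e => bracket (covector n i j e.1) (covector n i j e.2)).prod := by
  have h := isTermsOf_bracketTerms n i j es c 0 (2 * es.length) (by simp)
  rw [show monomialCode (0 : Fin n × Fin 2 →₀ ℕ) = 0 by simp [monomialCode]] at h
  rw [h.termsValue hes, ← map_smul]
  congr 1
  rw [mul_comm, smul_eq_C_mul]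
  rfl

/-! ### The orientation morphism as a differential polynomial -/

/-- The graph of directed edges with two arrows at every vertex. -/
def arrowGraph {n m : ℕ} (g : EdgeGraph n m) (o : Fin m → Bool) (s : Fin 2 → Fin n)
    (h : ∀ v, (outArrows (tail g o s) v).length = 2) : WedgeGraph 2 n :=
  fun v i => head g o ((outArrows (tail g o s) v).get (Fin.cast (h v).symm i))

/-- The Left and Right slots of the tops correspond bijectively to the m + 2 arrows (`φ`), and
exactly one of these arrows was created with head r. -/
theorem card_arrowGraph_sink {n m : ℕ} (g : EdgeGraph n m) (o : Fin m → Bool) (s : Fin 2 → Fin n)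
    (h : ∀ v, (outArrows (tail g o s) v).length = 2) (r : Fin 2) :
    (Finset.univ.filter fun e : Fin n × Fin 2 =>
      arrowGraph g o s h e.1 e.2 = Sum.inl r).card = 1 := by
  classical
  let φ : Fin n × Fin 2 → Fin (m + 2) := fun e =>
    (outArrows (tail g o s) e.1).get (Fin.cast (h e.1).symm e.2)
  have htail (e) : tail g o s (φ e) = e.1 := by
    have := List.get_mem (outArrows (tail g o s) e.1) (Fin.cast (h e.1).symm e.2)
    exact of_decide_eq_true (List.mem_filter.1 this).2
  have hinj : Function.Injective φ := by
    rintro ⟨v, i⟩ ⟨w, j⟩ hvw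
    have hv : v = w :=
      (htail (v, i)).symm.trans ((congrArg (tail g o s) hvw).trans (htail (w, j)))
    subst hv
    have hnd : (outArrows (tail g o s) v).Nodup := (List.nodup_finRange _).filter _
    have := hnd.injective_get hvw
    simpa using this
  have hsurj : Function.Surjective φ := by
    intro a
    have ha : a ∈ outArrows (tail g o s) (tail g o s a) := by simp [outArrows]
    obtain ⟨k, hk⟩ := List.get_of_mem ha
    exact ⟨(tail g o s a, Fin.cast (h _) k), hk⟩
  have hhead (a : Fin (m + 2)) : head g o a = Sum.inl r ↔ a = Fin.natAdd m r := by
    refine Fin.addCases (fun b => ?_) (fun b => ?_) a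
    · simp only [head, Fin.append_left, reduceCtorEq, false_iff]
      intro hb
      have := congrArg Fin.val hb
      simp at this
      omega
    · simp [head]
  rw [Finset.card_eq_one]
  obtain ⟨e, he⟩ := hsurj (Fin.natAdd m r)
  refine ⟨e, ?_⟩
  ext e'
  simp only [Finset.mem_filter, Finset.mem_univ, true_and, Finset.mem_singleton]
  change head g o (φ e') = _ ↔ _
  rw [hhead, ← he, hinj.eq_iff]

open Classical in
/-- The component `Qⁱʲ` of the bi-vector of the orientation of a graph. -/
def orientJet {n m : ℕ} (g : EdgeGraph n m) (i j : Fin 2) : JetRing :=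
  ∑ o : Fin m → Bool, ∑ s : Fin 2 → Fin n,
    if h : ∀ v, (outArrows (tail g o s) v).length = 2 then
      arrowSign (tail g o s) • ofSymb (graphSymb (sinkVec ![i, j]) (arrowGraph g o s h))
    else 0

theorem comboOp_orient {n m : ℕ} (g : EdgeGraph n m) {ϱ : Plane → ℝ} (hϱ : ContDiff ℝ ∞ ϱ)
    (x : Plane) (i j : Fin 2) :
    Finsupp.linearCombination ℝ
        (fun Γ => graphOp Γ (bivector ϱ) ![fun y => y i, fun y => y j] x) (orient g)
      = jetEval ϱ (orientJet g i j) x := by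
  unfold orient orientJet
  rw [map_sum, jetEval_sum]
  refine Finset.sum_congr rfl fun o _ => ?_
  rw [map_sum, jetEval_sum]
  refine Finset.sum_congr rfl fun s _ => ?_
  by_cases h : ∀ v, (outArrows (tail g o s) v).length = 2
  · rw [dif_pos h, dif_pos h, Finsupp.linearCombination_single, jetEval_smul, smul_eq_mul]
    congr 1
    refine graphOp_sinks hϱ (arrowGraph g o s h) ![i, j] (card_arrowGraph_sink g o s h) _
      (fun r => ?_) x
    fin_cases r <;> rfl
  · rw [dif_neg h, dif_neg h, map_zero]
    simp [jetEval]

theorem flow5_eq_jetEval {ϱ : Plane → ℝ} (hϱ : ContDiff ℝ ∞ ϱ) (x : Plane) (i j : Fin 2) :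
    flow5 (bivector ϱ) x i j
      = jetEval ϱ (orientJet pentagonWheel i j + (5 / 2 : ℝ) • orientJet prism i j) x := by
  have h1 : orientation gamma5 = orient pentagonWheel + (5 / 2 : ℝ) • orient prism := by
    unfold orientation gamma5
    rw [Finsupp.sum_add_index' (by simp) (fun _ _ _ => add_smul _ _ _),
      Finsupp.sum_single_index (by simp), Finsupp.sum_single_index (by simp), one_smul]
  change Finsupp.linearCombination ℝ
    (fun Γ => graphOp Γ (bivector ϱ) ![fun y => y i, fun y => y j] x) (orientation gamma5) = _
  rw [h1, map_add, map_smul, comboOp_orient _ hϱ, comboOp_orient _ hϱ, jetEval_add, jetEval_smul,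
    smul_eq_mul]

/-! ### Lists of arrows -/

theorem length_filter_ofFn {α : Type*} {m : ℕ} (f : Fin m → α) (P : α → Bool) :
    ((List.ofFn f).filter P).length = ∑ q, if P (f q) then 1 else 0 := by
  induction m with
  | zero => simp
  | succ m ih =>
    rw [List.ofFn_succ, List.filter_cons, Fin.sum_univ_succ, ← ih]
    split_ifs <;> simp [add_comm]

theorem inversions_ofFn {m : ℕ} (t : Fin m → ℕ) :
    inversions (List.ofFn t)
      = (Finset.univ.filter fun p : Fin m × Fin m => p.1 < p.2 ∧ t p.2 < t p.1).card := by
  induction m with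
  | zero => simp [inversions]
  | succ m ih =>
    rw [List.ofFn_succ, inversions, ih, length_filter_ofFn]
    simp only [Finset.card_filter, Fintype.sum_prod_type, Fin.sum_univ_succ, Fin.succ_lt_succ_iff,
      Fin.succ_pos, lt_irrefl, Fin.not_lt_zero, Nat.blt_eq]
    simp

theorem arrowSign_eq {n m : ℕ} (t : Fin (m + 2) → Fin n) :
    arrowSign t = ((bif Nat.beq (inversions (List.ofFn fun a => (t a : ℕ)) % 2) 0
      then 1 else -1 : ℤ) : ℝ) := by
  have h : inversions (List.ofFn fun a => (t a : ℕ))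
      = (Finset.univ.filter fun p : Fin (m + 2) × Fin (m + 2) =>
        p.1 < p.2 ∧ t p.2 < t p.1).card := by
    rw [inversions_ofFn]
    rfl
  unfold arrowSign
  rw [← h]
  rcases Nat.mod_two_eq_zero_or_one (inversions (List.ofFn fun a => (t a : ℕ))) with h2 | h2
  · rw [(Nat.even_iff.2 h2).neg_one_pow, h2]
    simp
  · rw [(Nat.odd_iff.2 h2).neg_one_pow, h2]
    simp [show Nat.beq 1 0 = false from rfl]

/-- The number of the head of an arrow: the sinks follow the `n` other vertices. -/
def headNumber {n : ℕ} : Fin 2 ⊕ Fin n → ℕ := Sum.elim (fun r => n + r) fun v => v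

theorem covector_headNumber {n : ℕ} (i j : Fin 2) (u : Fin 2 ⊕ Fin n) :
    covector n i j (headNumber u) = sinkVec ![i, j] u := by
  funext k
  rcases u with r | v
  · have h : covector n i j (n + r) k = C (if (![i, j] r : Fin 2) = k then 1 else 0) := by
      unfold covector
      rw [dif_neg (by omega)]
      fin_cases r
      · simp only [add_zero, if_true]
        rfl
      · simp only [Nat.add_eq_left, one_ne_zero, if_false]
        rfl
    exact h
  · simp [covector, headNumber, sinkVec]

/-- The list of arrows with the tails `t` and heads `w`. -/
def arrowList {n m : ℕ} (t : Fin (m + 2) → Fin n) (w : Fin (m + 2) → Fin 2 ⊕ Fin n) :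
    List (ℕ × ℕ) := List.ofFn fun a => ((t a : ℕ), headNumber (w a))

theorem arrowsFrom_arrowList {n m : ℕ} (t : Fin (m + 2) → Fin n)
    (w : Fin (m + 2) → Fin 2 ⊕ Fin n) (v : Fin n) :
    arrowsFrom (arrowList t w) v
      = (outArrows t v).map fun a => ((t a : ℕ), headNumber (w a)) := by
  unfold arrowsFrom arrowList outArrows
  rw [List.ofFn_eq_map, List.filter_map]
  congr 1
  refine List.filter_congr fun a _ => ?_
  simp only [Function.comp]
  rw [Bool.eq_iff_iff]
  simp [Nat.beq_eq, Fin.ext_iff]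

theorem all_range_iff {n : ℕ} (P : ℕ → Bool) :
    (List.range n).all P = true ↔ ∀ v : Fin n, P v = true := by
  rw [List.all_eq_true]
  exact ⟨fun h v => h v (List.mem_range.2 v.2), fun h v hv => h ⟨v, List.mem_range.1 hv⟩⟩

/-- Grouped by tails, the sum has two equal terms 8 ^ v for each vertex. This is the necessary
condition by which `orientTerms` selects tails; `arrowTerms` rechecks the out-degrees. -/
theorem tailCode_arrowList {m : ℕ} (t : Fin (m + 2) → Fin 6) (w : Fin (m + 2) → Fin 2 ⊕ Fin 6)
    (h : ∀ v, (outArrows t v).length = 2) : tailCode (arrowList t w) = 0o222222 := by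
  classical
  unfold tailCode arrowList
  rw [List.map_ofFn, List.sum_ofFn]
  simp only [Function.comp]
  rw [← Finset.sum_fiberwise Finset.univ t]
  have hcard (v : Fin 6) : (Finset.univ.filter fun a => t a = v).card = 2 := by
    have h' : (outArrows t v).length = ∑ a, if t a = v then 1 else 0 := by
      rw [outArrows, ← List.ofFn_id, length_filter_ofFn]
      simp
    rw [Finset.card_filter, ← h', h v]
  have h2 (v : Fin 6) : ∑ a with t a = v, 8 ^ (t a : ℕ) = 2 * 8 ^ (v : ℕ) := by
    rw [Finset.sum_congr rfl (g := fun _ => 8 ^ (v : ℕ)) fun a ha => by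
      rw [(Finset.mem_filter.1 ha).2], Finset.sum_const, smul_eq_mul, hcard]
  simp only [h2]
  decide

theorem prod_range_map {M : Type*} [CommMonoid M] (n : ℕ) (f : ℕ → M) :
    ((List.range n).map f).prod = ∏ v : Fin n, f v := by
  induction n with
  | zero => simp
  | succ n ih => rw [List.range_succ, List.map_append, List.prod_append, ih,
      Fin.prod_univ_castSucc]; simp

theorem sum_range_map {M : Type*} [AddCommMonoid M] (n : ℕ) (f : ℕ → M) :
    ((List.range n).map f).sum = ∑ v : Fin n, f v := by
  induction n with
  | zero => simp
  | succ n ih => rw [List.range_succ, List.map_append, List.sum_append, ih,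
      Fin.sum_univ_castSucc]; simp

theorem headPair_arrowsFrom {n m : ℕ} (t : Fin (m + 2) → Fin n)
    (w : Fin (m + 2) → Fin 2 ⊕ Fin n) (v : Fin n) (h : (outArrows t v).length = 2) :
    headPair (arrowsFrom (arrowList t w) v)
      = (headNumber (w ((outArrows t v).get (Fin.cast h.symm 0))),
        headNumber (w ((outArrows t v).get (Fin.cast h.symm 1)))) := by
  rw [arrowsFrom_arrowList]
  generalize outArrows t v = l at h
  match l, h with
  | [a, b], _ => rfl

theorem prod_headPair {m : ℕ} (g : EdgeGraph 6 m) (o : Fin m → Bool) (s : Fin 2 → Fin 6)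
    (h : ∀ v, (outArrows (tail g o s) v).length = 2) (i j : Fin 2) :
    (((List.range 6).map fun v => headPair (arrowsFrom (arrowList (tail g o s) (head g o)) v)).map
      fun e => bracket (covector 6 i j e.1) (covector 6 i j e.2)).prod
      = graphSymb (sinkVec ![i, j]) (arrowGraph g o s h) := by
  rw [List.map_map, prod_range_map]
  refine Finset.prod_congr rfl fun v _ => ?_
  simp only [Function.comp]
  rw [headPair_arrowsFrom _ _ _ (h v)]
  simp only [covector_headNumber]
  rfl

theorem termsValue_arrowTerms {m : ℕ} (g : EdgeGraph 6 m) (o : Fin m → Bool)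
    (s : Fin 2 → Fin 6) (i j : Fin 2) :
    termsValue 6 (arrowTerms i j (arrowList (tail g o s) (head g o)))
      = if h : ∀ v, (outArrows (tail g o s) v).length = 2 then
          arrowSign (tail g o s) • ofSymb (graphSymb (sinkVec ![i, j]) (arrowGraph g o s h))
        else 0 := by
  have hiff : ((List.range 6).all fun v =>
      Nat.beq (arrowsFrom (arrowList (tail g o s) (head g o)) v).length 2) = true
      ↔ ∀ v, (outArrows (tail g o s) v).length = 2 := by
    rw [all_range_iff]
    simp [arrowsFrom_arrowList, Nat.beq_eq]
  unfold arrowTerms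
  by_cases h : ∀ v, (outArrows (tail g o s) v).length = 2
  · have hfst : (arrowList (tail g o s) (head g o)).map Prod.fst
        = List.ofFn fun a => (tail g o s a : ℕ) := by
      rw [arrowList, List.map_ofFn]
      rfl
    rw [dif_pos h, hiff.2 h, cond_true, termsValue_bracketTerms _ _ _ _ _ (by simp),
      arrowSign_eq, prod_headPair g o s h, hfst]
  · rw [dif_neg h, Bool.eq_false_iff.2 (mt hiff.1 h), cond_false]
    rfl

/-- The default in `getD` is never used, since the lists in `boolLists m` have length m. -/
theorem sum_boolLists {M : Type*} [AddCommMonoid M] (m : ℕ) (F : (Fin m → Bool) → M) :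
    ∑ o, F o = ((boolLists m).map fun l => F fun a => l.getD a false).sum := by
  induction m with
  | zero =>
    rw [Fintype.sum_unique]
    simp only [boolLists, List.map_cons, List.map_nil, List.sum_cons, List.sum_nil, add_zero]
    exact congrArg F (Subsingleton.elim _ _)
  | succ m ih =>
    rw [← Fintype.sum_equiv (Fin.consEquiv fun _ => Bool) (fun p => F (Fin.cons p.1 p.2)) F
      fun p => rfl, Fintype.sum_prod_type_right, ih]
    have hc (l : List Bool) (b : Bool) : (Fin.cons b fun a : Fin m => l.getD a false : Fin (m + 1) → Bool)
        = fun a : Fin (m + 1) => (b :: l).getD a false := by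
      funext a
      refine Fin.cases ?_ (fun a => ?_) a <;> simp
    rw [boolLists]
    generalize boolLists m = L
    induction L with
    | nil => rfl
    | cons l L ihL =>
      rw [List.flatMap_cons, List.map_append, List.sum_append, ← ihL, List.map_cons, List.sum_cons]
      simp only [hc, Fintype.sum_bool, List.map_cons, List.map_nil, List.sum_cons, List.sum_nil,
        add_zero]

theorem length_of_mem_boolLists {m : ℕ} {l : List Bool} (h : l ∈ boolLists m) : l.length = m := by
  induction m generalizing l with
  | zero => simpa [boolLists] using h
  | succ m ih =>
    obtain ⟨l', hl', h⟩ := List.mem_flatMap.1 h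
    have := ih hl'
    rcases List.mem_cons.1 h with rfl | h
    · simp [this]
    · simp [List.mem_singleton.1 h, this]

theorem arrowList_eq_append {n m : ℕ} (g : EdgeGraph n m) (o : Fin m → Bool) (s : Fin 2 → Fin n) :
    arrowList (tail g o s) (head g o)
      = (List.ofFn fun a => if o a then (((g a).1 : ℕ), ((g a).2 : ℕ))
          else (((g a).2 : ℕ), ((g a).1 : ℕ))) ++ [((s 0 : ℕ), n), ((s 1 : ℕ), n + 1)] := by
  have h : (fun a => ((tail g o s a : ℕ), headNumber (head g o a)))
      = Fin.append (fun a : Fin m => if o a then (((g a).1 : ℕ), ((g a).2 : ℕ))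
          else (((g a).2 : ℕ), ((g a).1 : ℕ))) fun r : Fin 2 => ((s r : ℕ), n + (r : ℕ)) := by
    funext a
    refine Fin.addCases (fun b => ?_) (fun b => ?_) a
    · simp only [tail, head, Fin.append_left]
      split_ifs <;> rfl
    · simp only [tail, head, Fin.append_right]
      rfl
  unfold arrowList
  rw [h, List.ofFn_fin_append]
  rfl

theorem directEdges_ofFn {n m : ℕ} (g : EdgeGraph n m) (l : List Bool) (hl : l.length = m) :
    directEdges (List.ofFn fun a => (((g a).1 : ℕ), ((g a).2 : ℕ))) l
      = List.ofFn fun a : Fin m => if l.getD a false then (((g a).1 : ℕ), ((g a).2 : ℕ))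
          else (((g a).2 : ℕ), ((g a).1 : ℕ)) := by
  unfold directEdges
  refine List.ext_getElem (by simp [hl]) fun k h1 h2 => ?_
  have hk : k < l.length := by
    simp at h1
    omega
  simp only [List.getElem_ofFn, List.getElem_zipWith, List.getD_eq_getElem _ _ hk]
  cases l[k] <;> rfl

theorem termsValue_orientTerms (g : EdgeGraph 6 10) (i j : Fin 2) :
    termsValue 6 (orientTerms (List.ofFn fun a => (((g a).1 : ℕ), ((g a).2 : ℕ))) i j)
      = orientJet g i j := by
  classical
  unfold orientTerms orientJet
  rw [termsValue_flatMap, sum_boolLists]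
  refine congrArg List.sum (List.map_congr_left fun l hl => ?_)
  have hlen := length_of_mem_boolLists hl
  set E := List.ofFn fun a => (((g a).1 : ℕ), ((g a).2 : ℕ)) with hE
  have hcode (s : Fin 2 → Fin 6) : tailCode (arrowList (tail g (fun a => l.getD a false) s)
      (head g fun a => l.getD a false))
      = tailCode (directEdges E l) + 8 ^ (s 0 : ℕ) + 8 ^ (s 1 : ℕ) := by
    rw [arrowList_eq_append, ← directEdges_ofFn g l hlen, ← hE, tailCode, tailCode, List.map_append, List.sum_append]
    simp only [List.map_cons, List.map_nil, List.sum_cons, List.sum_nil, add_zero, add_assoc]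
  have hterm (s : Fin 2 → Fin 6) :
      (if h : ∀ v, (outArrows (tail g (fun a => l.getD a false) s) v).length = 2 then
        arrowSign (tail g (fun a => l.getD a false) s) • ofSymb (graphSymb (sinkVec ![i, j])
          (arrowGraph g (fun a => l.getD a false) s h)) else 0)
      = termsValue 6 (bif Nat.beq (tailCode (directEdges E l) + 8 ^ (s 0 : ℕ) + 8 ^ (s 1 : ℕ))
          0o222222 then arrowTerms i j (directEdges E l ++ [((s 0 : ℕ), 6), ((s 1 : ℕ), 7)])
        else []) := by
    rcases hb : Nat.beq (tailCode (directEdges E l) + 8 ^ (s 0 : ℕ) + 8 ^ (s 1 : ℕ)) 0o222222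
      with _ | _
    · rw [dif_neg]
      · rfl
      · intro h
        have := tailCode_arrowList _ (head g fun a => l.getD a false) h
        rw [hcode] at this
        rw [this] at hb
        exact absurd hb (by decide)
    · rw [cond_true, ← termsValue_arrowTerms, arrowList_eq_append,
        ← directEdges_ofFn g l hlen]
  simp only [force_eq, forcePairs_eq, hterm]
  rw [← Fintype.sum_equiv (finTwoArrowEquiv (Fin 6)).symm
    (fun p : Fin 6 × Fin 6 => termsValue 6 (bif Nat.beq (tailCode (directEdges E l)
        + 8 ^ (p.1 : ℕ) + 8 ^ (p.2 : ℕ)) 0o222222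
      then arrowTerms i j (directEdges E l ++ [((p.1 : ℕ), 6), ((p.2 : ℕ), 7)])
      else [])) _ fun p => by simp, Fintype.sum_prod_type]
  rcases hb : Nat.beq (Nat.land (tailCode (directEdges E l) + 0o111111) 0o444444) 0 with _ | _
  · rw [cond_false, termsValue_nil]
    symm
    refine Finset.sum_eq_zero fun s _ => Finset.sum_eq_zero fun s' _ => ?_
    rcases hc : Nat.beq (tailCode (directEdges E l) + 8 ^ (s : ℕ) + 8 ^ (s' : ℕ)) 0o222222
      with _ | _
    · rfl
    · exfalso
      have h1 := Nat.eq_of_beq_eq_true hc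
      have h2 : ∀ s s' : Fin 6, Nat.beq (Nat.land (0o222222 - 8 ^ (s' : ℕ) - 8 ^ (s : ℕ)
          + 0o111111) 0o444444) 0 = true := by decide
      have h3 : tailCode (directEdges E l) = 0o222222 - 8 ^ (s' : ℕ) - 8 ^ (s : ℕ) := by omega
      rw [h3, h2] at hb
      exact Bool.noConfusion hb
  · rw [cond_true, termsValue_flatMap, sum_range_map]
    refine Finset.sum_congr rfl fun s _ => ?_
    rw [termsValue_flatMap, sum_range_map]

/-! ### The terms of the bracket with the Hamiltonian vector field -/

theorem digitMonomial_digits_succ (n K a b : ℕ) (ha : a < 32) (hb : b < 32) :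
    digitMonomial (digits (n + 1) (K * 1024 + (32 * a + b)))
      = X (a, b) * digitMonomial (digits n K) := by
  have h1 : (K * 1024 + (32 * a + b)) % 1024 = 32 * a + b := by omega
  have h2 : (K * 1024 + (32 * a + b)) / 1024 = K := by omega
  rw [digits, h1, h2, digitMonomial, List.map_cons, List.prod_cons, digitMonomial]
  congr 2
  · congr 1 <;> omega

theorem IsTermsOf.termsValue_totalSymb {n d : ℕ} {N : List (ℤ × ℕ)} {p : Symb (Fin n)}
    (h : IsTermsOf d N p) (hd : d + 1 < 32) (k : Fin 2) (a b : ℕ) (ha : a < 32) (hb : b < 32)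
    (m : ℤ) :
    GraphFlow.termsValue (n + 1) (N.flatMap fun t => (List.range n).map fun v =>
        (m * t.1, (t.2 + ![32, 1] k * 1024 ^ v) * 1024 + (32 * a + b)))
      = (m : ℝ) • (X (a, b) * totalD k (ofSymb p)) := by
  obtain ⟨L, rfl, rfl, hL⟩ := h
  rw [← ofSymb_totalSymb_mul]
  induction L with
  | nil => simp [termsValue_nil]
  | cons t L ih =>
    rw [List.map_cons, List.flatMap_cons, termsValue_append, ih fun t ht =>
      hL t (List.mem_cons_of_mem _ ht), List.map_cons, List.sum_cons, mul_add, map_add, mul_add,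
      smul_add]
    refine congrArg (· + _) ?_
    rw [GraphFlow.termsValue, List.map_map, sum_range_map, totalSymb, Finset.sum_mul, map_sum,
      Finset.mul_sum, Finset.smul_sum]
    refine Finset.sum_congr rfl fun v _ => ?_
    have hdeg := hL t List.mem_cons_self
    have hX : (X (v, k) : Symb (Fin n)) * monomial t.2 (t.1 : ℝ)
        = monomial (Finsupp.single (v, k) 1 + t.2) (t.1 : ℝ) := by
      rw [X, monomial_mul, one_mul]
    simp only [Function.comp]
    rw [digitMonomial_digits_succ _ _ _ _ ha hb, ← monomialCode_single v k, ← monomialCode_add,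
      digitMonomial_monomialCode, hX, ofSymb_monomial, add_comm t.2,
      mul_smul_comm, smul_smul, Int.cast_mul]
    rw [map_add, Finsupp.degree_single]
    omega

/-- The symbol of an encoded graph as a product of brackets of numbered covectors. -/
theorem graphSymb_encoding (l : Fin 4 → Fin 2 → ℕ) (hl : ∀ v s, l v s ∈ Finset.Icc 1 5) :
    graphSymb (fun u i => (X (vertexEquiv u, i) : Symb (Fin 5))) (encoding l)
      = ((List.ofFn fun v => (l v 0 - 1, l v 1 - 1)).map fun e =>
        bracket (covector 5 0 0 e.1) (covector 5 0 0 e.2)).prod := by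
  have h (c : ℕ) (hc : c ∈ Finset.Icc 1 5) : (fun i => (X (vertexEquiv (vertex c), i) : Symb (Fin 5)))
      = covector 5 0 0 (c - 1) := by
    have hlt : c - 1 < 5 := by
      have := Finset.mem_Icc.1 hc
      omega
    have hv : vertexEquiv (vertex c) = ⟨c - 1, hlt⟩ := by
      have := Finset.mem_Icc.1 hc
      obtain ⟨h1, h5⟩ := this
      interval_cases c <;> rfl
    funext i
    rw [hv, covector, dif_pos hlt]
  rw [List.map_ofFn, List.prod_ofFn, graphSymb]
  refine Finset.prod_congr rfl fun v _ => ?_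
  simp only [encoding]
  rw [h _ (hl v 0), h _ (hl v 1)]
  rfl

theorem isTermsOf_hamTerms : IsTermsOf 8 hamTerms hamSymb := by
  have key (es : List (ℕ × ℕ)) (hes : es.length = 4) (c : ℤ) :
      IsTermsOf 8 (bracketTerms 5 0 0 es c 0) ((c : ℝ) •
        (es.map fun e => bracket (covector 5 0 0 e.1) (covector 5 0 0 e.2)).prod) := by
    have h := isTermsOf_bracketTerms 5 0 0 es c 0 8 (by simp [hes])
    rw [show monomialCode (0 : Fin 5 × Fin 2 →₀ ℕ) = 0 by simp [monomialCode]] at h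
    rw [smul_eq_C_mul, mul_comm]
    exact h
  have h := (key [(2, 3), (3, 4), (0, 1), (0, 2)] rfl 6).append
    ((key [(2, 3), (3, 4), (0, 1), (0, 3)] rfl (-2)).append
      (key [(0, 4), (0, 3), (0, 1), (0, 2)] rfl (-2)))
  refine Eq.subst (motive := fun p => IsTermsOf 8 hamTerms p) ?_ h
  symm
  unfold hamSymb hamGraphs5
  rw [map_sub, map_sub, Finsupp.linearCombination_single, Finsupp.linearCombination_single,
    Finsupp.linearCombination_single, graphSymb_encoding _ (by decide),
    graphSymb_encoding _ (by decide), graphSymb_encoding _ (by decide)]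
  push_cast
  rw [neg_smul, neg_smul, sub_sub, sub_eq_add_neg, neg_add]
  rfl

/-- The field ω₂⁻¹(d Ham) is divergence-free, as total derivatives commute; only -Y(ϱ) is left. -/
theorem schoutenJet_fieldJet : schoutenJet fieldJet
    = X (0, 1) * totalD 0 (ofSymb hamSymb) - X (1, 0) * totalD 1 (ofSymb hamSymb) := by
  simp only [schoutenJet, fieldJet, Matrix.cons_val_zero, Matrix.cons_val_one, map_neg, totalD_comm]
  ring

theorem termsValue_derivHamTerms (m : ℤ) :
    termsValue 6 (derivHamTerms 32 1 m ++ derivHamTerms 1 32 (-m))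
      = (m : ℝ) • schoutenJet fieldJet := by
  have h0 := isTermsOf_hamTerms.termsValue_totalSymb (by norm_num) 0 0 1 (by norm_num)
    (by norm_num) m
  have h1 := isTermsOf_hamTerms.termsValue_totalSymb (by norm_num) 1 1 0 (by norm_num)
    (by norm_num) (-m)
  rw [termsValue_append, schoutenJet_fieldJet]
  refine (congrArg₂ (· + ·) h0 h1).trans ?_
  push_cast
  module

theorem wheelEdges_eq :
    (List.ofFn fun a => (((pentagonWheel a).1 : ℕ), ((pentagonWheel a).2 : ℕ))) = wheelEdges := by
  decide

theorem prismEdges_eq :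
    (List.ofFn fun a => (((prism a).1 : ℕ), ((prism a).2 : ℕ))) = prismEdges := by
  decide

theorem termsValue_eq_of_zeroTest {p q : List (ℤ × ℕ)}
    (h : zeroTest (p ++ scale (-1) q) .leaf = true) : termsValue 6 p = termsValue 6 q := by
  have h' := termsValue_add_value_eq_zero h
  rw [termsValue_append, termsValue_scale] at h'
  change _ + (0 : JetRing) = 0 at h'
  rw [add_zero, Int.cast_neg, Int.cast_one, neg_one_smul, ← sub_eq_add_neg] at h'
  exact sub_eq_zero.1 h'

/-! ### Antisymmetry of the orientation -/

/-- Inversions against earlier entries depend only on the set of the two last ones, so the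
transposition affects a single pair. -/
theorem inversions_append_swap (l : List ℕ) (a b : ℕ) :
    inversions (l ++ [b, a]) + (if b < a then 1 else 0)
      = inversions (l ++ [a, b]) + if a < b then 1 else 0 := by
  induction l with
  | nil =>
    have h (a b : ℕ) : inversions [a, b] = if b < a then 1 else 0 := by
      by_cases h : b < a <;> simp [inversions, h, Nat.blt_eq]
    rw [List.nil_append, List.nil_append, h, h, add_comm]
  | cons c l ih =>
    have hp : ((l ++ [b, a]).filter fun b => Nat.blt b c).length
        = ((l ++ [a, b]).filter fun b => Nat.blt b c).length :=
      (((List.Perm.swap a b []).append_left l).filter _).length_eq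
    rw [List.cons_append, List.cons_append, inversions, inversions, hp, add_assoc, ih, add_assoc]

theorem covector_swap (i j : Fin 2) {c : ℕ} (hc : c < 6) : covector 6 j i c = covector 6 i j c := by
  funext k
  simp [covector, hc]

theorem arrowsFrom_append (A B : List (ℕ × ℕ)) (v : ℕ) :
    arrowsFrom (A ++ B) v = arrowsFrom A v ++ arrowsFrom B v := List.filter_append ..

theorem arrowsFrom_pair (s s' c c' v : ℕ) : arrowsFrom [(s, c), (s', c')] v
    = (if s = v then [(s, c)] else []) ++ if s' = v then [(s', c')] else [] := by
  by_cases h : s = v <;> by_cases h' : s' = v <;>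
    simp [arrowsFrom, h, h', Nat.beq_eq]

theorem bracket_swap {A : Type*} [CommRing A] (a b : Fin 2 → A) : bracket b a = -bracket a b := by
  unfold bracket
  ring

/-- The bracket at the vertex `v` for given arrows. -/
def vertexBracket (i j : Fin 2) (A : List (ℕ × ℕ)) (v : ℕ) : Symb (Fin 6) :=
  bracket (covector 6 i j (headPair (arrowsFrom A v)).1)
    (covector 6 i j (headPair (arrowsFrom A v)).2)

/-- Interchanging the tails together with the coordinates in the sinks leaves every arrow with the
same content. A bracket changes only if both new arrows leave one vertex, where Left and Right trade
places. -/
theorem vertexBracket_swap (i j : Fin 2) (B : List (ℕ × ℕ)) (hB : ∀ e ∈ B, e.2 < 6) (s s' v : ℕ)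
    (h : (arrowsFrom (B ++ [(s, 6), (s', 7)]) v).length = 2) :
    vertexBracket j i (B ++ [(s', 6), (s, 7)]) v
      = (if v = s then if s = s' then -1 else 1 else 1)
        * vertexBracket i j (B ++ [(s, 6), (s', 7)]) v := by
  have hB' : ∀ e ∈ arrowsFrom B v, e.2 < 6 := fun e he => hB e (List.mem_filter.1 he).1
  have h6 : covector 6 j i 6 = covector 6 i j 7 := by
    funext k
    simp [covector]
  have h7 : covector 6 j i 7 = covector 6 i j 6 := by
    funext k
    simp [covector]
  unfold vertexBracket
  rw [arrowsFrom_append, arrowsFrom_pair] at h ⊢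
  rw [arrowsFrom_append, arrowsFrom_pair]
  generalize arrowsFrom B v = L at h hB' ⊢
  by_cases hs : s = v <;> by_cases hs' : s' = v
  · subst hs hs'
    match L, h with
    | [], _ =>
      simp only [if_true, List.nil_append, headPair, List.cons_append, h6, h7]
      rw [bracket_swap, neg_one_mul]
    | _ :: _, h => simp at h
  · subst hs
    match L, h, hB' with
    | [e], _, hB' =>
      simp [headPair, hs', Ne.symm hs', h7, covector_swap i j (hB' e (by simp))]
    | [], h, _ => simp [hs'] at h
    | _ :: _ :: _, h, _ => simp [hs'] at h
  · subst hs'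
    match L, h, hB' with
    | [e], _, hB' =>
      simp [headPair, hs, Ne.symm hs, h6, covector_swap i j (hB' e (by simp))]
    | [], h, _ => simp [hs] at h
    | _ :: _ :: _, h, _ => simp [hs] at h
  · match L, h, hB' with
    | [e, e'], _, hB' =>
      simp [headPair, hs, hs', Ne.symm hs, covector_swap i j (hB' e (by simp)),
        covector_swap i j (hB' e' (by simp))]
    | [], h, _ => simp [hs, hs'] at h
    | [_], h, _ => simp [hs, hs'] at h
    | _ :: _ :: _ :: _, h, _ => simp [hs, hs'] at h

theorem termsValue_arrowTerms_eq (i j : Fin 2) (A : List (ℕ × ℕ)) :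
    termsValue 6 (arrowTerms i j A)
      = if ∀ v : Fin 6, (arrowsFrom A v).length = 2 then
          (-1 : ℝ) ^ inversions (A.map Prod.fst) • ofSymb (∏ v : Fin 6, vertexBracket i j A v)
        else 0 := by
  have hiff : ((List.range 6).all fun v => Nat.beq (arrowsFrom A v).length 2) = true
      ↔ ∀ v : Fin 6, (arrowsFrom A v).length = 2 := by
    rw [all_range_iff]
    simp [Nat.beq_eq]
  have hsign (k : ℕ) : ((bif Nat.beq (k % 2) 0 then 1 else -1 : ℤ) : ℝ) = (-1) ^ k := by
    rcases Nat.mod_two_eq_zero_or_one k with h2 | h2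
    · rw [(Nat.even_iff.2 h2).neg_one_pow, h2]
      simp
    · rw [(Nat.odd_iff.2 h2).neg_one_pow, h2]
      simp [show Nat.beq 1 0 = false from rfl]
  unfold arrowTerms
  by_cases h : ∀ v : Fin 6, (arrowsFrom A v).length = 2
  · rw [if_pos h, hiff.2 h, cond_true, termsValue_bracketTerms _ _ _ _ _ (by simp), hsign,
      List.map_map, prod_range_map]
    rfl
  · rw [if_neg h, Bool.eq_false_iff.2 (mt hiff.1 h), cond_false]
    rfl

/-- The minus sign has two sources: for s ≠ s' the number of inversions changes by one, and for s =
s' it stays the same but the bracket at that vertex changes sign. -/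
theorem termsValue_arrowTerms_swap (i j : Fin 2) (B : List (ℕ × ℕ)) (hB : ∀ e ∈ B, e.2 < 6)
    (s s' : Fin 6) : termsValue 6 (arrowTerms j i (B ++ [((s' : ℕ), 6), ((s : ℕ), 7)]))
      = -termsValue 6 (arrowTerms i j (B ++ [((s : ℕ), 6), ((s' : ℕ), 7)])) := by
  have hlen (v : ℕ) : (arrowsFrom (B ++ [((s' : ℕ), 6), ((s : ℕ), 7)]) v).length
      = (arrowsFrom (B ++ [((s : ℕ), 6), ((s' : ℕ), 7)]) v).length := by
    rw [arrowsFrom_append, arrowsFrom_append, arrowsFrom_pair, arrowsFrom_pair]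
    split_ifs <;> simp
  rw [termsValue_arrowTerms_eq, termsValue_arrowTerms_eq]
  simp only [hlen]
  by_cases h : ∀ v : Fin 6, (arrowsFrom (B ++ [((s : ℕ), 6), ((s' : ℕ), 7)]) v).length = 2
  · rw [if_pos h, if_pos h]
    have hprod : ∏ v : Fin 6, vertexBracket j i (B ++ [((s' : ℕ), 6), ((s : ℕ), 7)]) v
        = (if s = s' then -1 else 1 : ℝ)
          • ∏ v : Fin 6, vertexBracket i j (B ++ [((s : ℕ), 6), ((s' : ℕ), 7)]) v := by
      rw [Finset.prod_congr rfl fun (v : Fin 6) _ => vertexBracket_swap i j B hB s s' v (h v),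
        Finset.prod_mul_distrib]
      simp only [← Fin.ext_iff]
      rw [Finset.prod_ite_eq' Finset.univ s]
      split_ifs <;> simp_all
    have hinv := inversions_append_swap (B.map Prod.fst) s s'
    rw [hprod, map_smul, smul_smul, ← neg_smul, List.map_append, List.map_append]
    congr 1
    simp only [List.map_cons, List.map_nil]
    rcases lt_trichotomy s s' with h | rfl | h
    · have h' : (s : ℕ) < s' := h
      rw [if_neg (by omega), if_pos h', add_zero] at hinv
      rw [hinv, if_neg h.ne, pow_succ]
      ring
    · simp
    · have h' : (s' : ℕ) < s := h
      rw [if_pos h', if_neg (by omega), add_zero] at hinv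
      rw [← hinv, if_neg h.ne', pow_succ]
      ring
  · rw [if_neg h, if_neg h, neg_zero]

theorem orientJet_swap {m : ℕ} (g : EdgeGraph 6 m) (i j : Fin 2) :
    orientJet g j i = -orientJet g i j := by
  unfold orientJet
  rw [← Finset.sum_neg_distrib]
  refine Finset.sum_congr rfl fun o _ => ?_
  rw [← Finset.sum_neg_distrib, ← Equiv.sum_comp (Equiv.arrowCongr (Equiv.swap (0 : Fin 2) 1)
    (Equiv.refl (Fin 6)))]
  refine Finset.sum_congr rfl fun s _ => ?_
  rw [← termsValue_arrowTerms, ← termsValue_arrowTerms, arrowList_eq_append, arrowList_eq_append]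
  refine Eq.trans ?_ (termsValue_arrowTerms_swap i j _ (fun e he => ?_) (s 0) (s 1))
  · simp [Equiv.arrowCongr]
  · obtain ⟨a, rfl⟩ := (List.mem_ofFn' _ _).1 he
    dsimp only
    split_ifs
    · exact (g a).2.2
    · exact (g a).1.2

/-! ### The flow is a coboundary -/

-- The collected form is a certificate: the kernel expands all directings and checks that the
-- difference of the two lists cancels. Splitting the main identity this way separates two large
-- expansions from one small comparison.
set_option maxRecDepth 100000 in
theorem orientJet_pentagonWheel : orientJet pentagonWheel 0 1 = termsValue 6 wheelTerms := by
  rw [← termsValue_orientTerms, wheelEdges_eq]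
  have h : zeroTest (orientTerms wheelEdges 0 1 ++ scale (-1) wheelTerms) .leaf = true := by
    decide +kernel
  exact termsValue_eq_of_zeroTest h

set_option maxRecDepth 100000 in
theorem orientJet_prism : orientJet prism 0 1 = termsValue 6 prismTerms := by
  rw [← termsValue_orientTerms, prismEdges_eq]
  have h : zeroTest (orientTerms prismEdges 0 1 ++ scale (-1) prismTerms) .leaf = true := by
    decide +kernel
  exact termsValue_eq_of_zeroTest h

/-- Doubling clears the denominator of 5/2, so that the lists have integer coefficients. -/
theorem smul_schoutenJet_fieldJet :
    (2 : ℝ) • schoutenJet fieldJet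
      = (2 : ℝ) • termsValue 6 wheelTerms + (5 : ℝ) • termsValue 6 prismTerms := by
  have h : zeroTest ((derivHamTerms 32 1 2 ++ derivHamTerms 1 32 (-2))
      ++ scale (-1) (scale 2 wheelTerms ++ scale 5 prismTerms)) .leaf = true := by
    decide +kernel
  have h' := termsValue_eq_of_zeroTest h
  rw [termsValue_derivHamTerms, termsValue_append, termsValue_scale, termsValue_scale] at h'
  exact_mod_cast h'

theorem orientJet_eq (i j : Fin 2) :
    orientJet pentagonWheel i j + (5 / 2 : ℝ) • orientJet prism i j
      = eps i j • schoutenJet fieldJet := by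
  have h01 : orientJet pentagonWheel 0 1 + (5 / 2 : ℝ) • orientJet prism 0 1
      = schoutenJet fieldJet := by
    rw [orientJet_pentagonWheel, orientJet_prism]
    have h := congrArg (fun p : JetRing => (1 / 2 : ℝ) • p) smul_schoutenJet_fieldJet
    simp only [smul_add, smul_smul] at h
    norm_num at h
    exact h.symm
  -- Antisymmetry replaces a separate computation of the diagonal components.
  have hdiag {m : ℕ} (g : EdgeGraph 6 m) (i : Fin 2) : orientJet g i i = 0 :=
    self_eq_neg.1 (orientJet_swap g i i)
  fin_cases i <;> fin_cases j
  · change orientJet _ 0 0 + _ • orientJet _ 0 0 = (0 : ℝ) • _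
    simp [hdiag]
  · change orientJet _ 0 1 + _ • orientJet _ 0 1 = (1 : ℝ) • _
    rw [h01, one_smul]
  · change orientJet _ 1 0 + _ • orientJet _ 1 0 = (-1 : ℝ) • _
    rw [orientJet_swap _ 0 1, orientJet_swap _ 0 1, smul_neg, ← neg_add, h01, neg_one_smul]
  · change orientJet _ 1 1 + _ • orientJet _ 1 1 = (0 : ℝ) • _
    simp [hdiag]

theorem flow5_eq_schoutenBV {ϱ : Plane → ℝ} (hϱ : ContDiff ℝ ∞ ϱ) :
    flow5 (bivector ϱ) = schoutenBV (bivector ϱ) (field5 ϱ) := by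
  funext x i j
  rw [flow5_eq_jetEval hϱ, orientJet_eq, jetEval_smul,
    schoutenBV_eq_jetEval hϱ fieldJet (field5_eq_jetEval hϱ)]

/-! ### The numbers of graphs -/

theorem support_hamGraphs5 : hamGraphs5.support =
    {encoding ![![3, 4], ![4, 5], ![1, 2], ![1, 3]], encoding ![![3, 4], ![4, 5], ![1, 2], ![1, 4]],
      encoding ![![1, 5], ![1, 4], ![1, 2], ![1, 3]]} := by
  classical
  have h12 : encoding ![![3, 4], ![4, 5], ![1, 2], ![1, 3]]
      ≠ encoding ![![3, 4], ![4, 5], ![1, 2], ![1, 4]] := by decide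
  have h13 : encoding ![![3, 4], ![4, 5], ![1, 2], ![1, 3]]
      ≠ encoding ![![1, 5], ![1, 4], ![1, 2], ![1, 3]] := by decide
  have h23 : encoding ![![3, 4], ![4, 5], ![1, 2], ![1, 4]]
      ≠ encoding ![![1, 5], ![1, 4], ![1, 2], ![1, 3]] := by decide
  ext Γ
  simp only [Finsupp.mem_support_iff, Finset.mem_insert, Finset.mem_singleton, hamGraphs5,
    Finsupp.sub_apply]
  constructor
  · intro h
    by_contra hΓ
    push Not at hΓ
    simp [hΓ.1.symm, hΓ.2.1.symm, hΓ.2.2.symm] at h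
  · rintro (rfl | rfl | rfl)
    · simp [h12.symm, h13.symm]
    · simp [h12, h23.symm]
    · simp [h13, h23]

theorem card_support_hamGraphs5 : hamGraphs5.support.card = 3 := by
  rw [support_hamGraphs5]
  decide

theorem issueWedge_injective {n : ℕ} :
    Function.Injective fun q : WedgeGraph 1 n × Fin (n + 1) => issueWedge q.1 q.2 := by
  rintro ⟨Γ, i⟩ ⟨Γ', i'⟩ h
  simp only [issueWedge, Fin.cons_inj] at h
  obtain ⟨h0, hs⟩ := h
  have hi : i = i' := by simpa using congrFun h0 1
  have hΓ : Γ = Γ' := by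
    funext v s
    have h' := congrFun (congrFun hs v) s
    rcases hv : Γ v s with u | w <;> rcases hv' : Γ' v s with u' | w'
    · rw [Subsingleton.elim u u']
    · simp [hv, hv', (Fin.succ_ne_zero _).symm] at h'
    · simp [hv, hv', Fin.succ_ne_zero] at h'
    · simpa [hv, hv'] using h'
  rw [hi, hΓ]

/-- The pair (Γ, i) can be recovered from the new graph, so no two summands merge or cancel; this
gives the count 3 × 5. -/
theorem fieldGraphs5_issueWedge (Γ : WedgeGraph 1 4) (i : Fin 5) :
    fieldGraphs5 (issueWedge Γ i) = hamGraphs5 Γ := by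
  classical
  have h (Γ' : WedgeGraph 1 4) (i' : Fin 5) : issueWedge Γ' i' = issueWedge Γ i ↔ Γ' = Γ ∧ i' = i := by
    rw [← Prod.mk.injEq]
    exact issueWedge_injective.eq_iff (a := (Γ', i')) (b := (Γ, i))
  rw [fieldGraphs5, Finsupp.sum, Finsupp.finsetSum_apply]
  simp only [Finsupp.finsetSum_apply, Finsupp.single_apply, h, ite_and]
  simpa using fun h => h.symm

theorem card_support_fieldGraphs5 : fieldGraphs5.support.card = 15 := by
  classical
  have h : fieldGraphs5.support = (hamGraphs5.support ×ˢ (Finset.univ : Finset (Fin 5))).image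
      fun q => issueWedge q.1 q.2 := by
    ext Γ
    simp only [Finset.mem_image, Finset.mem_product, Finset.mem_univ, and_true, Prod.exists]
    constructor
    · intro hΓ
      obtain ⟨Γ', hΓ', h'⟩ := Finset.mem_biUnion.1 (Finsupp.support_sum hΓ)
      obtain ⟨i, -, hi⟩ := Finset.mem_biUnion.1 (Finsupp.support_finsetSum h')
      exact ⟨Γ', i, hΓ', (Finset.mem_singleton.1 (Finsupp.support_single_subset hi)).symm⟩
    · rintro ⟨Γ', i, hΓ', rfl⟩
      rw [Finsupp.mem_support_iff, fieldGraphs5_issueWedge]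
      exact Finsupp.mem_support_iff.1 hΓ'
  rw [h, Finset.card_image_of_injective _ issueWedge_injective, Finset.card_product,
    card_support_hamGraphs5, Finset.card_fin]

end GraphFlow

end

/-! ### The main theorem. -/

open GraphFlow in
theorem mainTheorem2 :
    -- the flow is a coboundary, with respect to the vector field `ω₂⁻¹(d Ham)`
    (∀ ϱ : Plane → ℝ, ContDiff ℝ ∞ ϱ →
      flow5 (bivector ϱ) = schoutenBV (bivector ϱ) (field5 ϱ)) ∧
    -- the Hamiltonian has three graphs, the vector field is encoded by 15 one-vector graphs
    hamGraphs5.support.card = 3 ∧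
    fieldGraphs5.support.card = 15 ∧
    (∀ Γ ∈ fieldGraphs5.support, IsOneVector Γ) ∧
    (∀ ϱ : Plane → ℝ, ContDiff ℝ ∞ ϱ →
      field5 ϱ = vectorOf fieldGraphs5 (bivector ϱ)) ∧
    -- uniqueness: all the solutions over one-vector graphs on five wedges
    (∀ c : WedgeGraph 1 5 →₀ ℝ, (∀ Γ ∈ c.support, IsOneVector Γ) →
      ((∀ ϱ : Plane → ℝ, ContDiff ℝ ∞ ϱ →
          flow5 (bivector ϱ) = schoutenBV (bivector ϱ) (vectorOf c (bivector ϱ))) ↔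
        ∃ h : WedgeGraph 0 4 →₀ ℝ, ∀ ϱ : Plane → ℝ, ContDiff ℝ ∞ ϱ →
          vectorOf c (bivector ϱ) =
            field5 ϱ + schoutenBF (bivector ϱ) (functionOf h (bivector ϱ)))) := by
  refine ⟨fun ϱ hϱ => flow5_eq_schoutenBV hϱ, card_support_hamGraphs5, card_support_fieldGraphs5,
    fun Γ hΓ => isOneVector_of_mem_support hΓ, fun ϱ hϱ => field5_eq_vectorOf hϱ, fun c hc => ?_⟩
  rw [← schouten_eq_iff hc]
  exact forall₂_congr fun ϱ hϱ => by rw [flow5_eq_schoutenBV hϱ]
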